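/- **Theorem 4.3.** Let $N\ge 2$, $\ell>0$, $g>0$, $\sigma>0$, $0\le r<\tfrac12$ and $s>0$. Let $\Sigma=\mathbb T^{N-1}=\mathbb R^{N-1}/\mathbb Z^{N-1}$ and $\Omega=\Sigma\times(0,\ell)$, with points $(x,y)$, and let $\hat f(\xi)=\int_\Sigma f(x)e^{-2\pi i\xi\cdot x}\,dx$, $\xi\in\mathbb Z^{N-1}$, be the Fourier transform in the horizontal variable $x$. Let $M$ be the Fourier multiplier $\widehat{M(h)}(\xi)=\mu(\xi)\hat h(\xi)$ with $\mu(\xi)=g+\sigma(2\pi|\xi|)^{2r}$. Let $V$ be the space of $v\in H^1(\Omega;\mathbb R^N)$ with $v=0$ on $\{y=0\}$ and $\operatorname{div}v=0$; its closure in $L^2(\Omega;\mathbb R^N)$ is embedded in $V^*$ by the $L^2$ inner product. Put $(\mathbb Du)_{ij}=\partial_iu_j+\partial_ju_i$. A weak solution with initial data $(u_0,h_0)$ is a pair $(u,h)$ with $u\in L^2_{\rm loc}([0,\infty);V)$, $\partial_tu\in L^2_{\rm loc}([0,\infty);V^*)$, $h,M(h)\in L^2_{\rm loc}([0,\infty);L^2(\Sigma))$,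 $\partial_th\in L^2_{\rm loc}([0,\infty);H^{1/2}(\Sigma))$ (weak time derivatives), such that for every $T>0$ and every $v\in L^2([0,T];V)$ $$[\partial_tu,v]_{V^*,V}+\tfrac12(\mathbb Du,\mathbb Dv)_{L^2(\Omega)}+\int_{\{y=\ell\}}M(h)\,v_N\,dx=0\quad\text{for a.e. }t\in(0,T),$$ $\partial_th=u_N$ on $\{y=\ell\}$ (in the sense of traces), $\int_\Sigma h(x,t)\,dx=0$, and $u=u_0$, $h=h_0$ at $t=0$. Then there is a constant $K>0$, depending only on $N,\ell,g,\sigma,r,s$, such that the following holds. Let $(u,h)$ be a weak solution with initial data $(u_0,h_0)$ satisfying $$\|u_0\|_{H^s_x(L^2_y)}^2=\int_0^\ell\sum_{\xi}(1+|\xi|^2)^s|\hat u_0(\xi,y)|^2\,dy<\infty,\qquad \|h_0\|_{H^{s+r}}^2=\sum_\xi(1+|\xi|^2)^{s+r}|\hat h_0(\xi)|^2<\infty .$$ Then $u$ and $h$ have representatives that are continuous in time on $[0,\infty)$ with values in $L^2(\Omega;\mathbb R^N)$ and $L^2(\Sigma)$, that take the values $u_0$ and $h_0$ at $t=0$, and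 for which the energy $$\mathcal E(t)=\tfrac12\int_\Omega|u(x,y,t)|^2\,dx\,dy+\tfrac12\sum_{\xi\in\mathbb Z^{N-1}}\mu(\xi)|\hat h(\xi,t)|^2$$ (the sum being $\int_\Sigma M(h)h\,dx$) satisfies $$\mathcal E(t)\le K\left(\|u_0\|_{H^s_x(L^2_y)}^2+\|h_0\|_{H^{s+r}}^2\right)(1+t)^{-\frac{s}{1/2-r}}\qquad\text{for all }t\ge0 .$$ -/

import Mathlib

open MeasureTheory Set Filter Topology
open scoped ENNReal ContDiff InnerProductSpace

noncomputable section

namespace FluidLayer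

/-! The flat torus `Σ = 𝕋ⁿ = ℝⁿ / ℤⁿ`, with `n = N - 1`, and the slab `Ω = Σ × (0, ℓ)`.
The `N = n + 1` coordinates are indexed by `Fin (n + 1)`: the horizontal directions are the
`Fin.castSucc i`, the vertical direction is `Fin.last n`. -/

/-- The Haar probability measure `dx` on the torus. -/
def torusMeasure (n : ℕ) : Measure (UnitAddTorus (Fin n)) :=
  Measure.pi fun _ => AddCircle.haarAddCircle

/-- The measure `dz = dx dy` on the slab `Ω = Σ × (0, ℓ)`. -/
def slabMeasure (n : ℕ) (ℓ : ℝ) : Measure (UnitAddTorus (Fin n) × ℝ) :=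
  (torusMeasure n).prod (volume.restrict (Ioo 0 ℓ))

/-- `L²(Σ; ℝ)`. -/
abbrev L2Torus (n : ℕ) : Type := Lp ℝ 2 (torusMeasure n)

/-- `L²(Ω; ℝᴺ)`. -/
abbrev L2Vec (n : ℕ) (ℓ : ℝ) : Type :=
  Lp (EuclideanSpace ℝ (Fin (n + 1))) 2 (slabMeasure n ℓ)

/-- `L²(Ω; ℝᴺˣᴺ)`; the entry `(i, j)` of a velocity gradient is `∂ᵢ uⱼ`. -/
abbrev L2Mat (n : ℕ) (ℓ : ℝ) : Type :=
  Lp (EuclideanSpace ℝ (Fin (n + 1) × Fin (n + 1))) 2 (slabMeasure n ℓ)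

/-! ### Fourier side -/

/-- The Euclidean length `|ξ|` of a frequency `ξ ∈ ℤⁿ`. -/
def freqNorm {n : ℕ} (ξ : Fin n → ℤ) : ℝ := √(∑ i, (ξ i : ℝ) ^ 2)

/-- `f̂(ξ) = ∫_Σ f(x) e^{-2πi ξ·x} dx` for a real-valued `f` on the torus. -/
def fourier {n : ℕ} (f : UnitAddTorus (Fin n) → ℝ) (ξ : Fin n → ℤ) : ℂ :=
  UnitAddTorus.mFourierCoeff (fun x => (f x : ℂ)) ξ

/-- The squared Sobolev norm `‖f‖²_{H^s(Σ)} = ∑_ξ (1 + |ξ|²)^s |f̂(ξ)|²`, possibly infinite. -/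
def sobolevSq {n : ℕ} (s : ℝ) (f : UnitAddTorus (Fin n) → ℝ) : ℝ≥0∞ :=
  ∑' ξ : Fin n → ℤ, ENNReal.ofReal ((1 + freqNorm ξ ^ 2) ^ s) * ‖fourier f ξ‖ₑ ^ 2

/-- The squared norm `‖u‖²_{H^s_x(L²_y)} = ∫₀^ℓ ∑_ξ (1 + |ξ|²)^s |û(ξ, y)|² dy` of a vector field
on the slab, the Fourier transform being horizontal; possibly infinite. -/
def sobolevSlabSq {n : ℕ} (ℓ s : ℝ)
    (u : UnitAddTorus (Fin n) × ℝ → EuclideanSpace ℝ (Fin (n + 1))) : ℝ≥0∞ :=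
  ∫⁻ y in Ioo 0 ℓ, ∑' ξ : Fin n → ℤ, ENNReal.ofReal ((1 + freqNorm ξ ^ 2) ^ s) *
    ∑ j, ‖fourier (fun x => u (x, y) j) ξ‖ₑ ^ 2

/-- `m = M(h)`, where `M` is the Fourier multiplier with symbol `μ`. -/
def IsMultiplierOf {n : ℕ} (μ : (Fin n → ℤ) → ℝ) (h m : L2Torus n) : Prop :=
  ∀ ξ, fourier m ξ = (μ ξ : ℂ) * fourier h ξ

/-- The symbol `μ(ξ) = g + σ (2π|ξ|)^{2r}` of `g + σ(-Δ)^r`. -/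
def fracSymbol {n : ℕ} (g σ r : ℝ) (ξ : Fin n → ℤ) : ℝ :=
  g + σ * (2 * Real.pi * freqNorm ξ) ^ (2 * r)

/-- The energy `½ ∫_Ω |u|² + ½ ∫_Σ M(h) h`, the quadratic form `∫_Σ M(h) h` being
`∑_ξ μ(ξ) |ĥ(ξ)|²` (possibly infinite, for an arbitrary `h ∈ L²` and a nonnegative symbol). -/
def energy {n : ℕ} {ℓ : ℝ} (μ : (Fin n → ℤ) → ℝ) (u : L2Vec n ℓ) (h : L2Torus n) : ℝ≥0∞ :=
  2⁻¹ * (∫⁻ z, ‖u z‖ₑ ^ 2 ∂slabMeasure n ℓ) +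
    2⁻¹ * ∑' ξ : Fin n → ℤ, ENNReal.ofReal (μ ξ) * ‖fourier h ξ‖ₑ ^ 2

/-! ### Weak derivatives, traces, and the space of divergence-free fields -/

/-- The displacement of length `s` in the coordinate direction `j`, in `Σ × ℝ`. -/
def displacement {n : ℕ} (j : Fin (n + 1)) (s : ℝ) : UnitAddTorus (Fin n) × ℝ :=
  Fin.lastCases (motive := fun _ => UnitAddTorus (Fin n) × ℝ) (0, s)
    (fun i => (Pi.single i (s : UnitAddCircle), 0)) j

/-- The classical partial derivative `∂ⱼ φ` of a function on `Σ × ℝ`. -/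
def partialDeriv {n : ℕ} (j : Fin (n + 1)) (φ : UnitAddTorus (Fin n) × ℝ → ℝ)
    (z : UnitAddTorus (Fin n) × ℝ) : ℝ :=
  deriv (fun s : ℝ => φ (z + displacement j s)) 0

/-- `φ` is a `C^∞` function on `Σ × ℝ`, i.e. its periodic lift to `ℝⁿ × ℝ` is. -/
def IsSmooth {n : ℕ} (φ : UnitAddTorus (Fin n) × ℝ → ℝ) : Prop :=
  ContDiff ℝ ∞ fun p : (Fin n → ℝ) × ℝ => φ (fun i => (p.1 i : UnitAddCircle), p.2)

/-- `w` is the weak derivative `∂ⱼ f` in `Ω`; test functions are compactly supported in `Ω`. -/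
def IsWeakPartial {n : ℕ} (ℓ : ℝ) (j : Fin (n + 1)) (f w : UnitAddTorus (Fin n) × ℝ → ℝ) : Prop :=
  ∀ φ : UnitAddTorus (Fin n) × ℝ → ℝ, IsSmooth φ → tsupport φ ⊆ univ ×ˢ Ioo 0 ℓ →
    ∫ z, f z * partialDeriv j φ z ∂slabMeasure n ℓ = -∫ z, w z * φ z ∂slabMeasure n ℓ

/-- For `f ∈ H¹(Ω)` with `∂_y f = w`: the trace of `f` on `{y = 0}` vanishes. The trace is
identified by integration by parts against functions smooth up to the boundary that vanish on
`{y = ℓ}`. -/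
def VanishesAtBottom {n : ℕ} (ℓ : ℝ) (f w : UnitAddTorus (Fin n) × ℝ → ℝ) : Prop :=
  ∀ φ : UnitAddTorus (Fin n) × ℝ → ℝ, IsSmooth φ → (∀ x, φ (x, ℓ) = 0) →
    ∫ z, (f z * partialDeriv (Fin.last n) φ z + w z * φ z) ∂slabMeasure n ℓ = 0

/-- For `f ∈ H¹(Ω)` with `∂_y f = w`: the trace of `f` on `{y = ℓ}` is `b`. The trace is
identified by integration by parts against functions smooth up to the boundary that vanish on
`{y = 0}`. -/
def HasTopTrace {n : ℕ} (ℓ : ℝ) (f w : UnitAddTorus (Fin n) × ℝ → ℝ) (b : L2Torus n) : Prop :=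
  ∀ φ : UnitAddTorus (Fin n) × ℝ → ℝ, IsSmooth φ → (∀ x, φ (x, 0) = 0) →
    ∫ z, (f z * partialDeriv (Fin.last n) φ z + w z * φ z) ∂slabMeasure n ℓ =
      ∫ x, b x * φ (x, ℓ) ∂torusMeasure n

/-- Membership in the space of `u ∈ H¹(Ω; ℝᴺ)` with `u = 0` on `{y = 0}` and `div u = 0`, where
`G = ∇u`. -/
structure IsDivFreeField {n : ℕ} {ℓ : ℝ} (u : L2Vec n ℓ) (G : L2Mat n ℓ) : Prop where
  grad : ∀ i j, IsWeakPartial ℓ i (fun z => u z j) (fun z => G z (i, j))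
  bottom : ∀ j, VanishesAtBottom ℓ (fun z => u z j) (fun z => G z (Fin.last n, j))
  div_free : ∀ᵐ z ∂slabMeasure n ℓ, ∑ i, G z (i, i) = 0

/-! Test functions and their derivatives are bounded on the slab, so that every integral above is
that of an integrable function; this makes the space below a linear space. -/

theorem isOpenQuotientMap_lift (n : ℕ) : IsOpenQuotientMap
    (fun p : (Fin n → ℝ) × ℝ => ((fun i => (p.1 i : UnitAddCircle), p.2) :
      UnitAddTorus (Fin n) × ℝ)) := by
  have h1 : IsOpenQuotientMap (fun x : Fin n → ℝ => (fun i => (x i : UnitAddCircle))) :=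
    IsOpenQuotientMap.piMap fun _ => QuotientAddGroup.isOpenQuotientMap_mk
  exact h1.prodMap IsOpenQuotientMap.id

theorem IsSmooth.continuous {n : ℕ} {φ : UnitAddTorus (Fin n) × ℝ → ℝ} (hφ : IsSmooth φ) :
    Continuous φ :=
  (isOpenQuotientMap_lift n).continuous_comp_iff.1 (ContDiff.continuous hφ)

theorem IsSmooth.continuous_partialDeriv {n : ℕ} {φ : UnitAddTorus (Fin n) × ℝ → ℝ}
    (hφ : IsSmooth φ) (j : Fin (n + 1)) : Continuous (partialDeriv j φ) := by
  refine (isOpenQuotientMap_lift n).continuous_comp_iff.1 ?_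
  set F : (Fin n → ℝ) × ℝ → ℝ :=
    fun p => φ (fun i => (p.1 i : UnitAddCircle), p.2) with hF
  have hFd : ContDiff ℝ ∞ F := hφ
  let e : (Fin n → ℝ) × ℝ :=
    Fin.lastCases (motive := fun _ => (Fin n → ℝ) × ℝ) (0, 1) (fun i => (Pi.single i 1, 0)) j
  have key : (partialDeriv j φ ∘ fun p : (Fin n → ℝ) × ℝ =>
      ((fun i => (p.1 i : UnitAddCircle), p.2) : UnitAddTorus (Fin n) × ℝ)) =
      fun p => fderiv ℝ F p e := by
    funext p
    have hline : (fun s : ℝ => φ (((fun i => (p.1 i : UnitAddCircle), p.2) :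
        UnitAddTorus (Fin n) × ℝ) + displacement j s)) = fun s : ℝ => F (p + s • e) := by
      funext s
      simp only [hF, e, displacement]
      congr 1
      refine Fin.lastCases ?_ (fun i => ?_) j
      · simp
      · simp only [Fin.lastCases_castSucc]
        ext k
        · by_cases hk : k = i
          · subst hk; simp
          · simp [hk]
        · simp
    simp only [Function.comp, partialDeriv]
    rw [hline]
    have h1 : HasFDerivAt F (fderiv ℝ F (p + (0 : ℝ) • e)) (p + (0 : ℝ) • e) :=
      (hFd.differentiable (by simp)).differentiableAt.hasFDerivAt
    have h2 : HasDerivAt (fun s : ℝ => p + s • e) e 0 := by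
      simpa using ((hasDerivAt_id (0 : ℝ)).smul_const e).const_add p
    simpa [Function.comp_def] using (h1.comp_hasDerivAt (0 : ℝ) h2).deriv
  rw [key]
  exact (hFd.continuous_fderiv (by simp)).clm_apply continuous_const

instance (n : ℕ) : IsProbabilityMeasure (torusMeasure n) := by
  unfold torusMeasure; infer_instance

instance (n : ℕ) (ℓ : ℝ) : IsFiniteMeasure (slabMeasure n ℓ) := by
  unfold slabMeasure; infer_instance

theorem memLp_of_continuous {n : ℕ} (ℓ : ℝ) {φ : UnitAddTorus (Fin n) × ℝ → ℝ}
    (hφ : Continuous φ) : MemLp φ 2 (slabMeasure n ℓ) := by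
  obtain ⟨C, hC⟩ := ((isCompact_univ.prod isCompact_Icc :
    IsCompact ((univ : Set (UnitAddTorus (Fin n))) ×ˢ Icc 0 ℓ))).exists_bound_of_continuousOn
      hφ.continuousOn
  refine MemLp.of_bound hφ.aestronglyMeasurable C ?_
  have hae : ∀ᵐ z ∂slabMeasure n ℓ, z ∈ (univ : Set (UnitAddTorus (Fin n))) ×ˢ Ioo 0 ℓ := by
    have : slabMeasure n ℓ = ((torusMeasure n).prod volume).restrict
        ((univ : Set (UnitAddTorus (Fin n))) ×ˢ Ioo 0 ℓ) := by
      rw [← Measure.prod_restrict, Measure.restrict_univ, slabMeasure]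
    rw [this]
    exact ae_restrict_mem (MeasurableSet.univ.prod measurableSet_Ioo)
  filter_upwards [hae] with z hz
  exact hC z ⟨hz.1, Ioo_subset_Icc_self hz.2⟩

theorem integrable_coord_mul {n : ℕ} {ℓ : ℝ} {ι : Type*} [Fintype ι]
    (u : Lp (EuclideanSpace ℝ ι) 2 (slabMeasure n ℓ)) (j : ι)
    {φ : UnitAddTorus (Fin n) × ℝ → ℝ} (hφ : Continuous φ) :
    Integrable (fun z => u z j * φ z) (slabMeasure n ℓ) := by
  have h : MemLp (fun z => u z j) 2 (slabMeasure n ℓ) :=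
    (EuclideanSpace.proj (𝕜 := ℝ) j).comp_memLp' (Lp.memLp u)
  exact h.integrable_mul (memLp_of_continuous ℓ hφ)

theorem integral_add_mul {n : ℕ} {ℓ : ℝ} {ι : Type*} [Fintype ι]
    (u v : Lp (EuclideanSpace ℝ ι) 2 (slabMeasure n ℓ)) (j : ι)
    {φ : UnitAddTorus (Fin n) × ℝ → ℝ} (hφ : Continuous φ) :
    ∫ z, (u + v) z j * φ z ∂slabMeasure n ℓ =
      ∫ z, u z j * φ z ∂slabMeasure n ℓ + ∫ z, v z j * φ z ∂slabMeasure n ℓ := by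
  rw [← integral_add (integrable_coord_mul u j hφ) (integrable_coord_mul v j hφ)]
  refine integral_congr_ae ?_
  filter_upwards [Lp.coeFn_add u v] with z hz
  rw [hz]
  simp [add_mul]

theorem integral_smul_mul {n : ℕ} {ℓ : ℝ} {ι : Type*} [Fintype ι]
    (c : ℝ) (u : Lp (EuclideanSpace ℝ ι) 2 (slabMeasure n ℓ)) (j : ι)
    (φ : UnitAddTorus (Fin n) × ℝ → ℝ) :
    ∫ z, (c • u) z j * φ z ∂slabMeasure n ℓ = c * ∫ z, u z j * φ z ∂slabMeasure n ℓ := by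
  rw [← integral_const_mul]
  refine integral_congr_ae ?_
  filter_upwards [Lp.coeFn_smul c u] with z hz
  rw [hz]
  simp [mul_assoc]

theorem integral_zero_mul {n : ℕ} {ℓ : ℝ} {ι : Type*} [Fintype ι] (j : ι)
    (φ : UnitAddTorus (Fin n) × ℝ → ℝ) :
    ∫ z, (0 : Lp (EuclideanSpace ℝ ι) 2 (slabMeasure n ℓ)) z j * φ z ∂slabMeasure n ℓ = 0 := by
  refine (integral_congr_ae ?_).trans (integral_zero _ _)
  filter_upwards [Lp.coeFn_zero (EuclideanSpace ℝ ι) 2 (slabMeasure n ℓ)] with z hz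
  rw [hz]
  simp

/-- The space of divergence-free `u ∈ H¹(Ω; ℝᴺ)` with `u = 0` on `{y = 0}`. An element is the pair
`(u, ∇u)`, so that the norm inherited from `L² × L²` is the `H¹(Ω)` norm. -/
def divFree (n : ℕ) (ℓ : ℝ) : Submodule ℝ (WithLp 2 (L2Vec n ℓ × L2Mat n ℓ)) where
  carrier := {p | IsDivFreeField p.fst p.snd}
  zero_mem' := by
    refine ⟨fun i j φ _ _ => ?_, fun j φ hφ _ => ?_, ?_⟩
    · simp only [WithLp.zero_fst, WithLp.zero_snd]
      rw [integral_zero_mul j, integral_zero_mul (i, j), neg_zero]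
    · simp only [WithLp.zero_fst, WithLp.zero_snd]
      rw [integral_add (integrable_coord_mul _ _ (hφ.continuous_partialDeriv _))
        (integrable_coord_mul _ (Fin.last n, j) hφ.continuous),
        integral_zero_mul j, integral_zero_mul (Fin.last n, j), add_zero]
    · simp only [WithLp.zero_snd]
      filter_upwards [Lp.coeFn_zero (EuclideanSpace ℝ (Fin (n + 1) × Fin (n + 1))) 2
        (slabMeasure n ℓ)] with z hz
      rw [hz]
      simp
  add_mem' := by
    intro p q hp hq
    refine ⟨fun i j φ hφ hs => ?_, fun j φ hφ hb => ?_, ?_⟩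
    · simp only [WithLp.add_fst, WithLp.add_snd]
      rw [integral_add_mul _ _ _ (hφ.continuous_partialDeriv i),
        integral_add_mul _ _ (i, j) hφ.continuous, hp.grad i j φ hφ hs, hq.grad i j φ hφ hs,
        neg_add]
    · have h1 := hp.bottom j φ hφ hb
      have h2 := hq.bottom j φ hφ hb
      simp only [WithLp.add_fst, WithLp.add_snd]
      rw [integral_add (integrable_coord_mul _ _ (hφ.continuous_partialDeriv _))
        (integrable_coord_mul _ (Fin.last n, j) hφ.continuous)] at h1 h2 ⊢
      rw [integral_add_mul _ _ _ (hφ.continuous_partialDeriv _),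
        integral_add_mul _ _ (Fin.last n, j) hφ.continuous]
      linarith
    · simp only [WithLp.add_snd]
      filter_upwards [hp.div_free, hq.div_free, Lp.coeFn_add p.snd q.snd] with z h1 h2 h3
      rw [h3]
      simp only [Pi.add_apply, PiLp.add_apply, Finset.sum_add_distrib, h1, h2, add_zero]
  smul_mem' := by
    intro c p hp
    refine ⟨fun i j φ hφ hs => ?_, fun j φ hφ hb => ?_, ?_⟩
    · simp only [WithLp.smul_fst, WithLp.smul_snd]
      rw [integral_smul_mul, integral_smul_mul c _ (i, j), hp.grad i j φ hφ hs, mul_neg]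
    · have h1 := hp.bottom j φ hφ hb
      simp only [WithLp.smul_fst, WithLp.smul_snd]
      rw [integral_add (integrable_coord_mul _ _ (hφ.continuous_partialDeriv _))
        (integrable_coord_mul _ (Fin.last n, j) hφ.continuous)] at h1 ⊢
      rw [integral_smul_mul, integral_smul_mul c _ (Fin.last n, j), ← mul_add, h1, mul_zero]
    · simp only [WithLp.smul_snd]
      filter_upwards [hp.div_free, Lp.coeFn_smul c p.snd] with z h1 h3
      rw [h3]
      simp only [Pi.smul_apply, PiLp.smul_apply, smul_eq_mul, ← Finset.mul_sum, h1, mul_zero]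

/-! ### Weak solutions -/

/-- `f ∈ L²_loc([0, ∞); E)`. -/
def MemL2Loc {E : Type*} [NormedAddCommGroup E] (f : ℝ → E) : Prop :=
  ∀ T : ℝ, 0 < T → MemLp f 2 (volume.restrict (Ioo 0 T))

/-- On `(0, ∞)` the weak derivative of `a` is `b`, and the initial value of `a` is `a₀`. (Test
functions supported in `(0, ∞)` say the first, the remaining ones the second.) -/
def HasWeakDerivFrom (a₀ : ℝ) (a b : ℝ → ℝ) : Prop :=
  ∀ φ : ℝ → ℝ, ContDiff ℝ ∞ φ → HasCompactSupport φ →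
    ∫ t in Ioi 0, deriv φ t * a t = -(φ 0 * a₀) - ∫ t in Ioi 0, φ t * b t

/-- The component `v_j` of an element of the space of divergence-free fields. -/
def comp {n : ℕ} {ℓ : ℝ} (v : divFree n ℓ) (j : Fin (n + 1)) :
    UnitAddTorus (Fin n) × ℝ → ℝ :=
  fun z => v.1.fst z j

/-- The weak derivative `∂ᵢ v_j` of an element of the space of divergence-free fields. -/
def dcomp {n : ℕ} {ℓ : ℝ} (v : divFree n ℓ) (i j : Fin (n + 1)) :
    UnitAddTorus (Fin n) × ℝ → ℝ :=
  fun z => v.1.snd z (i, j)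

/-- The `L²(Ω)` inner product `(𝔻u, 𝔻v)`, where `(𝔻u)_{ij} = ∂ᵢ uⱼ + ∂ⱼ uᵢ`. -/
def symGradInner {n : ℕ} {ℓ : ℝ} (u v : divFree n ℓ) : ℝ :=
  ∫ z, ∑ i, ∑ j, (dcomp u i j z + dcomp u j i z) * (dcomp v i j z + dcomp v j i z)
    ∂slabMeasure n ℓ

/-- `b` is the trace on `{y = ℓ}` of the vertical component `v_N`. -/
def IsTopTraceOf {n : ℕ} {ℓ : ℝ} (v : divFree n ℓ) (b : L2Torus n) : Prop :=
  HasTopTrace ℓ (comp v (Fin.last n)) (dcomp v (Fin.last n) (Fin.last n)) b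

/-- `(u, h)` is a weak solution with initial data `(u₀, h₀)`, where `du = ∂ₜu` takes values in the
dual of the space of divergence-free fields, `dh = ∂ₜh` and `mh = M(h)`. -/
structure IsWeakSolutionWith {n : ℕ} {ℓ : ℝ} (μ : (Fin n → ℤ) → ℝ)
    (u₀ : L2Vec n ℓ) (h₀ : L2Torus n) (u : ℝ → divFree n ℓ) (h : ℝ → L2Torus n)
    (du : ℝ → (divFree n ℓ →L[ℝ] ℝ)) (dh mh : ℝ → L2Torus n) : Prop where
  u_mem : MemL2Loc u
  du_mem : MemL2Loc du
  h_mem : MemL2Loc h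
  mh_mem : MemL2Loc mh
  mh_eq : ∀ᵐ t ∂volume.restrict (Ioi 0), IsMultiplierOf μ (h t) (mh t)
  /-- `∂ₜh ∈ L²_loc([0, ∞); H^{1/2}(Σ))`, in two fields. -/
  dh_meas : ∀ T : ℝ, 0 < T → AEStronglyMeasurable dh (volume.restrict (Ioo 0 T))
  dh_mem : ∀ T : ℝ, 0 < T → ∫⁻ t in Ioo 0 T, sobolevSq (1 / 2) (dh t) < ⊤
  /-- `u₀` lies in the `L²` closure of the divergence-free fields, which is embedded in the dual
  space by the `L²` inner product; the derivative and the initial value of `u` are taken there. -/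
  u_init : u₀ ∈ closure (range fun v : divFree n ℓ => v.1.fst)
  u_deriv : ∀ v : divFree n ℓ,
    HasWeakDerivFrom ⟪u₀, v.1.fst⟫_ℝ (fun t => ⟪(u t).1.fst, v.1.fst⟫_ℝ) (fun t => du t v)
  h_deriv : ∀ ψ : L2Torus n,
    HasWeakDerivFrom ⟪h₀, ψ⟫_ℝ (fun t => ⟪h t, ψ⟫_ℝ) (fun t => ⟪dh t, ψ⟫_ℝ)
  /-- `[∂ₜu, v] + ½ (𝔻u, 𝔻v) + ∫_{y = ℓ} M(h) v_N = 0` for all `v ∈ L²_T`, for a.e. `t`;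
  `b` is the trace of `v_N`. -/
  momentum : ∀ T : ℝ, 0 < T → ∀ v : ℝ → divFree n ℓ, MemLp v 2 (volume.restrict (Ioo 0 T)) →
    ∀ b : ℝ → L2Torus n, (∀ᵐ t ∂volume.restrict (Ioo 0 T), IsTopTraceOf (v t) (b t)) →
      ∀ᵐ t ∂volume.restrict (Ioo 0 T),
        du t (v t) + 1 / 2 * symGradInner (u t) (v t) +
          ∫ x, mh t x * b t x ∂torusMeasure n = 0
  /-- `∂ₜh = u_N` on `{y = ℓ}`. -/
  kinematic : ∀ᵐ t ∂volume.restrict (Ioi 0), IsTopTraceOf (u t) (dh t)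
  zero_avg : ∀ᵐ t ∂volume.restrict (Ioi 0), ∫ x, h t x ∂torusMeasure n = 0

/-- `(u, h)` is a weak solution, with initial data `(u₀, h₀)`, of the linearized free boundary
problem on the slab `𝕋ⁿ × (0, ℓ)` whose boundary operator has the symbol `μ`. Here `u` and `h`
matter only up to a null set of times. -/
def IsWeakSolution {n : ℕ} {ℓ : ℝ} (μ : (Fin n → ℤ) → ℝ)
    (u₀ : L2Vec n ℓ) (h₀ : L2Torus n) (u : ℝ → divFree n ℓ) (h : ℝ → L2Torus n) : Prop :=
  ∃ (du : ℝ → (divFree n ℓ →L[ℝ] ℝ)) (dh mh : ℝ → L2Torus n),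
    IsWeakSolutionWith μ u₀ h₀ u h du dh mh

end FluidLayer

end

open MeasureTheory Set Filter Topology
open scoped ENNReal ContDiff InnerProductSpace

noncomputable section

namespace FluidLayer

/-! The equations are invariant under horizontal translations, so the problem decouples over the
frequencies `ξ`. At each frequency the energy decays exponentially, at a rate that degenerates like
`|ξ|^(2r-1)` as `|ξ| → ∞`; the `s` extra derivatives of the data turn this degeneration into an
algebraic rate.

Localization. The projector at `ξ` is `P w = ∫ cos(2π ξ·a) w(· + a) da`. It is an average of
translations, so it acts alike on `V`, on `L²` and on traces, and commutes with every operator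
involved (`ContractionFamily.average_intertwine`, `IsTopTraceOf.average`). Hence `P u` is an
admissible test field, and no complexification is needed. Moreover `⟪P w, w⟫` is exactly the squared
Fourier coefficient of `w` at `ξ`, integrated in `y` (`inner_average_self`), so these forms add up
to `‖w‖²` by Parseval.

Decay at one frequency. Put `X = ⟪P u, u⟫`, `B = ⟪P 𝔻u, 𝔻u⟫`, and let `c, d` be the cosine and sine
coefficients of `h`. Testing with `P u` gives `(X + μ (c² + d²))' = -B`. Korn's inequality
(`korn_average`) bounds `X` by `B`, but nothing here damps `h`. That damping comes from testing with
`P v` for fixed fields `v` whose normal trace is `cos(2π ξ·x)` or `sin(2π ξ·x)`: the momentum `p =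
⟪P u, v⟫` satisfies `p' = -½ ⟪P 𝔻u, 𝔻v⟫ - ½ μ c`, and similarly for `q` and `d`. Adding `ε (p c + q
d)` to half of `X + μ (c² + d²)` produces a Lyapunov functional (`lyapunov_decay`). The price is
`‖∇v‖²`, and a boundary layer of thickness `1/|ξ|` makes it `O(|ξ|)` (`exists_trace_lift`). The
resulting constraint `ε |ξ| ≲ μ(ξ)` allows `ε ~ |ξ|^(2r-1)` (`exists_decay_rate`). At `ξ = 0` the
zero average of `h` leaves only `X`, and Korn's inequality suffices.

Summation. With `q = s / (1/2 - r)`, the bound `exp(-ρ y t) ≲ y^(-q) (1+t)^(-q)` at `y =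
(1+|ξ|²)^(-(1/2-r))` costs the weight `(1+|ξ|²)^s` (`exp_neg_le_mul_rpow`), and `μ ≲ (1+|ξ|²)^r`
accounts for the norm of `h₀`.

Time regularity. Pairing `∂ₜu` with `P u` is justified by a Lions–Magenes lemma, proved with Steklov
averages (`exists_continuous_representative`), which also supplies the continuous representatives.
-/

section

/-! ### Primitives of integrable functions -/

/-- On `[0, T]`, `f` is a primitive of the integrable function `f'`. -/
structure IsPrimitiveOn (T : ℝ) (f f' : ℝ → ℝ) : Prop where
  integrable : IntervalIntegrable f' volume 0 T
  eq : ∀ t ∈ Icc 0 T, f t = f 0 + ∫ s in 0..t, f' s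

namespace IsPrimitiveOn

variable {T : ℝ} {f f' g g' : ℝ → ℝ}

theorem add (hf : IsPrimitiveOn T f f') (hg : IsPrimitiveOn T g g') :
    IsPrimitiveOn T (fun t => f t + g t) (fun t => f' t + g' t) where
  integrable := hf.integrable.add hg.integrable
  eq t ht := by
    have hsub : uIcc 0 t ⊆ uIcc 0 T := by
      rw [uIcc_of_le ht.1, uIcc_of_le (ht.1.trans ht.2)]; exact Icc_subset_Icc_right ht.2
    rw [intervalIntegral.integral_add (hf.integrable.mono_set hsub) (hg.integrable.mono_set hsub),
      hf.eq t ht, hg.eq t ht]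
    ring

theorem const_mul (c : ℝ) (hf : IsPrimitiveOn T f f') :
    IsPrimitiveOn T (fun t => c * f t) (fun t => c * f' t) where
  integrable := hf.integrable.const_mul c
  eq t ht := by
    rw [intervalIntegral.integral_const_mul, hf.eq t ht]
    ring

/-- Since `f` is arbitrary off `[0, T]`, absolute continuity and a.e. differentiability are stated
for the primitive itself, which is defined on all of `ℝ`. -/
theorem exists_absolutelyContinuous (hT : 0 ≤ T) (hf : IsPrimitiveOn T f f') :
    ∃ F : ℝ → ℝ, EqOn F f (Icc 0 T) ∧ AbsolutelyContinuousOnInterval F 0 T ∧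
      ∀ᵐ t, t ∈ Icc 0 T → HasDerivAt F (f' t) t := by
  have hconst : AbsolutelyContinuousOnInterval (fun _ : ℝ => f 0) 0 T :=
    ((LipschitzWith.const (f 0)).lipschitzOnWith (s := uIcc 0 T)).absolutelyContinuousOnInterval
  refine ⟨fun t => f 0 + ∫ s in 0..t, f' s, fun t ht => (hf.eq t ht).symm,
    hconst.fun_add
      (hf.integrable.absolutelyContinuousOnInterval_intervalIntegral left_mem_uIcc), ?_⟩
  filter_upwards [hf.integrable.ae_hasDerivAt_integral] with t ht htm
  rw [uIcc_of_le hT] at ht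
  exact (ht htm 0 ⟨le_rfl, hT⟩).const_add _

theorem continuousOn (hT : 0 ≤ T) (hf : IsPrimitiveOn T f f') : ContinuousOn f (Icc 0 T) := by
  obtain ⟨F, h1, h2, -⟩ := hf.exists_absolutelyContinuous hT
  have := h2.continuousOn
  rw [uIcc_of_le hT] at this
  exact this.congr h1.symm

theorem mul (hT : 0 ≤ T) (hf : IsPrimitiveOn T f f') (hg : IsPrimitiveOn T g g') :
    IsPrimitiveOn T (fun t => f t * g t) (fun t => f' t * g t + f t * g' t) := by
  have hf_c := hf.continuousOn hT
  have hg_c := hg.continuousOn hT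
  refine ⟨(hf.integrable.mul_continuousOn ?_).add (hg.integrable.continuousOn_mul ?_), ?_⟩
  · rwa [uIcc_of_le hT]
  · rwa [uIcc_of_le hT]
  intro t ht
  obtain ⟨F, hF1, hF2, hF3⟩ := hf.exists_absolutelyContinuous hT
  obtain ⟨G, hG1, hG2, hG3⟩ := hg.exists_absolutelyContinuous hT
  have hsub : uIcc 0 t ⊆ uIcc 0 T := by
    rw [uIcc_of_le ht.1, uIcc_of_le hT]; exact Icc_subset_Icc_right ht.2
  have key := (hF2.mono hsub).integral_deriv_mul_eq_sub (hG2.mono hsub)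
  have h0 : (0 : ℝ) ∈ Icc 0 T := ⟨le_rfl, hT⟩
  rw [hF1 ht, hG1 ht, hF1 h0, hG1 h0] at key
  rw [← sub_eq_iff_eq_add', ← key]
  refine intervalIntegral.integral_congr_ae ?_
  filter_upwards [hF3, hG3] with s h3 h4 hs
  rw [uIoc_of_le ht.1] at hs
  have hs' : s ∈ Icc 0 T := ⟨hs.1.le, hs.2.trans ht.2⟩
  rw [(h3 hs').deriv, (h4 hs').deriv, hF1 hs', hG1 hs']

theorem of_hasDerivAt (h : ∀ t, HasDerivAt f (f' t) t) (hc : Continuous f') :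
    IsPrimitiveOn T f f' where
  integrable := hc.intervalIntegrable _ _
  eq t ht := by
    rw [intervalIntegral.integral_eq_sub_of_hasDerivAt (fun s _ => h s)
      (hc.intervalIntegrable _ _)]
    ring

/-- Grönwall's inequality. -/
theorem le_exp_mul (hT : 0 ≤ T) (hf : IsPrimitiveOn T f f') (κ : ℝ)
    (h : ∀ᵐ t ∂volume.restrict (Ioo 0 T), f' t ≤ -κ * f t) :
    ∀ t ∈ Icc 0 T, f t ≤ Real.exp (-κ * t) * f 0 := by
  intro t ht
  have hexp : IsPrimitiveOn T (fun t => Real.exp (κ * t)) (fun t => Real.exp (κ * t) * κ) :=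
    of_hasDerivAt (fun t => by simpa using ((hasDerivAt_id t).const_mul κ).exp)
      (by fun_prop)
  have hp := (hexp.mul hT hf).eq t ht
  have hle : ∫ s in 0..t, (Real.exp (κ * s) * κ * f s + Real.exp (κ * s) * f' s) ≤ 0 := by
    rw [intervalIntegral.integral_of_le ht.1]
    refine integral_nonpos_of_ae ?_
    rw [← restrict_Ioo_eq_restrict_Ioc]
    have := ae_mono (Measure.restrict_mono_set volume (Ioo_subset_Ioo_right ht.2)) h
    filter_upwards [this] with s hs
    have := mul_le_mul_of_nonneg_left hs (Real.exp_pos (κ * s)).le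
    simp only [Pi.zero_apply]
    linarith
  have h2 : Real.exp (κ * t) * f t ≤ f 0 := by
    have : Real.exp (κ * 0) * f 0 = f 0 := by simp
    linarith
  have h3 : f t = Real.exp (-κ * t) * (Real.exp (κ * t) * f t) := by
    rw [← mul_assoc, ← Real.exp_add]; simp
  rw [h3]
  exact mul_le_mul_of_nonneg_left h2 (Real.exp_pos _).le

end IsPrimitiveOn

/-! ### Functions with a weak derivative are primitives -/

/-- The du Bois-Reymond lemma with an initial value. Test functions vanish near `T` but are free at
`0`, so any `ψ` in `C_c^∞(0, T)` is an admissible `φ'`, and no mean-zero condition remains: the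
boundary term identifies the constant as `a₀`. It serves in the time variable and again in the
vertical variable. -/
theorem ae_eq_primitive_of_weakDeriv {T a₀ : ℝ} (hT : 0 < T) {a b : ℝ → ℝ}
    (ha : IntegrableOn a (Ioo 0 T)) (hb : IntegrableOn b (Ioo 0 T))
    (h : ∀ φ : ℝ → ℝ, ContDiff ℝ ∞ φ → (∃ S < T, ∀ t, S ≤ t → φ t = 0) →
      ∫ t in Ioo 0 T, deriv φ t * a t = -(φ 0 * a₀) - ∫ t in Ioo 0 T, φ t * b t) :
    ∀ᵐ t ∂volume.restrict (Ioo 0 T), a t = a₀ + ∫ s in 0..t, b s := by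
  have hbi : IntervalIntegrable b volume 0 T := by
    rw [intervalIntegrable_iff_integrableOn_Ioo_of_le hT.le]; exact hb
  have hB : IsPrimitiveOn T (fun t => ∫ s in 0..t, b s) b := ⟨hbi, fun t _ => by simp⟩
  have hBc := hB.continuousOn hT.le
  have hBi : IntegrableOn (fun t => ∫ s in 0..t, b s) (Ioo 0 T) :=
    (hBc.integrableOn_Icc).mono_set Ioo_subset_Icc_self
  have hdi : IntegrableOn (fun t => a t - a₀ - ∫ s in 0..t, b s) (Ioo 0 T) :=
    (ha.sub (integrableOn_const (by simp))).sub hBi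
  rw [ae_restrict_iff' measurableSet_Ioo]
  have key := isOpen_Ioo.ae_eq_zero_of_integral_contDiff_smul_eq_zero (μ := volume)
    (hdi.locallyIntegrableOn) (fun ψ hψ hψc hψs => ?_)
  · filter_upwards [key] with t ht htm
    linarith [ht htm]
  have hψi : ∀ x y, IntervalIntegrable ψ volume x y := fun x y =>
    hψ.continuous.intervalIntegrable x y
  -- The primitive of `ψ` normalized at `T` rather than at `0`: it vanishes past the support of `ψ`,
  -- and `φ 0 = -∫ ψ`.
  set φ : ℝ → ℝ := fun t => (∫ s in 0..t, ψ s) - ∫ s in 0..T, ψ s with hφ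
  have hφd : ∀ t, HasDerivAt φ (ψ t) t := fun t =>
    (intervalIntegral.integral_hasDerivAt_right (hψi 0 t)
      (hψ.continuous.stronglyMeasurableAtFilter _ _) hψ.continuous.continuousAt).sub_const _
  have hφ' : deriv φ = ψ := funext fun t => (hφd t).deriv
  have hφs : ContDiff ℝ ∞ φ := by
    rw [contDiff_infty_iff_deriv]
    exact ⟨fun t => (hφd t).differentiableAt, by rw [hφ']; exact hψ⟩
  have hzero : ∃ S < T, ∀ t, S ≤ t → φ t = 0 := by
    by_cases hne : (tsupport ψ).Nonempty
    · obtain ⟨S, hS, hSmax⟩ := hψc.isCompact.exists_isGreatest hne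
      refine ⟨S, (hψs hS).2, fun t ht => ?_⟩
      have : ∫ s in t..T, ψ s = 0 := by
        rw [← intervalIntegral.integral_zero (a := t) (b := T) (μ := volume)]
        refine intervalIntegral.integral_congr_ae ?_
        have : ∀ᵐ x : ℝ, x ≠ S := by simp [ae_iff, measure_singleton]
        filter_upwards [this] with x hxS hx
        refine image_eq_zero_of_notMem_tsupport fun hxm => ?_
        have h1 := hSmax hxm
        have h2 : min t T < x := hx.1
        have h3 : S ≤ min t T := le_min ht (hψs hS).2.le
        linarith
      rw [hφ]
      simp only
      rw [← intervalIntegral.integral_add_adjacent_intervals (hψi 0 t) (hψi t T), this]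
      ring
    · refine ⟨0, hT, fun t _ => ?_⟩
      have : ψ = 0 := by
        rw [not_nonempty_iff_eq_empty, tsupport_eq_empty_iff] at hne
        exact hne
      simp [hφ, this]
  have h1 := h φ hφs hzero
  rw [hφ'] at h1
  have hφp : IsPrimitiveOn T φ ψ := IsPrimitiveOn.of_hasDerivAt hφd hψ.continuous
  have h2 := (hφp.mul hT.le hB).eq T ⟨hT.le, le_rfl⟩
  have hφT : φ T = 0 := by simp [hφ]
  have hφ0 : φ 0 = -∫ t in Ioo 0 T, ψ t := by
    rw [← integral_Ioc_eq_integral_Ioo, ← intervalIntegral.integral_of_le hT.le]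
    simp [hφ]
  simp only [hφT, intervalIntegral.integral_same, zero_mul, mul_zero, zero_add] at h2
  have hψB : IntegrableOn (fun t => ψ t * ∫ s in 0..t, b s) (Ioo 0 T) :=
    ((hψ.continuous.continuousOn.mul hBc).integrableOn_Icc).mono_set Ioo_subset_Icc_self
  have hφb : IntegrableOn (fun t => φ t * b t) (Ioo 0 T) := by
    have := hbi.continuousOn_mul (g := φ) hφs.continuous.continuousOn
    rwa [intervalIntegrable_iff_integrableOn_Ioo_of_le hT.le] at this
  have hψa : IntegrableOn (fun t => ψ t * a t) (Ioo 0 T) := by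
    have hai : IntervalIntegrable a volume 0 T := by
      rw [intervalIntegrable_iff_integrableOn_Ioo_of_le hT.le]; exact ha
    have := hai.continuousOn_mul (g := ψ) hψ.continuous.continuousOn
    rwa [intervalIntegrable_iff_integrableOn_Ioo_of_le hT.le] at this
  have hψ0 : IntegrableOn (fun t => ψ t * a₀) (Ioo 0 T) :=
    ((hψ.continuous.mul continuous_const).continuousOn.integrableOn_Icc).mono_set
      Ioo_subset_Icc_self
  rw [intervalIntegral.integral_of_le hT.le, integral_Ioc_eq_integral_Ioo,
    integral_add hψB hφb] at h2
  have hset : ∫ x, ψ x • (a x - a₀ - ∫ s in 0..x, b s) =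
      ∫ x in Ioo 0 T, ψ x • (a x - a₀ - ∫ s in 0..x, b s) := by
    refine (setIntegral_eq_integral_of_forall_compl_eq_zero fun x hx => ?_).symm
    rw [image_eq_zero_of_notMem_tsupport fun hxm => hx (hψs hxm), zero_smul]
  rw [hset]
  have hsplit : ∀ x, ψ x • (a x - a₀ - ∫ s in 0..x, b s) =
      ψ x * a x - ψ x * a₀ - ψ x * ∫ s in 0..x, b s := fun x => by
    rw [smul_eq_mul]; ring
  simp only [hsplit]
  have e1 := integral_sub (hψa.sub hψ0) hψB
  have e2 := integral_sub hψa hψ0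
  simp only [Pi.sub_apply] at e1
  rw [e1, e2, integral_mul_const, h1, hφ0]
  linarith

theorem HasWeakDerivFrom.ae_eq_primitive {a₀ : ℝ} {a b : ℝ → ℝ} (h : HasWeakDerivFrom a₀ a b)
    (ha : ∀ T, 0 < T → IntegrableOn a (Ioo 0 T)) (hb : ∀ T, 0 < T → IntegrableOn b (Ioo 0 T))
    {T : ℝ} (hT : 0 < T) :
    ∀ᵐ t ∂volume.restrict (Ioo 0 T), a t = a₀ + ∫ s in 0..t, b s := by
  refine ae_eq_primitive_of_weakDeriv hT (ha T hT) (hb T hT) fun φ hφ ⟨S, hST, hS⟩ => ?_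
  -- `φ` need not vanish at `-∞`, while the definition asks for compact support. The cutoff equals
  -- `1` on `[-1, ∞)`, so nothing changes where the integrals are taken.
  set χ : ℝ → ℝ := fun t => Real.smoothTransition (t + 2) with hχ
  have hχs : ContDiff ℝ ∞ χ := Real.smoothTransition.contDiff.comp (by fun_prop)
  have hχ1 : ∀ t, 0 ≤ t → χ t = 1 := fun t ht =>
    Real.smoothTransition.one_of_one_le (by linarith)
  have hcs : HasCompactSupport (fun t => χ t * φ t) := by
    refine HasCompactSupport.intro (isCompact_Icc (a := -2) (b := S)) fun t ht => ?_
    by_cases h1 : t < -2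
    · simp [hχ, Real.smoothTransition.zero_of_nonpos (x := t + 2) (by linarith)]
    · rw [hS t (by_contra fun h2 => ht ⟨by linarith, by linarith⟩), mul_zero]
  have key := h _ (hχs.mul hφ) hcs
  have hd : ∀ t, 0 < t → deriv (fun t => χ t * φ t) t = deriv φ t := fun t ht => by
    refine Filter.EventuallyEq.deriv_eq ?_
    filter_upwards [Ioi_mem_nhds ht] with s hs
    rw [hχ1 s (le_of_lt hs), one_mul]
  have hd0 : ∀ t, S < t → deriv φ t = 0 := fun t ht => by
    have : φ =ᶠ[𝓝 t] fun _ => 0 := by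
      filter_upwards [Ioi_mem_nhds ht] with s hs using hS s (le_of_lt hs)
    rw [this.deriv_eq, deriv_const]
  have e1 : ∫ t in Ioi 0, deriv (fun t => χ t * φ t) t * a t = ∫ t in Ioo 0 T, deriv φ t * a t := by
    refine (setIntegral_eq_of_subset_of_forall_sdiff_eq_zero measurableSet_Ioi
      (Ioo_subset_Ioi_self : Ioo 0 T ⊆ Ioi 0) (fun t ht => ?_)).trans ?_
    · rw [hd t ht.1, hd0 t (hST.trans_le (by_contra fun h2 => ht.2 ⟨ht.1, by linarith⟩)), zero_mul]
    · exact setIntegral_congr_fun measurableSet_Ioo fun t ht => by simp only [hd t ht.1]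
  have e2 : ∫ t in Ioi 0, (χ t * φ t) * b t = ∫ t in Ioo 0 T, φ t * b t := by
    refine (setIntegral_eq_of_subset_of_forall_sdiff_eq_zero measurableSet_Ioi
      (Ioo_subset_Ioi_self : Ioo 0 T ⊆ Ioi 0) (fun t ht => ?_)).trans ?_
    · simp only [hS t (hST.le.trans (by_contra fun h2 => ht.2 ⟨ht.1, by linarith⟩)), mul_zero,
        zero_mul]
    · exact setIntegral_congr_fun measurableSet_Ioo fun t ht => by simp [hχ1 t ht.1.le]
  rw [e1, e2, hχ1 0 le_rfl, one_mul] at key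
  exact key

end

section

/-! ### Steklov averages -/

section Steklov

variable {E : Type*} [NormedAddCommGroup E]

theorem sq_lintegral_le {α : Type*} [MeasurableSpace α] (μ : Measure α) {f : α → ℝ≥0∞}
    (hf : AEMeasurable f μ) : (∫⁻ x, f x ∂μ) ^ 2 ≤ μ univ * ∫⁻ x, f x ^ 2 ∂μ := by
  have h := ENNReal.lintegral_mul_le_Lp_mul_Lq μ Real.HolderConjugate.two_two
    (f := fun _ => 1) (g := f) aemeasurable_const hf
  simp only [Pi.mul_apply, one_mul, ENNReal.one_rpow, lintegral_one] at h
  calc (∫⁻ x, f x ∂μ) ^ 2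
      ≤ (μ univ ^ (1 / 2 : ℝ) * (∫⁻ x, f x ^ (2 : ℝ) ∂μ) ^ (1 / 2 : ℝ)) ^ 2 := by gcongr
    _ = _ := by
      rw [mul_pow, ← ENNReal.rpow_natCast, ← ENNReal.rpow_natCast, ← ENNReal.rpow_mul,
        ← ENNReal.rpow_mul]
      norm_num

/-- Strong continuity of translations in `L²(ℝ; E)`. -/
theorem tendsto_lintegral_translate_sub (G : Lp E 2 (volume : Measure ℝ)) :
    Tendsto (fun z : ℝ => ∫⁻ t, ‖G (t + z) - G t‖ₑ ^ 2) (𝓝 0) (𝓝 0) := by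
  have hmp : ∀ z : ℝ, MeasurePreserving (fun t : ℝ => t + z) volume volume := fun z =>
    measurePreserving_add_right volume z
  let τ : ℝ → C(ℝ, ℝ) := fun z => ⟨fun t => t + z, by fun_prop⟩
  have hτ : Continuous τ := ContinuousMap.continuous_of_continuous_uncurry _
    (by simp only [τ, ContinuousMap.coe_mk, Function.uncurry_def]; fun_prop)
  have hc : Continuous fun z => Lp.compMeasurePreserving (τ z) (hmp z) G :=
    (continuous_const (y := G)).compMeasurePreservingLp hτ hmp (by simp)
  have h0 : Lp.compMeasurePreserving (τ 0) (hmp 0) G = G := by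
    ext1
    filter_upwards [Lp.coeFn_compMeasurePreserving G (hmp 0)] with t ht
    exact ht.trans (by simp)
  have h1 := (hc.tendsto 0)
  rw [h0, Lp.tendsto_Lp_iff_tendsto_eLpNorm'] at h1
  have h2 := ((ENNReal.continuous_pow 2).tendsto 0).comp h1
  rw [zero_pow two_ne_zero] at h2
  refine h2.congr fun z => ?_
  simp only [Function.comp_apply]
  rw [eLpNorm_eq_lintegral_rpow_enorm_toReal (by simp) (by simp), ← ENNReal.rpow_natCast,
    ← ENNReal.rpow_mul, show (1 / (2 : ℝ≥0∞).toReal * ((2 : ℕ) : ℝ)) = 1 by norm_num,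
    ENNReal.rpow_one]
  refine lintegral_congr_ae ?_
  filter_upwards [Lp.coeFn_compMeasurePreserving G (hmp z)] with t ht
  have ht' : (Lp.compMeasurePreserving (τ z) (hmp z) G) t = G (t + z) := ht
  simp only [Pi.sub_apply]
  rw [ht', show (2 : ℝ≥0∞).toReal = ((2 : ℕ) : ℝ) by norm_num, ENNReal.rpow_natCast]

theorem intervalIntegrable_Lp (G : Lp E 2 (volume : Measure ℝ)) (a b : ℝ) :
    IntervalIntegrable G volume a b := by
  have : IsFiniteMeasure (volume.restrict (uIcc a b)) := ⟨by simp [uIcc]⟩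
  have h : IntegrableOn G (uIcc a b) := ((Lp.memLp G).restrict (uIcc a b)).integrable (by norm_num)
  exact h.intervalIntegrable

variable [NormedSpace ℝ E]

/-- The forward average `δ⁻¹ ∫_t^{t+δ} f`. -/
def steklov (δ : ℝ) (f : ℝ → E) (t : ℝ) : E := δ⁻¹ • ∫ s in t..t + δ, f s

theorem steklov_sub [CompleteSpace E] {δ : ℝ} (hδ : 0 < δ) {f : ℝ → E}
    (hf : ∀ a b, IntervalIntegrable f volume a b) (t : ℝ) :
    steklov δ f t - f t = δ⁻¹ • ∫ z in 0..δ, (f (t + z) - f t) := by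
  have h1 : IntervalIntegrable (fun z => f (t + z)) volume 0 δ := by
    simpa using (hf t (t + δ)).comp_add_left t
  rw [intervalIntegral.integral_sub h1 intervalIntegrable_const, intervalIntegral.integral_const,
    intervalIntegral.integral_comp_add_left (fun z => f z) t, steklov, smul_sub, smul_smul]
  simp [hδ.ne']

/-- The error of the average is the average of the translation errors: Cauchy–Schwarz in the shift
`z`, then Tonelli. -/
theorem lintegral_steklov_sub_le [CompleteSpace E] (G : Lp E 2 (volume : Measure ℝ)) {δ : ℝ}
    (hδ : 0 < δ) {ε : ℝ≥0∞} (h : ∀ z ∈ Ioc 0 δ, ∫⁻ t, ‖G (t + z) - G t‖ₑ ^ 2 ≤ ε) :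
    ∫⁻ t, ‖steklov δ G t - G t‖ₑ ^ 2 ≤ ε := by
  have hGm : StronglyMeasurable G := Lp.stronglyMeasurable G
  have hm : StronglyMeasurable (fun p : ℝ × ℝ => G (p.1 + p.2) - G p.1) :=
    (hGm.comp_measurable (measurable_fst.add measurable_snd)).sub
      (hGm.comp_measurable measurable_fst)
  have hpt : ∀ t, ‖steklov δ G t - G t‖ₑ ^ 2 ≤
      ENNReal.ofReal δ⁻¹ * ∫⁻ z in Ioc 0 δ, ‖G (t + z) - G t‖ₑ ^ 2 := fun t => by
    have hsec : StronglyMeasurable fun z => G (t + z) - G t :=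
      hm.comp_measurable (measurable_prodMk_left (x := t))
    rw [steklov_sub hδ (intervalIntegrable_Lp G), enorm_smul, mul_pow,
      intervalIntegral.integral_of_le hδ.le]
    have h1 : ‖∫ z in Ioc 0 δ, (G (t + z) - G t)‖ₑ ^ 2 ≤
        ENNReal.ofReal δ * ∫⁻ z in Ioc 0 δ, ‖G (t + z) - G t‖ₑ ^ 2 := by
      refine (pow_le_pow_left' (enorm_integral_le_lintegral_enorm _) 2).trans ?_
      refine (sq_lintegral_le _ hsec.enorm.aemeasurable).trans_eq ?_
      simp
    have hδi : ‖δ⁻¹‖ₑ = ENNReal.ofReal δ⁻¹ := Real.enorm_eq_ofReal (by positivity)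
    calc ‖δ⁻¹‖ₑ ^ 2 * ‖∫ z in Ioc 0 δ, (G (t + z) - G t)‖ₑ ^ 2
        ≤ ENNReal.ofReal δ⁻¹ ^ 2 *
          (ENNReal.ofReal δ * ∫⁻ z in Ioc 0 δ, ‖G (t + z) - G t‖ₑ ^ 2) := by
            rw [hδi]; gcongr
      _ = _ := by
        rw [← mul_assoc, sq, mul_assoc (ENNReal.ofReal δ⁻¹), ← ENNReal.ofReal_mul (by positivity),
          inv_mul_cancel₀ hδ.ne', ENNReal.ofReal_one, mul_one]
  calc ∫⁻ t, ‖steklov δ G t - G t‖ₑ ^ 2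
      ≤ ∫⁻ t, ENNReal.ofReal δ⁻¹ * ∫⁻ z in Ioc 0 δ, ‖G (t + z) - G t‖ₑ ^ 2 := lintegral_mono hpt
    _ = ENNReal.ofReal δ⁻¹ * ∫⁻ t, ∫⁻ z in Ioc 0 δ, ‖G (t + z) - G t‖ₑ ^ 2 :=
        lintegral_const_mul' _ _ (by simp)
    _ = ENNReal.ofReal δ⁻¹ * ∫⁻ z in Ioc 0 δ, ∫⁻ t, ‖G (t + z) - G t‖ₑ ^ 2 := by
        rw [lintegral_lintegral_swap]
        exact (hm.enorm.pow_const 2).aemeasurable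
    _ ≤ ENNReal.ofReal δ⁻¹ * ∫⁻ z in Ioc 0 δ, ε := by
        gcongr 1
        exact setLIntegral_mono' measurableSet_Ioc h
    _ = ε := by
        rw [setLIntegral_const, Real.volume_Ioc, sub_zero, mul_left_comm,
          ← ENNReal.ofReal_mul (by positivity), inv_mul_cancel₀ hδ.ne', ENNReal.ofReal_one, mul_one]

theorem tendsto_lintegral_steklov_sub [CompleteSpace E] {f : ℝ → E} {T : ℝ}
    (hf : MemLp f 2 (volume.restrict (Ioo 0 (T + 1)))) :
    Tendsto (fun δ => ∫⁻ t in Ioo 0 T, ‖steklov δ f t - f t‖ₑ ^ 2) (𝓝[>] 0) (𝓝 0) := by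
  -- Extension by zero off `(0, T + 1)`. For `t < T` and `δ < 1` the forward average at `t` sees
  -- only this interval, so the extension does not affect it.
  have hg : MemLp ((Ioo 0 (T + 1)).indicator f) 2 volume :=
    (memLp_indicator_iff_restrict measurableSet_Ioo).2 hf
  set G := hg.toLp with hG
  have hGf : ∀ᵐ t, t ∈ Ioo 0 (T + 1) → G t = f t := by
    filter_upwards [hg.coeFn_toLp] with t ht htm
    rw [hG, ht, indicator_of_mem htm]
  have hT := tendsto_lintegral_translate_sub G
  rw [ENNReal.tendsto_nhds_zero] at hT ⊢
  intro ε hε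
  obtain ⟨η, hη, hball⟩ := Metric.eventually_nhds_iff.1 (hT ε hε)
  have hev : ∀ᶠ δ in 𝓝[>] (0 : ℝ), δ ∈ Ioo 0 (min η 1) :=
    Ioo_mem_nhdsGT (lt_min hη one_pos)
  filter_upwards [hev] with δ hδ
  have hle := lintegral_steklov_sub_le G hδ.1 (ε := ε) fun z hz => hball (by
    rw [Real.dist_eq, sub_zero, abs_of_pos hz.1]
    exact hz.2.trans_lt (hδ.2.trans_le (min_le_left _ _)))
  refine le_trans (le_of_eq ?_) ((setLIntegral_le_lintegral (Ioo 0 T) _).trans hle)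
  refine setLIntegral_congr_fun_ae measurableSet_Ioo ?_
  filter_upwards [hGf] with t ht htm
  have hδ1 : δ < 1 := hδ.2.trans_le (min_le_right _ _)
  rw [ht ⟨htm.1, by linarith [htm.2]⟩]
  have : steklov δ G t = steklov δ f t := by
    rw [steklov, steklov]
    congr 1
    refine intervalIntegral.integral_congr_ae ?_
    filter_upwards [hGf] with s hs hst
    rw [uIoc_of_le (by linarith [hδ.1])] at hst
    exact hs ⟨htm.1.trans hst.1, by linarith [hst.2, htm.2]⟩
  rw [this]

theorem continuous_steklov {δ : ℝ} {f : ℝ → E}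
    (hf : ∀ a b, IntervalIntegrable f volume a b) : Continuous (steklov δ f) := by
  have h : steklov δ f = fun t => δ⁻¹ • ((∫ s in 0..t + δ, f s) - ∫ s in 0..t, f s) := by
    funext t
    rw [steklov, intervalIntegral.integral_interval_sub_left (hf _ _) (hf _ _)]
  rw [h]
  have hc := intervalIntegral.continuous_primitive hf 0
  exact ((hc.comp (continuous_id.add continuous_const)).sub hc).const_smul _

/-- Averaging upgrades a primitive, which is only absolutely continuous, to a `C¹` function whose
derivative is the average of `f`. This is why Steklov averages are used as regularization. -/
theorem hasDerivAt_steklov_primitive [CompleteSpace E] {δ : ℝ} {f : ℝ → E}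
    (hf : ∀ a b, IntervalIntegrable f volume a b) (t : ℝ) :
    HasDerivAt (steklov δ fun t => ∫ s in 0..t, f s) (steklov δ f t) t := by
  have hc := intervalIntegral.continuous_primitive hf 0
  have h : (steklov δ fun t => ∫ s in 0..t, f s) = fun t =>
      δ⁻¹ • ((∫ r in 0..t + δ, ∫ s in 0..r, f s) - ∫ r in 0..t, ∫ s in 0..r, f s) := by
    funext t
    rw [steklov, intervalIntegral.integral_interval_sub_left (hc.intervalIntegrable _ _)
      (hc.intervalIntegrable _ _)]
  rw [h, steklov, ← intervalIntegral.integral_interval_sub_left (hf 0 (t + δ)) (hf 0 t)]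
  have hd : ∀ t, HasDerivAt (fun t => ∫ r in 0..t, ∫ s in 0..r, f s) (∫ s in 0..t, f s) t :=
    fun t => intervalIntegral.integral_hasDerivAt_right (hc.intervalIntegrable _ _)
      (hc.stronglyMeasurableAtFilter _ _) hc.continuousAt
  exact (((hd (t + δ)).comp_add_const t δ).sub (hd t)).const_smul _

theorem tendsto_steklov_of_hasDerivAt {f : ℝ → E} {t : ℝ} {y : E}
    (hf : ∀ a b, IntervalIntegrable f volume a b)
    (h : HasDerivAt (fun x => ∫ s in 0..x, f s) y t) :
    Tendsto (fun δ => steklov δ f t) (𝓝[>] 0) (𝓝 y) := by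
  have h1 := (hasDerivAt_iff_tendsto_slope_zero.1 h).mono_left
    (nhdsWithin_mono 0 (fun x (hx : 0 < x) => hx.ne' : Ioi (0 : ℝ) ⊆ {0}ᶜ))
  refine h1.congr fun δ => ?_
  rw [steklov, intervalIntegral.integral_interval_sub_left (hf _ _) (hf _ _)]

end Steklov

end

section

/-! ### Functions of `L²(V)` with time derivative in `L²(V*)` -/

section Evolution

theorem sq_add_le_two_mul (a b : ℝ≥0∞) : (a + b) ^ 2 ≤ 2 * a ^ 2 + 2 * b ^ 2 := by
  rcases eq_or_ne a ⊤ with rfl | ha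
  · simp
  rcases eq_or_ne b ⊤ with rfl | hb
  · simp
  lift a to NNReal using ha
  lift b to NNReal using hb
  norm_cast
  rw [← NNReal.coe_le_coe]
  push_cast
  nlinarith [sq_nonneg ((a : ℝ) - b)]

theorem enorm_sq_eq {E : Type*} [NormedAddCommGroup E] (x : E) :
    ‖x‖ₑ ^ 2 = ENNReal.ofReal (‖x‖ ^ 2) := by
  rw [ENNReal.ofReal_pow (norm_nonneg _), ofReal_norm]

theorem memLp_Ioo_of_continuousOn {E : Type*} [NormedAddCommGroup E] {f : ℝ → E} {T : ℝ}
    (hf : ContinuousOn f (Icc 0 T)) : MemLp f 2 (volume.restrict (Ioo 0 T)) := by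
  obtain ⟨C, hC⟩ := isCompact_Icc.exists_bound_of_continuousOn hf
  have hm : AEStronglyMeasurable f (volume.restrict (Ioo 0 T)) :=
    (hf.aestronglyMeasurable measurableSet_Icc).mono_measure
      (Measure.restrict_mono_set _ Ioo_subset_Icc_self)
  exact MemLp.of_bound hm C ((ae_restrict_mem measurableSet_Ioo).mono
    fun t ht => hC t (Ioo_subset_Icc_self ht))

variable {V H : Type*} [NormedAddCommGroup V] [NormedSpace ℝ V]
  [NormedAddCommGroup H] [InnerProductSpace ℝ H]

/-- No differentiability of `w` is assumed. Self-adjointness of `P` factors an increment of the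
quadratic form as `(z τ - z r) (PV (w τ + w r))`; after division by `τ - r` the first factor
converges in `V*` and the second in `V`. Allowing a general `P`, and not just the identity, gives
the energy identity one frequency at a time. -/
theorem energy_identity_of_continuous {ι : V →L[ℝ] H} {P : H →L[ℝ] H} {PV : V →L[ℝ] V}
    (hPV : ∀ v, ι (PV v) = P (ι v)) (hP : ∀ x y, ⟪P x, y⟫_ℝ = ⟪x, P y⟫_ℝ)
    {w : ℝ → V} {z z' : ℝ → (V →L[ℝ] ℝ)} {c : V → ℝ} (hw : Continuous w) (hz' : Continuous z')
    (hz : ∀ t, HasDerivAt z (z' t) t)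
    (h : ∀ t, 0 ≤ t → ∀ v, ⟪ι (w t), ι v⟫_ℝ = c v + z t v) {s t : ℝ} (hs : 0 ≤ s) (hst : s ≤ t) :
    ⟪P (ι (w t)), ι (w t)⟫_ℝ = ⟪P (ι (w s)), ι (w s)⟫_ℝ + 2 * ∫ τ in s..t, z' τ (PV (w τ)) := by
  set f : ℝ → ℝ := fun t => ⟪P (ι (w t)), ι (w t)⟫_ℝ with hf
  have hfc : Continuous f := by fun_prop
  have hd : ∀ r, 0 < r → HasDerivAt f (2 * z' r (PV (w r))) r := fun r hr => by
    rw [hasDerivAt_iff_tendsto_slope]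
    have h1 := hasDerivAt_iff_tendsto_slope.1 (hz r)
    have h2 : Tendsto (fun τ => PV (w τ + w r)) (𝓝[≠] r) (𝓝 (PV (w r + w r))) :=
      (by fun_prop : Continuous fun τ => PV (w τ + w r)).continuousAt.tendsto.mono_left
        nhdsWithin_le_nhds
    have h3 : Tendsto (fun τ => slope z r τ (PV (w τ + w r))) (𝓝[≠] r)
        (𝓝 (z' r (PV (w r + w r)))) :=
      ((isBoundedBilinearMap_apply (𝕜 := ℝ)).continuous.tendsto (z' r, PV (w r + w r))).comp
        (h1.prodMk_nhds h2)
    have h4 : z' r (PV (w r + w r)) = 2 * z' r (PV (w r)) := by simp [two_mul]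
    rw [h4] at h3
    refine h3.congr' ?_
    filter_upwards [mem_nhdsWithin_of_mem_nhds (Ioi_mem_nhds hr)] with τ hτ
    have hτ' : 0 ≤ τ := le_of_lt hτ
    have key : f τ - f r = (z τ - z r) (PV (w τ + w r)) := by
      have e1 := h τ hτ' (PV (w τ + w r))
      have e2 := h r hr.le (PV (w τ + w r))
      rw [hPV] at e1 e2
      have e3 : f τ - f r = ⟪ι (w τ), P (ι (w τ + w r))⟫_ℝ - ⟪ι (w r), P (ι (w τ + w r))⟫_ℝ := by
        simp only [hf, map_add, inner_add_right]
        rw [← hP (ι (w τ)) (ι (w r)), ← hP (ι (w τ)) (ι (w τ)), ← hP (ι (w r)) (ι (w r)),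
          real_inner_comm, ← hP (ι (w r)) (ι (w τ)), hP, real_inner_comm (ι (w τ)) (P (ι (w r)))]
        simp only [hP]
        ring
      rw [e3, e1, e2, _root_.sub_apply]
      ring
    rw [slope_def_field, key]
    rw [slope_def_module]
    simp only [_root_.smul_apply, smul_eq_mul]
    ring
  -- The pairing identity is available for nonnegative times only, so there is no two-sided
  -- derivative at `0`; continuity of `f` at the endpoints is enough.
  have hint := intervalIntegral.integral_eq_sub_of_hasDerivAt_of_le hst hfc.continuousOn
    (fun r hr => hd r (hs.trans_lt hr.1))
    ((by fun_prop : Continuous fun τ => 2 * z' τ (PV (w τ))).intervalIntegrable _ _)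
  rw [intervalIntegral.integral_const_mul] at hint
  rw [hint]
  simp only [hf]
  ring

/-- The quantitative embedding into `C([0, T]; H)`: the energy identity compares the value at `t`
with the value at any `r`, and averaging over `r` in `(0, T)` bounds the latter by the `L²` norm in
`V`. -/
theorem enorm_sq_le_of_continuous {ι : V →L[ℝ] H} {w : ℝ → V} {z z' : ℝ → (V →L[ℝ] ℝ)} {c : V → ℝ}
    (hw : Continuous w) (hz' : Continuous z') (hz : ∀ t, HasDerivAt z (z' t) t)
    (h : ∀ t, 0 ≤ t → ∀ v, ⟪ι (w t), ι v⟫_ℝ = c v + z t v) {T : ℝ} (hT : 0 < T) {t : ℝ}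
    (ht : t ∈ Icc 0 T) :
    ‖ι (w t)‖ₑ ^ 2 ≤ ENNReal.ofReal (‖ι‖ ^ 2 / T + 1) *
      ((∫⁻ s in Ioo 0 T, ‖w s‖ₑ ^ 2) + ∫⁻ s in Ioo 0 T, ‖z' s‖ₑ ^ 2) := by
  have hid : ∀ r ∈ Icc 0 T, ∀ t ∈ Icc 0 T, r ≤ t →
      ‖ι (w t)‖ ^ 2 = ‖ι (w r)‖ ^ 2 + 2 * ∫ τ in r..t, z' τ (w τ) := fun r hr t ht hrt => by
    have := energy_identity_of_continuous (ι := ι) (P := .id ℝ H) (PV := .id ℝ V) (fun _ => rfl)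
      (fun _ _ => rfl) hw hz' hz h hr.1 hrt
    simpa only [ContinuousLinearMap.id_apply, real_inner_self_eq_norm_sq] using this
  have hwi : IntegrableOn (fun s => ‖w s‖ ^ 2) (Ioo 0 T) :=
    ((hw.norm.pow 2).continuousOn.integrableOn_Icc).mono_set Ioo_subset_Icc_self
  have hzi : IntegrableOn (fun s => ‖z' s‖ ^ 2) (Ioo 0 T) :=
    ((hz'.norm.pow 2).continuousOn.integrableOn_Icc).mono_set Ioo_subset_Icc_self
  set A := ∫ s in Ioo 0 T, (‖w s‖ ^ 2 + ‖z' s‖ ^ 2) with hA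
  have hsmall : ∀ r ∈ Icc 0 T, ∀ t ∈ Icc 0 T, r ≤ t → |2 * ∫ τ in r..t, z' τ (w τ)| ≤ A := by
    intro r hr t ht hrt
    have h1 : ‖∫ τ in r..t, 2 * z' τ (w τ)‖ ≤ ∫ τ in r..t, (‖w τ‖ ^ 2 + ‖z' τ‖ ^ 2) := by
      refine intervalIntegral.norm_integral_le_of_norm_le hrt (ae_of_all _ fun τ _ => ?_)
        ((by fun_prop : Continuous fun τ => ‖w τ‖ ^ 2 + ‖z' τ‖ ^ 2).intervalIntegrable _ _)
      rw [norm_mul]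
      have := (z' τ).le_opNorm (w τ)
      norm_num
      rw [Real.norm_eq_abs] at this
      nlinarith [sq_nonneg (‖w τ‖ - ‖z' τ‖)]
    rw [← intervalIntegral.integral_const_mul]
    refine h1.trans ?_
    rw [intervalIntegral.integral_of_le hrt, integral_Ioc_eq_integral_Ioo]
    exact setIntegral_mono_set (hwi.add hzi) (ae_of_all _ fun τ => by
      simp only [Pi.zero_apply]; positivity)
      (Ioo_subset_Ioo hr.1 ht.2).eventuallyLE
  have hle : ∀ r ∈ Icc 0 T, ‖ι (w t)‖ ^ 2 ≤ ‖ι (w r)‖ ^ 2 + A := fun r hr => by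
    rcases le_total r t with hrt | hrt
    · have := le_of_abs_le (hsmall r hr t ht hrt)
      rw [hid r hr t ht hrt]; linarith
    · have := neg_le_of_abs_le (hsmall t ht r hr hrt)
      have := hid t ht r hr hrt
      linarith
  have havg : T * ‖ι (w t)‖ ^ 2 ≤ ‖ι‖ ^ 2 * (∫ s in Ioo 0 T, ‖w s‖ ^ 2) + T * A := by
    have h1 : ∫ _ in Ioo 0 T, ‖ι (w t)‖ ^ 2 ≤ ∫ s in Ioo 0 T, (‖ι‖ ^ 2 * ‖w s‖ ^ 2 + A) := by
      refine setIntegral_mono_on (integrableOn_const (by simp))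
        ((hwi.const_mul _).add (integrableOn_const (by simp))) measurableSet_Ioo fun s hs => ?_
      refine (hle s (Ioo_subset_Icc_self hs)).trans ?_
      rw [← mul_pow]
      gcongr
      exact ι.le_opNorm _
    rw [integral_add (hwi.const_mul _) (integrableOn_const (by simp)), integral_const_mul] at h1
    simpa [hT.le] using h1
  have hw_le : ∫ s in Ioo 0 T, ‖w s‖ ^ 2 ≤ A := by
    rw [hA, integral_add hwi hzi]
    have : 0 ≤ ∫ s in Ioo 0 T, ‖z' s‖ ^ 2 := integral_nonneg fun s => sq_nonneg _
    linarith
  have hfin : ‖ι (w t)‖ ^ 2 ≤ (‖ι‖ ^ 2 / T + 1) * A := by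
    have : T * ‖ι (w t)‖ ^ 2 ≤ T * ((‖ι‖ ^ 2 / T + 1) * A) := by
      have e : T * ((‖ι‖ ^ 2 / T + 1) * A) = ‖ι‖ ^ 2 * A + T * A := by field_simp
      rw [e]
      nlinarith [mul_le_mul_of_nonneg_left hw_le (sq_nonneg ‖ι‖)]
    exact le_of_mul_le_mul_left this hT
  rw [enorm_sq_eq, ← lintegral_add_left (hw.enorm.measurable.pow_const 2)]
  refine (ENNReal.ofReal_le_ofReal hfin).trans_eq ?_
  have hsum : IntegrableOn (fun s => ‖w s‖ ^ 2 + ‖z' s‖ ^ 2) (Ioo 0 T) := hwi.add hzi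
  rw [ENNReal.ofReal_mul (by positivity), hA, ofReal_integral_eq_lintegral_ofReal hsum
    (ae_of_all _ fun τ => by simp only [Pi.zero_apply]; positivity)]
  congr 1
  refine lintegral_congr fun s => ?_
  rw [enorm_sq_eq, enorm_sq_eq, ENNReal.ofReal_add (by positivity) (by positivity)]

end Evolution

end

/-! ### Passage to the limit in the Steklov averages: the continuous representative -/

section

section Evolution

variable {V H : Type*} [NormedAddCommGroup V] [NormedSpace ℝ V]
  [NormedAddCommGroup H] [InnerProductSpace ℝ H]

/-- An identity valid for almost every time becomes, once averaged over `[t, t + δ]`, an identity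
valid for every `t ≥ 0`. -/
theorem inner_steklov_eq [CompleteSpace V] {ι : V →L[ℝ] H} {u : ℝ → V} {du : ℝ → (V →L[ℝ] ℝ)}
    {u₀ : H}
    (hui : ∀ a b, IntervalIntegrable u volume a b) (hdi : ∀ a b, IntervalIntegrable du volume a b)
    (h : ∀ v, ∀ T, 0 < T → ∀ᵐ t ∂volume.restrict (Ioo 0 T),
      ⟪ι (u t), ι v⟫_ℝ = ⟪u₀, ι v⟫_ℝ + (∫ s in 0..t, du s) v)
    {δ : ℝ} (hδ : 0 < δ) {t : ℝ} (ht : 0 ≤ t) (v : V) :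
    ⟪ι (steklov δ u t), ι v⟫_ℝ =
      ⟪u₀, ι v⟫_ℝ + steklov δ (fun t => ∫ s in 0..t, du s) t v := by
  set D : ℝ → (V →L[ℝ] ℝ) := fun t => ∫ s in 0..t, du s with hD
  have hDc : Continuous D := intervalIntegral.continuous_primitive hdi 0
  let Φ : V →L[ℝ] ℝ := (innerSL ℝ (ι v)).comp ι
  have hΦ : ∀ x, ⟪ι x, ι v⟫_ℝ = Φ x := fun x => by
    simp [Φ, real_inner_comm]
  have hev : ∀ z : V →L[ℝ] ℝ, z v = ContinuousLinearMap.apply ℝ ℝ v z := fun z => rfl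
  have h1 : ∫ s in t..t + δ, Φ (u s) = ∫ s in t..t + δ, (⟪u₀, ι v⟫_ℝ + D s v) := by
    refine intervalIntegral.integral_congr_ae ?_
    have := (ae_restrict_iff' measurableSet_Ioo).1 (h v (t + δ + 1) (by linarith))
    filter_upwards [this] with s hs hst
    rw [uIoc_of_le (by linarith)] at hst
    rw [← hΦ]
    exact hs ⟨ht.trans_lt hst.1, by linarith [hst.2]⟩
  have hDv : Continuous fun s => D s v := by fun_prop
  rw [hΦ, steklov, map_smul, ← Φ.intervalIntegral_comp_comm (hui _ _), h1,
    intervalIntegral.integral_add intervalIntegrable_const (hDv.intervalIntegrable _ _),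
    intervalIntegral.integral_const, hev, steklov, map_smul,
    ← ContinuousLinearMap.intervalIntegral_comp_comm _ (hDc.intervalIntegrable _ _)]
  simp only [ContinuousLinearMap.apply_apply, smul_eq_mul, add_sub_cancel_left, mul_add]
  rw [inv_mul_cancel_left₀ hδ.ne']

theorem tendsto_eLpNorm_of_tendsto_lintegral_sq {α E : Type*} [MeasurableSpace α]
    [NormedAddCommGroup E] {μ : Measure α} {F : ℕ → α → E}
    (h : Tendsto (fun n => ∫⁻ x, ‖F n x‖ₑ ^ 2 ∂μ) atTop (𝓝 0)) :
    Tendsto (fun n => eLpNorm (F n) 2 μ) atTop (𝓝 0) := by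
  have h1 := ((ENNReal.continuous_rpow_const (y := (1 / 2 : ℝ))).tendsto 0).comp h
  rw [ENNReal.zero_rpow_of_pos (by norm_num)] at h1
  refine h1.congr fun n => ?_
  rw [eLpNorm_eq_lintegral_rpow_enorm_toReal (by simp) (by simp)]
  simp

/-- The duality pairing is a continuous bilinear form on `L²(V*) × L²(V)`, so it passes to the limit
under strong convergence of both factors. -/
theorem tendsto_integral_pairing {α : Type*} [MeasurableSpace α] {μ : Measure α}
    (B : V →L[ℝ] V) {z : ℕ → α → (V →L[ℝ] ℝ)} {zl : α → (V →L[ℝ] ℝ)} {w : ℕ → α → V} {wl : α → V}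
    (hz : ∀ n, MemLp (z n) 2 μ) (hzl : MemLp zl 2 μ) (hw : ∀ n, MemLp (w n) 2 μ)
    (hwl : MemLp wl 2 μ)
    (hzt : Tendsto (fun n => ∫⁻ x, ‖z n x - zl x‖ₑ ^ 2 ∂μ) atTop (𝓝 0))
    (hwt : Tendsto (fun n => ∫⁻ x, ‖w n x - wl x‖ₑ ^ 2 ∂μ) atTop (𝓝 0)) :
    Tendsto (fun n => ∫ x, z n x (B (w n x)) ∂μ) atTop (𝓝 (∫ x, zl x (B (wl x)) ∂μ)) := by
  have h1 := (Lp.tendsto_Lp_iff_tendsto_eLpNorm'' z hz zl hzl).2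
    (tendsto_eLpNorm_of_tendsto_lintegral_sq hzt)
  have h2 := (Lp.tendsto_Lp_iff_tendsto_eLpNorm'' w hw wl hwl).2
    (tendsto_eLpNorm_of_tendsto_lintegral_sq hwt)
  let Q : (V →L[ℝ] ℝ) →L[ℝ] V →L[ℝ] ℝ := (ContinuousLinearMap.compL ℝ V V ℝ).flip B
  have hQ : ∀ {f : α → (V →L[ℝ] ℝ)} {g : α → V} (hf : MemLp f 2 μ) (hg : MemLp g 2 μ),
      Q.lpPairing μ 2 2 (hf.toLp f) (hg.toLp g) = ∫ x, f x (B (g x)) ∂μ := fun hf hg => by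
    rw [ContinuousLinearMap.lpPairing_eq_integral]
    refine integral_congr_ae ?_
    filter_upwards [hf.coeFn_toLp, hg.coeFn_toLp] with x h3 h4
    rw [h3, h4]
    rfl
  have h3 := ((isBoundedBilinearMap_apply (𝕜 := ℝ)).continuous.tendsto
    (Q.lpPairing μ 2 2 (hzl.toLp zl), hwl.toLp wl)).comp
      ((((Q.lpPairing μ 2 2).continuous.tendsto _).comp h1).prodMk_nhds h2)
  simp only [Function.comp_def, hQ] at h3
  exact h3

/-- The estimate `enorm_sq_le_of_continuous`, applied to differences of Steklov averages, makes them
uniformly Cauchy in `H` on each `[0, T]`. The limit `U` is therefore continuous, and the energy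
identity of the averages passes to the limit. -/
theorem exists_continuous_representative_of_intervalIntegrable [CompleteSpace V] [CompleteSpace H]
    {ι : V →L[ℝ] H} {u : ℝ → V} {du : ℝ → (V →L[ℝ] ℝ)} {u₀ : H}
    (hu₀ : u₀ ∈ closure (range ι))
    (hui : ∀ a b, IntervalIntegrable u volume a b) (hdi : ∀ a b, IntervalIntegrable du volume a b)
    (hu : MemL2Loc u) (hdu : MemL2Loc du)
    (h : ∀ v, ∀ T, 0 < T → ∀ᵐ t ∂volume.restrict (Ioo 0 T),
      ⟪ι (u t), ι v⟫_ℝ = ⟪u₀, ι v⟫_ℝ + (∫ s in 0..t, du s) v) :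
    ∃ U : ℝ → H, ContinuousOn U (Ici 0) ∧ (∀ᵐ t ∂volume.restrict (Ioi 0), ι (u t) = U t) ∧
      U 0 = u₀ ∧ (∀ t, 0 ≤ t → ∀ v, ⟪U t, ι v⟫_ℝ = ⟪u₀, ι v⟫_ℝ + (∫ s in 0..t, du s) v) ∧
      ∀ (P : H →L[ℝ] H) (PV : V →L[ℝ] V), (∀ v, ι (PV v) = P (ι v)) →
        (∀ x y, ⟪P x, y⟫_ℝ = ⟪x, P y⟫_ℝ) → ∀ t, 0 ≤ t →
          ⟪P (U t), U t⟫_ℝ = ⟪P u₀, u₀⟫_ℝ + 2 * ∫ s in 0..t, du s (PV (u s)) := by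
  set δ : ℕ → ℝ := fun n => 1 / ((n : ℝ) + 1) with hδdef
  have hδ : ∀ n, 0 < δ n := fun n => by simp only [hδdef]; positivity
  have hδt : Tendsto δ atTop (𝓝[>] 0) :=
    tendsto_nhdsWithin_iff.2 ⟨tendsto_one_div_add_atTop_nhds_zero_nat, Eventually.of_forall hδ⟩
  set D : ℝ → (V →L[ℝ] ℝ) := fun t => ∫ s in 0..t, du s with hD
  have hDc : Continuous D := intervalIntegral.continuous_primitive hdi 0
  set X : ℕ → ℝ → V := fun n => steklov (δ n) u with hX
  set Y : ℕ → ℝ → (V →L[ℝ] ℝ) := fun n => steklov (δ n) du with hY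
  set Z : ℕ → ℝ → (V →L[ℝ] ℝ) := fun n => steklov (δ n) D with hZ
  have hXc : ∀ n, Continuous (X n) := fun n => continuous_steklov hui
  have hYc : ∀ n, Continuous (Y n) := fun n => continuous_steklov hdi
  have hZd : ∀ n t, HasDerivAt (Z n) (Y n t) t := fun n t => hasDerivAt_steklov_primitive hdi t
  have hpair : ∀ n t, 0 ≤ t → ∀ v, ⟪ι (X n t), ι v⟫_ℝ = ⟪u₀, ι v⟫_ℝ + Z n t v := fun n t ht v =>
    inner_steklov_eq hui hdi h (hδ n) ht v
  have hZt : ∀ t, Tendsto (fun n => Z n t) atTop (𝓝 (D t)) := fun t =>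
    (tendsto_steklov_of_hasDerivAt (fun a b => hDc.intervalIntegrable a b)
      (intervalIntegral.integral_hasDerivAt_right (hDc.intervalIntegrable _ _)
        (hDc.stronglyMeasurableAtFilter _ _) hDc.continuousAt)).comp hδt
  have hXL : ∀ T, 0 < T →
      Tendsto (fun n => ∫⁻ t in Ioo 0 T, ‖X n t - u t‖ₑ ^ 2) atTop (𝓝 0) := fun T hT =>
    (tendsto_lintegral_steklov_sub (hu (T + 1) (by linarith))).comp hδt
  have hYL : ∀ T, 0 < T →
      Tendsto (fun n => ∫⁻ t in Ioo 0 T, ‖Y n t - du t‖ₑ ^ 2) atTop (𝓝 0) := fun T hT =>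
    (tendsto_lintegral_steklov_sub (hdu (T + 1) (by linarith))).comp hδt
  have hcauchy : ∀ T, 0 < T → UniformCauchySeqOn (fun n t => ι (X n t)) atTop (Icc 0 T) := by
    intro T hT
    set a : ℕ → ℝ≥0∞ := fun n =>
      (∫⁻ t in Ioo 0 T, ‖X n t - u t‖ₑ ^ 2) + ∫⁻ t in Ioo 0 T, ‖Y n t - du t‖ₑ ^ 2 with ha
    set C := ENNReal.ofReal (‖ι‖ ^ 2 / T + 1) with hC
    have hat : Tendsto (fun n => C * 2 * a n) atTop (𝓝 0) := by
      have := ENNReal.Tendsto.const_mul ((hXL T hT).add (hYL T hT)) (a := C * 2)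
        (Or.inr (ENNReal.mul_ne_top ENNReal.ofReal_ne_top (by simp)))
      simpa using this
    have hsq : ∀ {E : Type _} [NormedAddCommGroup E] (f g k : ℝ → E),
        AEStronglyMeasurable f (volume.restrict (Ioo 0 T)) →
        AEStronglyMeasurable k (volume.restrict (Ioo 0 T)) →
        ∫⁻ t in Ioo 0 T, ‖f t - g t‖ₑ ^ 2 ≤ 2 * (∫⁻ t in Ioo 0 T, ‖f t - k t‖ₑ ^ 2) +
          2 * ∫⁻ t in Ioo 0 T, ‖g t - k t‖ₑ ^ 2 := by
      intro E _ f g k hf hk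
      have hm : AEMeasurable (fun t => 2 * ‖f t - k t‖ₑ ^ 2) (volume.restrict (Ioo 0 T)) :=
        ((hf.sub hk).enorm.pow_const 2).const_mul 2
      rw [← lintegral_const_mul' _ _ (by simp), ← lintegral_const_mul' _ _ (by simp),
        ← lintegral_add_left' hm]
      refine lintegral_mono fun t => ?_
      refine le_trans ?_ (sq_add_le_two_mul _ _)
      refine pow_le_pow_left' ?_ 2
      rw [enorm_sub_rev (g t)]
      refine le_trans (le_of_eq ?_) (enorm_add_le _ _)
      congr 1; abel
    have hb : ∀ m n, ∀ t ∈ Icc 0 T, ‖ι (X m t) - ι (X n t)‖ₑ ^ 2 ≤ C * 2 * a m + C * 2 * a n := by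
      intro m n t ht
      -- The initial datum cancels in the difference of two averages, hence the constant part is
      -- `0`.
      have := enorm_sq_le_of_continuous (ι := ι) (w := fun t => X m t - X n t)
        (z := fun t => Z m t - Z n t) (z' := fun t => Y m t - Y n t) (c := fun _ => 0)
        ((hXc m).sub (hXc n)) ((hYc m).sub (hYc n)) (fun t => (hZd m t).sub (hZd n t))
        (fun t ht v => by
          simp only [map_sub, inner_sub_left, hpair m t ht v, hpair n t ht v, _root_.sub_apply]
          ring) hT ht
      rw [map_sub] at this
      refine this.trans ?_
      have e1 := hsq (X m) (X n) u (hXc m).aestronglyMeasurable (hu T hT).1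
      have e2 := hsq (Y m) (Y n) du (hYc m).aestronglyMeasurable (hdu T hT).1
      calc _ ≤ C * ((2 * (∫⁻ t in Ioo 0 T, ‖X m t - u t‖ₑ ^ 2) +
            2 * ∫⁻ t in Ioo 0 T, ‖X n t - u t‖ₑ ^ 2) +
            (2 * (∫⁻ t in Ioo 0 T, ‖Y m t - du t‖ₑ ^ 2) +
            2 * ∫⁻ t in Ioo 0 T, ‖Y n t - du t‖ₑ ^ 2)) := by gcongr
        _ = _ := by simp only [ha]; ring
    rw [Metric.uniformCauchySeqOn_iff]
    intro ε hε
    have hε2 : 0 < ENNReal.ofReal (ε ^ 2) / 2 := ENNReal.half_pos (by simpa using by positivity)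
    obtain ⟨N, hN⟩ := eventually_atTop.1 (hat.eventually (gt_mem_nhds hε2))
    refine ⟨N, fun m hm n hn t ht => ?_⟩
    have h1 := (hb m n t ht).trans_lt (ENNReal.add_lt_add (hN m hm) (hN n hn))
    rw [ENNReal.add_halves, enorm_sq_eq, ENNReal.ofReal_lt_ofReal_iff (by positivity)] at h1
    rw [dist_eq_norm]
    exact lt_of_pow_lt_pow_left₀ 2 hε.le h1
  have hlim : ∀ t, ∃ L, 0 ≤ t → Tendsto (fun n => ι (X n t)) atTop (𝓝 L) := fun t => by
    by_cases ht : 0 ≤ t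
    · have hcs := (hcauchy (t + 1) (by linarith)).cauchySeq (x := t) ⟨ht, by linarith⟩
      obtain ⟨L, hL⟩ := cauchySeq_tendsto_of_complete hcs
      exact ⟨L, fun _ => hL⟩
    · exact ⟨0, fun h' => absurd h' ht⟩
  choose U hU using hlim
  have hinner : ∀ t, 0 ≤ t → ∀ v, ⟪U t, ι v⟫_ℝ = ⟪u₀, ι v⟫_ℝ + D t v := fun t ht v => by
    have h1 : Tendsto (fun n => ⟪ι (X n t), ι v⟫_ℝ) atTop (𝓝 ⟪U t, ι v⟫_ℝ) :=
      (hU t ht).inner tendsto_const_nhds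
    have h2 : Tendsto (fun n => ⟪u₀, ι v⟫_ℝ + Z n t v) atTop (𝓝 (⟪u₀, ι v⟫_ℝ + D t v)) :=
      (((ContinuousLinearMap.apply ℝ ℝ v).continuous.tendsto _).comp (hZt t)).const_add _
    exact tendsto_nhds_unique (h1.congr fun n => hpair n t ht v) h2
  -- The pairing at time `0` shows only that `U 0 - u₀` is orthogonal to the range of `ι`. Both
  -- terms also lie in the closure of that range, and so the difference vanishes.
  have hU0 : U 0 = u₀ := by
    have hmem : U 0 - u₀ ∈ (LinearMap.range (ι : V →ₗ[ℝ] H)).topologicalClosure := by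
      refine Submodule.sub_mem _ ?_ ?_
      · exact mem_closure_of_tendsto (hU 0 le_rfl) (Eventually.of_forall fun n => ⟨X n 0, rfl⟩)
      · convert! hu₀
    have horth : U 0 - u₀ ∈ (LinearMap.range (ι : V →ₗ[ℝ] H))ᗮ := by
      rw [Submodule.mem_orthogonal']
      rintro _ ⟨v, rfl⟩
      have := hinner 0 le_rfl v
      simp only [hD, intervalIntegral.integral_same, _root_.zero_apply, add_zero] at this
      simp [inner_sub_left, this]
    rw [← Submodule.orthogonal_closure] at horth
    have := Submodule.inner_right_of_mem_orthogonal hmem horth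
    exact sub_eq_zero.1 (inner_self_eq_zero.1 this)
  refine ⟨U, ?_, ?_, hU0, hinner, ?_⟩
  · have hT : ∀ T, 0 < T → ContinuousOn U (Icc 0 T) := fun T hT =>
      ((hcauchy T hT).tendstoUniformlyOn_of_tendsto fun t ht => hU t ht.1).continuousOn
        (Frequently.of_forall fun n => (ι.continuous.comp (hXc n)).continuousOn)
    intro t ht
    have h1 := hT (t + 1) (by linarith [mem_Ici.1 ht]) t ⟨ht, by linarith⟩
    refine h1.mono_of_mem_nhdsWithin ?_
    filter_upwards [self_mem_nhdsWithin, mem_nhdsWithin_of_mem_nhds (Iio_mem_nhds (lt_add_one t))]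
      with x hx hx'
    exact ⟨hx, le_of_lt hx'⟩
  -- At almost every `t` the averages converge to `u t` in `V` by Lebesgue differentiation, and
  -- after `ι` also to `U t`.
  · have hae : ∀ᵐ t, ∀ n : ℕ, t ∈ uIcc (0 : ℝ) n → ∀ c ∈ uIcc (0 : ℝ) n,
        HasDerivAt (fun x => ∫ s in c..x, u s) (u t) t :=
      ae_all_iff.2 fun n => (hui 0 n).ae_hasDerivAt_integral
    rw [ae_restrict_iff' measurableSet_Ioi]
    filter_upwards [hae] with t ht ht0
    obtain ⟨n, hn⟩ := exists_nat_ge t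
    have hd := ht n (by rw [uIcc_of_le (by positivity)]; exact ⟨le_of_lt ht0, hn⟩) 0
      left_mem_uIcc
    exact tendsto_nhds_unique ((ι.continuous.tendsto _).comp
      ((tendsto_steklov_of_hasDerivAt hui hd).comp hδt)) (hU t (le_of_lt ht0))
  · intro P PV hPV hP t ht
    rcases ht.eq_or_lt with rfl | ht0
    · simp [hU0]
    have hid : ∀ n, ⟪P (ι (X n t)), ι (X n t)⟫_ℝ = ⟪P (ι (X n 0)), ι (X n 0)⟫_ℝ +
        2 * ∫ τ in Ioo 0 t, Y n τ (PV (X n τ)) := fun n => by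
      rw [energy_identity_of_continuous hPV hP (hXc n) (hYc n) (hZd n) (hpair n) le_rfl ht,
        intervalIntegral.integral_of_le ht, integral_Ioc_eq_integral_Ioo]
    have hint := tendsto_integral_pairing PV
      (fun n => memLp_Ioo_of_continuousOn (T := t) (hYc n).continuousOn) (hdu t ht0)
      (fun n => memLp_Ioo_of_continuousOn (T := t) (hXc n).continuousOn) (hu t ht0)
      (hYL t ht0) (hXL t ht0)
    have hPt : ∀ s, 0 ≤ s →
        Tendsto (fun n => ⟪P (ι (X n s)), ι (X n s)⟫_ℝ) atTop (𝓝 ⟪P (U s), U s⟫_ℝ) :=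
      fun s hs => ((P.continuous.tendsto _).comp (hU s hs)).inner (hU s hs)
    rw [intervalIntegral.integral_of_le ht, integral_Ioc_eq_integral_Ioo, ← hU0]
    exact tendsto_nhds_unique ((hPt t ht).congr hid) ((hPt 0 le_rfl).add (hint.const_mul 2))

/-- A function of `L²_loc(V)` with weak derivative in `L²_loc(V*)` has a representative that is
continuous with values in `H`, for which the derivative of `½ ⟪P u, u⟫` is the duality pairing. -/
theorem exists_continuous_representative [CompleteSpace V] [CompleteSpace H]
    (ι : V →L[ℝ] H) {u : ℝ → V} {du : ℝ → (V →L[ℝ] ℝ)} {u₀ : H}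
    (hu₀ : u₀ ∈ closure (range ι)) (hu : MemL2Loc u) (hdu : MemL2Loc du)
    (h : ∀ v, HasWeakDerivFrom ⟪u₀, ι v⟫_ℝ (fun t => ⟪ι (u t), ι v⟫_ℝ) (fun t => du t v)) :
    ∃ U : ℝ → H, ContinuousOn U (Ici 0) ∧ (∀ᵐ t ∂volume.restrict (Ioi 0), ι (u t) = U t) ∧
      U 0 = u₀ ∧
      (∀ v, ∀ T, 0 ≤ T → IsPrimitiveOn T (fun t => ⟪U t, ι v⟫_ℝ) (fun t => du t v)) ∧
      ∀ (P : H →L[ℝ] H) (PV : V →L[ℝ] V), (∀ v, ι (PV v) = P (ι v)) →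
        (∀ x y, ⟪P x, y⟫_ℝ = ⟪x, P y⟫_ℝ) → ∀ T, 0 ≤ T →
          IsPrimitiveOn T (fun t => ⟪P (U t), U t⟫_ℝ) (fun t => 2 * du t (PV (u t))) := by
  have hint : ∀ {E : Type _} [NormedAddCommGroup E] {f : ℝ → E}, MemL2Loc f → ∀ T, 0 < T →
      IntegrableOn f (Ioo 0 T) := fun hf T hT => (hf T hT).integrable (by norm_num)
  -- Negative times carry no information, so functions are extended by zero there; this gives the
  -- local integrability on all of `ℝ` that the averages require.
  have hext : ∀ {E : Type _} [NormedAddCommGroup E] {f : ℝ → E}, MemL2Loc f →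
      ∀ a b, IntervalIntegrable ((Ioi 0).indicator f) volume a b := by
    intro E _ f hf a b
    refine (IntegrableOn.mono_set (t := Iio (max (max a b) 0 + 1)) ?_ ?_).intervalIntegrable
    · rw [IntegrableOn, integrable_indicator_iff measurableSet_Ioi, IntegrableOn,
        Measure.restrict_restrict measurableSet_Ioi, Ioi_inter_Iio]
      exact hint hf _ (by positivity)
    · intro x hx
      have := hx.2
      exact lt_of_le_of_lt (this.trans (le_max_left _ _)) (lt_add_one _)
  have hcongr : ∀ {E : Type _} [NormedAddCommGroup E] {f : ℝ → E}, MemL2Loc f →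
      MemL2Loc ((Ioi 0).indicator f) := by
    intro E _ f hf T hT
    refine (memLp_congr_ae ?_).1 (hf T hT)
    filter_upwards [ae_restrict_mem measurableSet_Ioo] with t ht
    rw [indicator_of_mem (show t ∈ Ioi 0 from ht.1)]
  have hIoo : ∀ {E : Type _} [NormedAddCommGroup E] [NormedSpace ℝ E] (f : ℝ → E) (t : ℝ), 0 ≤ t →
      ∫ s in 0..t, (Ioi 0).indicator f s = ∫ s in 0..t, f s := by
    intro E _ _ f t ht
    refine intervalIntegral.integral_congr_ae (ae_of_all _ fun s hs => ?_)
    rw [uIoc_of_le ht] at hs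
    exact indicator_of_mem hs.1 f
  have hev : ∀ t, 0 ≤ t → ∀ v, (∫ s in 0..t, (Ioi 0).indicator du s) v = ∫ s in 0..t, du s v := by
    intro t ht v
    have h1 := (ContinuousLinearMap.apply ℝ ℝ v).intervalIntegral_comp_comm (hext hdu 0 t)
    simp only [ContinuousLinearMap.apply_apply] at h1
    rw [← h1, ← hIoo (fun s => du s v) t ht]
    refine intervalIntegral.integral_congr fun s _ => ?_
    by_cases hs : s ∈ Ioi (0 : ℝ) <;> simp [hs]
  have hdv : ∀ v, ∀ T, 0 < T → IntegrableOn (fun t => du t v) (Ioo 0 T) := fun v T hT =>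
    (ContinuousLinearMap.apply ℝ ℝ v).integrable_comp (hint hdu T hT)
  obtain ⟨U, hUc, hUae, hU0, hUi, hUP⟩ := exists_continuous_representative_of_intervalIntegrable
    (ι := ι) hu₀ (hext hu) (hext hdu) (hcongr hu) (hcongr hdu) fun v T hT => by
      have := (h v).ae_eq_primitive (fun T hT => ?_) (hdv v) hT
      · filter_upwards [this, ae_restrict_mem measurableSet_Ioo] with t ht htm
        rw [indicator_of_mem (show t ∈ Ioi 0 from htm.1), hev t htm.1.le, ht]
      · have := ((innerSL ℝ (ι v)).comp ι).integrable_comp (hint hu T hT)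
        refine this.congr (ae_of_all _ fun t => ?_)
        simp [real_inner_comm]
  have hii : ∀ {f : ℝ → ℝ} {T : ℝ}, 0 ≤ T → (0 < T → IntegrableOn f (Ioo 0 T)) →
      IntervalIntegrable f volume 0 T := fun {f T} hT hf => by
    rcases hT.eq_or_lt with rfl | hT'
    · simp
    · rw [intervalIntegrable_iff_integrableOn_Ioo_of_le hT]
      exact hf hT'
  refine ⟨U, hUc, ?_, hU0, fun v T hT => ⟨hii hT (hdv v T), fun t ht => ?_⟩,
    fun P PV hPV hP T hT => ⟨hii hT fun hT' => ?_, fun t ht => ?_⟩⟩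
  · filter_upwards [hUae, ae_restrict_mem measurableSet_Ioi] with t ht htm
    rwa [indicator_of_mem htm] at ht
  · simp only [hU0]
    rw [hUi t ht.1, hev t ht.1]
  · have h1 := ((hdu T hT').norm.integrable_mul (hu T hT').norm).const_mul ‖PV‖
    refine Integrable.const_mul (h1.mono' ?_ (ae_of_all _ fun s => ?_)) 2
    · exact (isBoundedBilinearMap_apply (𝕜 := ℝ)).continuous.comp_aestronglyMeasurable
        ((hdu T hT').1.prodMk (PV.continuous.comp_aestronglyMeasurable (hu T hT').1))
    · refine ((du s).le_opNorm _).trans ?_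
      rw [Pi.mul_apply, mul_left_comm]
      gcongr
      exact PV.le_opNorm _
  · simp only [hU0]
    rw [hUP P PV hPV hP t ht.1, intervalIntegral.integral_const_mul]
    congr 2
    refine intervalIntegral.integral_congr_ae (ae_of_all _ fun s hs => ?_)
    rw [uIoc_of_le ht.1] at hs
    simp only [indicator_of_mem (show s ∈ Ioi 0 from hs.1)]

end Evolution

end

section

/-! ### Real characters of the torus -/

variable {n : ℕ}

instance : (torusMeasure n).IsAddHaarMeasure := by
  unfold torusMeasure; infer_instance

/-- The character `cos (2π ξ·x)`. -/
def cosChar (ξ : Fin n → ℤ) (x : UnitAddTorus (Fin n)) : ℝ := (UnitAddTorus.mFourier ξ x).re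

/-- The character `sin (2π ξ·x)`. -/
def sinChar (ξ : Fin n → ℤ) (x : UnitAddTorus (Fin n)) : ℝ := (UnitAddTorus.mFourier ξ x).im

/-- The phase `2π ξ·p`. -/
def phase (ξ : Fin n → ℤ) (p : Fin n → ℝ) : ℝ := 2 * Real.pi * ∑ i, (ξ i : ℝ) * p i

theorem mFourier_lift (ξ : Fin n → ℤ) (p : Fin n → ℝ) :
    UnitAddTorus.mFourier ξ (fun i => (p i : UnitAddCircle)) =
      Complex.exp ((phase ξ p : ℝ) * Complex.I) := by
  simp only [UnitAddTorus.mFourier, ContinuousMap.coe_mk, fourier_coe_apply, ← Complex.exp_sum]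
  congr 1
  simp only [phase, Complex.ofReal_mul, Complex.ofReal_sum, Finset.mul_sum, Finset.sum_mul]
  refine Finset.sum_congr rfl fun i _ => ?_
  push_cast
  ring

theorem cosChar_lift (ξ : Fin n → ℤ) (p : Fin n → ℝ) :
    cosChar ξ (fun i => (p i : UnitAddCircle)) = Real.cos (phase ξ p) := by
  rw [cosChar, mFourier_lift, Complex.exp_ofReal_mul_I_re]

theorem sinChar_lift (ξ : Fin n → ℤ) (p : Fin n → ℝ) :
    sinChar ξ (fun i => (p i : UnitAddCircle)) = Real.sin (phase ξ p) := by
  rw [sinChar, mFourier_lift, Complex.exp_ofReal_mul_I_im]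

theorem exists_lift (x : UnitAddTorus (Fin n)) :
    ∃ p : Fin n → ℝ, (fun i => (p i : UnitAddCircle)) = x := by
  choose p hp using fun i => QuotientAddGroup.mk_surjective (x i)
  exact ⟨p, funext hp⟩

theorem phase_add (ξ : Fin n → ℤ) (p q : Fin n → ℝ) :
    phase ξ (fun i => p i + q i) = phase ξ p + phase ξ q := by
  simp only [phase, mul_add, Finset.sum_add_distrib]

theorem cosChar_sub (ξ : Fin n → ℤ) (x y : UnitAddTorus (Fin n)) :
    cosChar ξ (x - y) = cosChar ξ x * cosChar ξ y + sinChar ξ x * sinChar ξ y := by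
  obtain ⟨p, rfl⟩ := exists_lift x
  obtain ⟨q, rfl⟩ := exists_lift y
  have h : ((fun i => (p i : UnitAddCircle)) - fun i => (q i : UnitAddCircle)) =
      fun i => (((fun i => p i + -q i) i : ℝ) : UnitAddCircle) := by
    ext i; simp [sub_eq_add_neg]
  have h2 : phase ξ (fun i => p i + -q i) = phase ξ p - phase ξ q := by
    rw [phase_add ξ p (fun i => -q i)]; simp [phase, sub_eq_add_neg]
  simp only [h, cosChar_lift, sinChar_lift, h2, Real.cos_sub]

theorem cosChar_sq_add_sinChar_sq (ξ : Fin n → ℤ) (x : UnitAddTorus (Fin n)) :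
    cosChar ξ x ^ 2 + sinChar ξ x ^ 2 = 1 := by
  obtain ⟨p, rfl⟩ := exists_lift x
  rw [cosChar_lift, sinChar_lift, Real.cos_sq_add_sin_sq]

theorem continuous_cosChar (ξ : Fin n → ℤ) : Continuous (cosChar ξ) :=
  Complex.continuous_re.comp (UnitAddTorus.mFourier ξ).continuous

theorem continuous_sinChar (ξ : Fin n → ℤ) : Continuous (sinChar ξ) :=
  Complex.continuous_im.comp (UnitAddTorus.mFourier ξ).continuous

theorem abs_cosChar_le (ξ : Fin n → ℤ) (x : UnitAddTorus (Fin n)) : |cosChar ξ x| ≤ 1 := by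
  rw [← sq_le_one_iff_abs_le_one]
  nlinarith [cosChar_sq_add_sinChar_sq ξ x, sq_nonneg (sinChar ξ x)]

theorem abs_sinChar_le (ξ : Fin n → ℤ) (x : UnitAddTorus (Fin n)) : |sinChar ξ x| ≤ 1 := by
  rw [← sq_le_one_iff_abs_le_one]
  nlinarith [cosChar_sq_add_sinChar_sq ξ x, sq_nonneg (cosChar ξ x)]

theorem cosChar_zero (x : UnitAddTorus (Fin n)) : cosChar 0 x = 1 := by
  simp [cosChar, UnitAddTorus.mFourier_zero]

theorem sinChar_zero (x : UnitAddTorus (Fin n)) : sinChar 0 x = 0 := by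
  simp [sinChar, UnitAddTorus.mFourier_zero]

/-! ### Averages of translates -/

/-- A strongly continuous family of contractions indexed by the torus. -/
structure ContractionFamily (n : ℕ) (F : Type*) [NormedAddCommGroup F] [NormedSpace ℝ F] where
  /-- The contraction attached to a point of the torus. -/
  map : UnitAddTorus (Fin n) → F →L[ℝ] F
  norm_map_le : ∀ a v, ‖map a v‖ ≤ ‖v‖
  continuous_map : ∀ v, Continuous fun a => map a v

namespace ContractionFamily

variable {F F' : Type*} [NormedAddCommGroup F] [NormedSpace ℝ F]
  [NormedAddCommGroup F'] [NormedSpace ℝ F']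

theorem integrable (T : ContractionFamily n F) (ξ : Fin n → ℤ) (v : F) :
    Integrable (fun a => cosChar ξ a • T.map a v) (torusMeasure n) :=
  ((continuous_cosChar ξ).smul (T.continuous_map v)).integrable_of_hasCompactSupport
    (HasCompactSupport.of_compactSpace _)

/-- The average of a family of translations against `cos (2π ξ·a)`, i.e. the real Fourier
projector at the frequency `ξ`. -/
def average (T : ContractionFamily n F) (ξ : Fin n → ℤ) : F →L[ℝ] F :=
  LinearMap.mkContinuous
    { toFun := fun v => ∫ a, cosChar ξ a • T.map a v ∂torusMeasure n
      map_add' := fun v w => by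
        simp only [map_add, smul_add]
        exact integral_add (T.integrable ξ v) (T.integrable ξ w)
      map_smul' := fun c v => by
        simp only [map_smul, RingHom.id_apply]
        rw [← integral_smul]
        simp only [smul_comm c] }
    1 fun v => by
      refine (norm_integral_le_of_norm_le_const (C := ‖v‖) (ae_of_all _ fun a => ?_)).trans ?_
      · rw [norm_smul, Real.norm_eq_abs]
        exact (mul_le_mul (abs_cosChar_le ξ a) (T.norm_map_le a v) (norm_nonneg _)
          zero_le_one).trans_eq (one_mul _)
      · simp

theorem average_apply (T : ContractionFamily n F) (ξ : Fin n → ℤ) (v : F) :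
    T.average ξ v = ∫ a, cosChar ξ a • T.map a v ∂torusMeasure n := rfl

theorem norm_average_le (T : ContractionFamily n F) (ξ : Fin n → ℤ) (v : F) :
    ‖T.average ξ v‖ ≤ ‖v‖ := by
  have := (T.average ξ).le_of_opNorm_le (LinearMap.mkContinuous_norm_le _ zero_le_one _) v
  rwa [one_mul] at this

theorem map_average [CompleteSpace F] [CompleteSpace F'] (T : ContractionFamily n F) (ξ : Fin n → ℤ)
    (L : F →L[ℝ] F') (v : F) :
    L (T.average ξ v) = ∫ a, cosChar ξ a • L (T.map a v) ∂torusMeasure n := by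
  rw [average_apply, ← L.integral_comp_comm (T.integrable ξ v)]
  simp only [map_smul]

/-- A continuous linear map commutes with a Bochner integral, so whatever commutes with translations
commutes with the projectors. Velocity, gradient and symmetrization are all handled this way. -/
theorem average_intertwine [CompleteSpace F] [CompleteSpace F'] (T : ContractionFamily n F)
    (T' : ContractionFamily n F') (L : F →L[ℝ] F') (h : ∀ a v, L (T.map a v) = T'.map a (L v))
    (ξ : Fin n → ℤ) (v : F) : L (T.average ξ v) = T'.average ξ (L v) := by
  rw [map_average, average_apply]
  simp only [h]

end ContractionFamily

/-! ### Translations of functions on the torus and on the slab -/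

theorem measurePreserving_torusShift (a : UnitAddTorus (Fin n)) :
    MeasurePreserving (fun x => x + a) (torusMeasure n) (torusMeasure n) :=
  measurePreserving_add_right _ a

theorem measurePreserving_slabShift (ℓ : ℝ) (a : UnitAddTorus (Fin n)) :
    MeasurePreserving (fun z : UnitAddTorus (Fin n) × ℝ => (z.1 + a, z.2))
      (slabMeasure n ℓ) (slabMeasure n ℓ) :=
  (measurePreserving_torusShift a).prod (MeasurePreserving.id _)

/-- Translations in `L²(Σ)`. -/
def torusTranslation (n : ℕ) : ContractionFamily n (L2Torus n) where
  map a := (Lp.compMeasurePreservingₗᵢ ℝ _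
    (measurePreserving_torusShift a)).toContinuousLinearMap
  norm_map_le a v := ((Lp.compMeasurePreservingₗᵢ ℝ _
    (measurePreserving_torusShift a)).norm_map v).le
  continuous_map v := by
    let τ : UnitAddTorus (Fin n) → C(UnitAddTorus (Fin n), UnitAddTorus (Fin n)) :=
      fun a => ⟨fun x => x + a, by fun_prop⟩
    have hτ : Continuous τ := ContinuousMap.continuous_of_continuous_uncurry _
      (by simp only [τ, ContinuousMap.coe_mk, Function.uncurry_def]; fun_prop)
    exact (continuous_const (y := v)).compMeasurePreservingLp hτ
      (fun a => measurePreserving_torusShift a) (by simp)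

/-- Horizontal translations in `L²(Ω; E)`. -/
def slabTranslation (n : ℕ) (ℓ : ℝ) (E : Type*) [NormedAddCommGroup E] [NormedSpace ℝ E] :
    ContractionFamily n (Lp E 2 (slabMeasure n ℓ)) where
  map a := (Lp.compMeasurePreservingₗᵢ ℝ _
    (measurePreserving_slabShift ℓ a)).toContinuousLinearMap
  norm_map_le a v := ((Lp.compMeasurePreservingₗᵢ ℝ _
    (measurePreserving_slabShift ℓ a)).norm_map v).le
  continuous_map v := by
    let τ : UnitAddTorus (Fin n) → C(UnitAddTorus (Fin n) × ℝ, UnitAddTorus (Fin n) × ℝ) :=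
      fun a => ⟨fun z => (z.1 + a, z.2), by fun_prop⟩
    have hτ : Continuous τ := ContinuousMap.continuous_of_continuous_uncurry _
      (by simp only [τ, ContinuousMap.coe_mk, Function.uncurry_def]; fun_prop)
    exact (continuous_const (y := v)).compMeasurePreservingLp hτ
      (fun a => measurePreserving_slabShift ℓ a) (by simp)

theorem coeFn_torusTranslation (a : UnitAddTorus (Fin n)) (b : L2Torus n) :
    (torusTranslation n).map a b =ᵐ[torusMeasure n] fun x => b (x + a) :=
  Lp.coeFn_compMeasurePreserving b (measurePreserving_torusShift a)

theorem coeFn_slabTranslation {ℓ : ℝ} {E : Type*} [NormedAddCommGroup E] [NormedSpace ℝ E]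
    (a : UnitAddTorus (Fin n)) (w : Lp E 2 (slabMeasure n ℓ)) :
    (slabTranslation n ℓ E).map a w =ᵐ[slabMeasure n ℓ] fun z => w (z.1 + a, z.2) :=
  Lp.coeFn_compMeasurePreserving w (measurePreserving_slabShift ℓ a)

theorem integral_slabShift (ℓ : ℝ) (a : UnitAddTorus (Fin n)) (f : UnitAddTorus (Fin n) × ℝ → ℝ) :
    ∫ z, f (z.1 + a, z.2) ∂slabMeasure n ℓ = ∫ z, f z ∂slabMeasure n ℓ :=
  (measurePreserving_slabShift ℓ a).integral_comp
    (((Homeomorph.addRight a).prodCongr (Homeomorph.refl ℝ)).measurableEmbedding) f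

theorem integral_torusShift (a : UnitAddTorus (Fin n)) (f : UnitAddTorus (Fin n) → ℝ) :
    ∫ x, f (x + a) ∂torusMeasure n = ∫ x, f x ∂torusMeasure n :=
  integral_add_right_eq_self f a

/-- The translate `φ(x - a, y)`. -/
def shiftFun (a : UnitAddTorus (Fin n)) (φ : UnitAddTorus (Fin n) × ℝ → ℝ) :
    UnitAddTorus (Fin n) × ℝ → ℝ := fun z => φ (z.1 - a, z.2)

theorem IsSmooth.shiftFun {φ : UnitAddTorus (Fin n) × ℝ → ℝ} (hφ : IsSmooth φ)
    (a : UnitAddTorus (Fin n)) : IsSmooth (shiftFun a φ) := by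
  obtain ⟨q, rfl⟩ := exists_lift a
  have h : ContDiff ℝ ∞ fun p : (Fin n → ℝ) × ℝ => ((p.1 - q, p.2) : (Fin n → ℝ) × ℝ) := by fun_prop
  exact ContDiff.comp
    (g := fun p : (Fin n → ℝ) × ℝ => φ (fun i => (p.1 i : UnitAddCircle), p.2)) hφ h

theorem partialDeriv_shiftFun (j : Fin (n + 1)) (a : UnitAddTorus (Fin n))
    (φ : UnitAddTorus (Fin n) × ℝ → ℝ) :
    partialDeriv j (shiftFun a φ) = shiftFun a (partialDeriv j φ) := by
  funext z
  simp only [partialDeriv, shiftFun]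
  congr 1
  funext s
  congr 1
  ext1
  · simp only [Prod.fst_add]; abel
  · simp

theorem integral_translate_mul {ℓ : ℝ} {ι : Type*} [Fintype ι]
    (w : Lp (EuclideanSpace ℝ ι) 2 (slabMeasure n ℓ)) (j : ι) (a : UnitAddTorus (Fin n))
    (φ : UnitAddTorus (Fin n) × ℝ → ℝ) :
    ∫ z, (slabTranslation n ℓ _).map a w z j * φ z ∂slabMeasure n ℓ =
      ∫ z, w z j * shiftFun a φ z ∂slabMeasure n ℓ := by
  rw [← integral_slabShift ℓ a (fun z => w z j * shiftFun a φ z)]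
  refine integral_congr_ae ?_
  filter_upwards [coeFn_slabTranslation a w] with z hz
  rw [hz]
  simp [shiftFun]

theorem integral_torusTranslate_mul (b : L2Torus n) (a : UnitAddTorus (Fin n))
    (φ : UnitAddTorus (Fin n) → ℝ) :
    ∫ x, (torusTranslation n).map a b x * φ x ∂torusMeasure n =
      ∫ x, b x * φ (x - a) ∂torusMeasure n := by
  rw [← integral_torusShift a (fun x => b x * φ (x - a))]
  refine integral_congr_ae ?_
  filter_upwards [coeFn_torusTranslation a b] with z hz
  rw [hz]
  simp

end

section

variable {n : ℕ} {ℓ : ℝ}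

/-! ### Completeness of the space of divergence-free fields -/

/-- Integration of the `j`-th component against a continuous function. -/
def coordPairing {ι : Type*} [Fintype ι] [DecidableEq ι] (n : ℕ) (ℓ : ℝ) (j : ι)
    (φ : UnitAddTorus (Fin n) × ℝ → ℝ) (hφ : Continuous φ) :
    Lp (EuclideanSpace ℝ ι) 2 (slabMeasure n ℓ) →L[ℝ] ℝ :=
  innerSL ℝ (((ContinuousLinearMap.toSpanSingleton ℝ (EuclideanSpace.single j (1 : ℝ))).comp_memLp'
    (memLp_of_continuous ℓ hφ)).toLp _)

theorem coordPairing_apply {ι : Type*} [Fintype ι] [DecidableEq ι] (j : ι)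
    {φ : UnitAddTorus (Fin n) × ℝ → ℝ} (hφ : Continuous φ)
    (w : Lp (EuclideanSpace ℝ ι) 2 (slabMeasure n ℓ)) :
    coordPairing n ℓ j φ hφ w = ∫ z, w z j * φ z ∂slabMeasure n ℓ := by
  rw [coordPairing, innerSL_apply_apply, L2.inner_def]
  refine integral_congr_ae ?_
  filter_upwards [((ContinuousLinearMap.toSpanSingleton ℝ
    (EuclideanSpace.single j (1 : ℝ))).comp_memLp' (memLp_of_continuous ℓ hφ)).coeFn_toLp] with z hz
  rw [hz]
  simp [inner_smul_left, EuclideanSpace.inner_single_left, mul_comm]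

/-- The divergence as an operator on velocity gradients. -/
def divOp (n : ℕ) (ℓ : ℝ) : L2Mat n ℓ →L[ℝ] Lp ℝ 2 (slabMeasure n ℓ) :=
  (∑ i, EuclideanSpace.proj (𝕜 := ℝ) ((i, i) : Fin (n + 1) × Fin (n + 1)) :
    EuclideanSpace ℝ (Fin (n + 1) × Fin (n + 1)) →L[ℝ] ℝ).compLpL 2 (slabMeasure n ℓ)

theorem divOp_eq_zero_iff (G : L2Mat n ℓ) :
    divOp n ℓ G = 0 ↔ ∀ᵐ z ∂slabMeasure n ℓ, ∑ i, G z (i, i) = 0 := by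
  rw [Lp.eq_zero_iff_ae_eq_zero]
  have h := ContinuousLinearMap.coeFn_compLpL (p := 2) (∑ i, EuclideanSpace.proj (𝕜 := ℝ)
    ((i, i) : Fin (n + 1) × Fin (n + 1)) : EuclideanSpace ℝ (Fin (n + 1) × Fin (n + 1)) →L[ℝ] ℝ) G
  constructor
  · intro h0
    filter_upwards [h, h0] with z h1 h2
    have h3 := h1.symm.trans h2
    simpa using h3
  · intro h0
    filter_upwards [h, h0] with z h1 h2
    refine h1.trans ?_
    simpa using h2

theorem isDivFreeField_iff (u : L2Vec n ℓ) (G : L2Mat n ℓ) : IsDivFreeField u G ↔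
    (∀ i j φ, ∀ hφ : IsSmooth φ, tsupport φ ⊆ univ ×ˢ Ioo 0 ℓ →
      coordPairing n ℓ j (partialDeriv i φ) (hφ.continuous_partialDeriv i) u =
        -coordPairing n ℓ (i, j) φ hφ.continuous G) ∧
    (∀ j φ, ∀ hφ : IsSmooth φ, (∀ x, φ (x, ℓ) = 0) →
      coordPairing n ℓ j (partialDeriv (Fin.last n) φ) (hφ.continuous_partialDeriv _) u +
        coordPairing n ℓ (Fin.last n, j) φ hφ.continuous G = 0) ∧ divOp n ℓ G = 0 := by
  simp only [coordPairing_apply, divOp_eq_zero_iff]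
  have hadd : ∀ j φ, IsSmooth φ →
      ∫ z, (u z j * partialDeriv (Fin.last n) φ z + G z (Fin.last n, j) * φ z) ∂slabMeasure n ℓ =
        ∫ z, u z j * partialDeriv (Fin.last n) φ z ∂slabMeasure n ℓ +
          ∫ z, G z (Fin.last n, j) * φ z ∂slabMeasure n ℓ := fun j φ hφ =>
    integral_add (integrable_coord_mul u j (hφ.continuous_partialDeriv _))
      (integrable_coord_mul G (Fin.last n, j) hφ.continuous)
  constructor
  · rintro ⟨h1, h2, h3⟩
    exact ⟨fun i j φ hφ hs => h1 i j φ hφ hs,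
      fun j φ hφ hb => by rw [← hadd j φ hφ]; exact h2 j φ hφ hb, h3⟩
  · rintro ⟨h1, h2, h3⟩
    exact ⟨fun i j φ hφ hs => h1 i j φ hφ hs,
      fun j φ hφ hb => by rw [hadd j φ hφ]; exact h2 j φ hφ hb, h3⟩

/-- Each defining condition equates continuous linear expressions in the pair `(u, ∇u)`. The
resulting completeness allows Bochner integrals in the space, both for the projectors and for the
Steklov averages. -/
theorem isClosed_divFree (n : ℕ) (ℓ : ℝ) :
    IsClosed (divFree n ℓ : Set (WithLp 2 (L2Vec n ℓ × L2Mat n ℓ))) := by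
  have h : (divFree n ℓ : Set (WithLp 2 (L2Vec n ℓ × L2Mat n ℓ))) =
      {p | IsDivFreeField p.fst p.snd} := rfl
  rw [h]
  simp only [isDivFreeField_iff, ofPred_and, ofPred_forall]
  have hf : Continuous fun p : WithLp 2 (L2Vec n ℓ × L2Mat n ℓ) => p.fst :=
    WithLp.continuous_fst _ _ _
  have hs : Continuous fun p : WithLp 2 (L2Vec n ℓ × L2Mat n ℓ) => p.snd :=
    WithLp.continuous_snd _ _ _
  refine IsClosed.inter ?_ (IsClosed.inter ?_ ?_)
  · exact isClosed_iInter fun i => isClosed_iInter fun j => isClosed_iInter fun φ =>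
      isClosed_iInter fun hφ => isClosed_iInter fun _ =>
        isClosed_eq ((ContinuousLinearMap.continuous _).comp hf)
          ((ContinuousLinearMap.continuous _).comp hs).neg
  · exact isClosed_iInter fun j => isClosed_iInter fun φ =>
      isClosed_iInter fun hφ => isClosed_iInter fun _ =>
        isClosed_eq (((ContinuousLinearMap.continuous _).comp hf).add
          ((ContinuousLinearMap.continuous _).comp hs)) continuous_const
  · exact isClosed_eq ((divOp n ℓ).continuous.comp hs) continuous_const

instance : CompleteSpace (divFree n ℓ) := (isClosed_divFree n ℓ).completeSpace_coe

/-! ### Translations and projections of divergence-free fields -/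

/-- All conditions but the divergence are tested by duality, so the shift moves to the test
function. The latter stays admissible because its support and boundary conditions restrict `y` only.
-/
theorem IsDivFreeField.translate {u : L2Vec n ℓ} {G : L2Mat n ℓ} (h : IsDivFreeField u G)
    (a : UnitAddTorus (Fin n)) :
    IsDivFreeField ((slabTranslation n ℓ _).map a u) ((slabTranslation n ℓ _).map a G) := by
  refine ⟨fun i j φ hφ hs => ?_, fun j φ hφ hb => ?_, ?_⟩
  · rw [integral_translate_mul, integral_translate_mul G (i, j), ← partialDeriv_shiftFun]
    refine h.grad i j _ (hφ.shiftFun a) fun z hz => ?_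
    have hc : Continuous fun z : UnitAddTorus (Fin n) × ℝ => (z.1 - a, z.2) := by fun_prop
    have := hs (tsupport_comp_subset_preimage φ hc hz)
    exact ⟨mem_univ _, this.2⟩
  · have h1 := h.bottom j _ (hφ.shiftFun a) fun x => hb _
    rw [integral_add (integrable_coord_mul _ _ (hφ.continuous_partialDeriv _))
      (integrable_coord_mul _ (Fin.last n, j) hφ.continuous), integral_translate_mul,
      integral_translate_mul G (Fin.last n, j), ← partialDeriv_shiftFun]
    rwa [integral_add (integrable_coord_mul _ _ ((hφ.shiftFun a).continuous_partialDeriv _))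
      (integrable_coord_mul _ (Fin.last n, j) (hφ.shiftFun a).continuous)] at h1
  · filter_upwards [coeFn_slabTranslation a G,
      (measurePreserving_slabShift ℓ a).quasiMeasurePreserving.ae h.div_free] with z h1 h2
    rw [h1]
    exact h2

/-- The velocity of a divergence-free field. -/
def velocity (n : ℕ) (ℓ : ℝ) : divFree n ℓ →L[ℝ] L2Vec n ℓ :=
  (WithLp.fstL 2 ℝ (L2Vec n ℓ) (L2Mat n ℓ)).comp (divFree n ℓ).subtypeL

/-- The velocity gradient of a divergence-free field. -/
def gradient (n : ℕ) (ℓ : ℝ) : divFree n ℓ →L[ℝ] L2Mat n ℓ :=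
  (WithLp.sndL 2 ℝ (L2Vec n ℓ) (L2Mat n ℓ)).comp (divFree n ℓ).subtypeL

/-- Horizontal translations of divergence-free fields. -/
def divFreeTranslation (n : ℕ) (ℓ : ℝ) : ContractionFamily n (divFree n ℓ) where
  map a := (((Lp.compMeasurePreservingₗᵢ ℝ _ (measurePreserving_slabShift ℓ a)).withLpProdMap 2
    (Lp.compMeasurePreservingₗᵢ ℝ _ (measurePreserving_slabShift ℓ a))).toContinuousLinearMap.comp
      (divFree n ℓ).subtypeL).codRestrict (divFree n ℓ)
        fun v => IsDivFreeField.translate v.2 a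
  norm_map_le a v := (((Lp.compMeasurePreservingₗᵢ ℝ _
    (measurePreserving_slabShift ℓ a)).withLpProdMap 2
      (Lp.compMeasurePreservingₗᵢ ℝ _ (measurePreserving_slabShift ℓ a))).norm_map v.1).le
  continuous_map v := by
    refine Continuous.subtype_mk ((WithLp.prod_continuous_toLp 2 _ _).comp ?_) _
    exact ((slabTranslation n ℓ _).continuous_map v.1.fst).prodMk
      ((slabTranslation n ℓ _).continuous_map v.1.snd)

theorem velocity_translate (a : UnitAddTorus (Fin n)) (v : divFree n ℓ) :
    velocity n ℓ ((divFreeTranslation n ℓ).map a v) =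
      (slabTranslation n ℓ _).map a (velocity n ℓ v) := rfl

theorem gradient_translate (a : UnitAddTorus (Fin n)) (v : divFree n ℓ) :
    gradient n ℓ ((divFreeTranslation n ℓ).map a v) =
      (slabTranslation n ℓ _).map a (gradient n ℓ v) := rfl

theorem velocity_average (ξ : Fin n → ℤ) (v : divFree n ℓ) :
    velocity n ℓ ((divFreeTranslation n ℓ).average ξ v) =
      (slabTranslation n ℓ _).average ξ (velocity n ℓ v) :=
  ContractionFamily.average_intertwine _ _ _ velocity_translate ξ v

theorem gradient_average (ξ : Fin n → ℤ) (v : divFree n ℓ) :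
    gradient n ℓ ((divFreeTranslation n ℓ).average ξ v) =
      (slabTranslation n ℓ _).average ξ (gradient n ℓ v) :=
  ContractionFamily.average_intertwine _ _ _ gradient_translate ξ v

/-! ### Traces -/

theorem memLp_torus_of_continuous {φ : UnitAddTorus (Fin n) → ℝ} (hφ : Continuous φ) :
    MemLp φ 2 (torusMeasure n) :=
  hφ.memLp_of_hasCompactSupport (HasCompactSupport.of_compactSpace _)

/-- Integration against a continuous function on the torus. -/
def torusPairing (φ : UnitAddTorus (Fin n) → ℝ) (hφ : Continuous φ) : L2Torus n →L[ℝ] ℝ :=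
  innerSL ℝ ((memLp_torus_of_continuous hφ).toLp φ)

theorem torusPairing_apply {φ : UnitAddTorus (Fin n) → ℝ} (hφ : Continuous φ) (b : L2Torus n) :
    torusPairing φ hφ b = ∫ x, b x * φ x ∂torusMeasure n := by
  rw [torusPairing, innerSL_apply_apply, L2.inner_def]
  refine integral_congr_ae ?_
  filter_upwards [(memLp_torus_of_continuous hφ).coeFn_toLp] with x hx
  rw [hx]
  simp

/-- The functional that identifies the trace on `{y = ℓ}` of the vertical velocity. -/
def tracePairing (φ : UnitAddTorus (Fin n) × ℝ → ℝ) (hφ : IsSmooth φ) : divFree n ℓ →L[ℝ] ℝ :=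
  (coordPairing n ℓ (Fin.last n) _ (hφ.continuous_partialDeriv (Fin.last n))).comp (velocity n ℓ) +
    (coordPairing n ℓ (Fin.last n, Fin.last n) φ hφ.continuous).comp (gradient n ℓ)

theorem tracePairing_apply {φ : UnitAddTorus (Fin n) × ℝ → ℝ} (hφ : IsSmooth φ) (v : divFree n ℓ) :
    tracePairing φ hφ v = ∫ z, (comp v (Fin.last n) z * partialDeriv (Fin.last n) φ z +
      dcomp v (Fin.last n) (Fin.last n) z * φ z) ∂slabMeasure n ℓ := by
  simp only [comp, dcomp]
  rw [integral_add (integrable_coord_mul v.1.fst _ (hφ.continuous_partialDeriv _))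
    (integrable_coord_mul v.1.snd (Fin.last n, Fin.last n) hφ.continuous)]
  simp only [tracePairing, _root_.add_apply, ContinuousLinearMap.comp_apply, coordPairing_apply]
  rfl

theorem isTopTraceOf_iff (v : divFree n ℓ) (b : L2Torus n) : IsTopTraceOf v b ↔
    ∀ φ, ∀ hφ : IsSmooth φ, (∀ x, φ (x, 0) = 0) → tracePairing φ hφ v =
      torusPairing (fun x => φ (x, ℓ)) (hφ.continuous.comp (by fun_prop)) b := by
  simp only [tracePairing_apply, torusPairing_apply]
  rfl

theorem IsTopTraceOf.translate {v : divFree n ℓ} {b : L2Torus n} (h : IsTopTraceOf v b)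
    (a : UnitAddTorus (Fin n)) :
    IsTopTraceOf ((divFreeTranslation n ℓ).map a v) ((torusTranslation n).map a b) := by
  rw [isTopTraceOf_iff] at h ⊢
  intro φ hφ h0
  have h1 := h _ (hφ.shiftFun a) fun x => h0 _
  rw [torusPairing_apply] at h1 ⊢
  rw [integral_torusTranslate_mul, ← show _ = ∫ x, b x * φ (x - a, ℓ) ∂torusMeasure n from h1]
  simp only [tracePairing, _root_.add_apply, ContinuousLinearMap.comp_apply, coordPairing_apply,
    velocity_translate, gradient_translate]
  rw [integral_translate_mul, integral_translate_mul _ (Fin.last n, Fin.last n)]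
  simp only [partialDeriv_shiftFun]

/-- Being the trace is an equality of continuous functionals of `(v, b)`, tested against each `φ`;
it holds for every translate and hence for the average. -/
theorem IsTopTraceOf.average {v : divFree n ℓ} {b : L2Torus n} (h : IsTopTraceOf v b)
    (ξ : Fin n → ℤ) :
    IsTopTraceOf ((divFreeTranslation n ℓ).average ξ v) ((torusTranslation n).average ξ b) := by
  rw [isTopTraceOf_iff]
  intro φ hφ h0
  rw [ContractionFamily.map_average, ContractionFamily.map_average]
  congr 1
  funext a
  rw [(isTopTraceOf_iff _ _).1 (h.translate a) φ hφ h0]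

end

section

variable {n : ℕ} {ℓ : ℝ}

/-! ### Horizontal Fourier coefficients -/

section Coefficients

variable {Y : Type*}

/-- The coefficient `∫ f(x, y) cos (2π ξ·x) dx`. -/
def cosCoeff (ξ : Fin n → ℤ) (f : UnitAddTorus (Fin n) × Y → ℝ) (y : Y) : ℝ :=
  ∫ x, f (x, y) * cosChar ξ x ∂torusMeasure n

/-- The coefficient `∫ f(x, y) sin (2π ξ·x) dx`. -/
def sinCoeff (ξ : Fin n → ℤ) (f : UnitAddTorus (Fin n) × Y → ℝ) (y : Y) : ℝ :=
  ∫ x, f (x, y) * sinChar ξ x ∂torusMeasure n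

variable [MeasurableSpace Y] {ν : Measure Y} [IsFiniteMeasure ν]

theorem memLp_coeff {k : UnitAddTorus (Fin n) → ℝ} (hk : Continuous k) (hk1 : ∀ x, |k x| ≤ 1)
    {f : UnitAddTorus (Fin n) × Y → ℝ} (hf : MemLp f 2 ((torusMeasure n).prod ν)) :
    MemLp (fun y => ∫ x, f (x, y) * k x ∂torusMeasure n) 2 ν := by
  have hm : AEStronglyMeasurable (fun z : UnitAddTorus (Fin n) × Y => f z * k z.1)
      ((torusMeasure n).prod ν) :=
    hf.1.mul (hk.stronglyMeasurable.comp_measurable measurable_fst).aestronglyMeasurable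
  have hm2 : AEStronglyMeasurable (fun y => ∫ x, f (x, y) * k x ∂torusMeasure n) ν :=
    hm.prod_swap.integral_prod_right'
  refine (memLp_two_iff_integrable_sq hm2).2 ⟨hm2.pow 2, ?_⟩
  have hfi : ∫⁻ z, ‖f z‖ₑ ^ 2 ∂(torusMeasure n).prod ν < ⊤ := by
    have := ((memLp_two_iff_integrable_sq hf.1).1 hf).2
    simpa [HasFiniteIntegral, enorm_pow] using this
  have hfm : AEMeasurable (fun z => ‖f z‖ₑ ^ 2) ((torusMeasure n).prod ν) := hf.1.enorm.pow_const 2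
  rw [lintegral_prod_symm _ hfm] at hfi
  refine lt_of_le_of_lt (lintegral_mono_ae ?_) hfi
  have hsec : ∀ᵐ y ∂ν, AEStronglyMeasurable (fun x => f (x, y)) (torusMeasure n) :=
    hf.1.prod_swap.prodMk_left
  filter_upwards [hsec] with y hy
  rw [enorm_pow]
  calc ‖∫ x, f (x, y) * k x ∂torusMeasure n‖ₑ ^ 2
      ≤ (∫⁻ x, ‖f (x, y)‖ₑ ∂torusMeasure n) ^ 2 := by
        refine pow_le_pow_left' ((enorm_integral_le_lintegral_enorm _).trans ?_) 2
        refine lintegral_mono fun x => ?_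
        rw [enorm_mul]
        refine mul_le_of_le_one_right' ?_
        rw [Real.enorm_eq_ofReal_abs]
        exact ENNReal.ofReal_le_one.2 (hk1 x)
    _ ≤ ∫⁻ x, ‖f (x, y)‖ₑ ^ 2 ∂torusMeasure n := by
        have := sq_lintegral_le (torusMeasure n) hy.enorm
        simpa using this

theorem memLp_cosCoeff (ξ : Fin n → ℤ) {f : UnitAddTorus (Fin n) × Y → ℝ}
    (hf : MemLp f 2 ((torusMeasure n).prod ν)) : MemLp (cosCoeff ξ f) 2 ν :=
  memLp_coeff (continuous_cosChar ξ) (abs_cosChar_le ξ) hf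

theorem memLp_sinCoeff (ξ : Fin n → ℤ) {f : UnitAddTorus (Fin n) × Y → ℝ}
    (hf : MemLp f 2 ((torusMeasure n).prod ν)) : MemLp (sinCoeff ξ f) 2 ν :=
  memLp_coeff (continuous_sinChar ξ) (abs_sinChar_le ξ) hf

theorem integral_mul_coeff {k : UnitAddTorus (Fin n) → ℝ} (hk : Continuous k)
    (hk1 : ∀ x, |k x| ≤ 1)
    {f : UnitAddTorus (Fin n) × Y → ℝ} (hf : MemLp f 2 ((torusMeasure n).prod ν)) {η : Y → ℝ}
    (hη : MemLp η 2 ν) :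
    Integrable (fun z => f z * (k z.1 * η z.2)) ((torusMeasure n).prod ν) ∧
    ∫ z, f z * (k z.1 * η z.2) ∂(torusMeasure n).prod ν =
      ∫ y, (∫ x, f (x, y) * k x ∂torusMeasure n) * η y ∂ν := by
  have hη' : MemLp (fun z : UnitAddTorus (Fin n) × Y => η z.2) 2 ((torusMeasure n).prod ν) :=
    hη.comp_measurePreserving measurePreserving_snd
  have hkη : MemLp (fun z : UnitAddTorus (Fin n) × Y => k z.1 * η z.2) 2
      ((torusMeasure n).prod ν) := by
    refine hη'.of_le ((hk.stronglyMeasurable.comp_measurable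
      measurable_fst).aestronglyMeasurable.mul hη'.1) (ae_of_all _ fun z => ?_)
    rw [norm_mul]
    exact mul_le_of_le_one_left (norm_nonneg _) (hk1 _)
  have hi : Integrable (fun z => f z * (k z.1 * η z.2)) ((torusMeasure n).prod ν) :=
    hf.integrable_mul hkη
  refine ⟨hi, ?_⟩
  rw [integral_prod_symm _ hi]
  refine integral_congr_ae (ae_of_all _ fun y => ?_)
  simp only
  rw [← integral_mul_const]
  congr 1
  funext x
  ring

/-- The substitution of `a - x` for `a` and the addition formula for the cosine separate the
variables. The fibre `Y` is left general so that the slab and, with a one-point fibre, the torus are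
both covered. Strong measurability of `f` is what makes `f(x + a, y)` jointly measurable for Fubini.
-/
theorem integral_cosChar_mul_translate (ξ : Fin n → ℤ) {f g : UnitAddTorus (Fin n) × Y → ℝ}
    (hfm : StronglyMeasurable f) (hf : MemLp f 2 ((torusMeasure n).prod ν))
    (hg : MemLp g 2 ((torusMeasure n).prod ν)) :
    ∫ a, cosChar ξ a * ∫ z, f (z.1 + a, z.2) * g z ∂(torusMeasure n).prod ν ∂torusMeasure n =
      ∫ y, (cosCoeff ξ f y * cosCoeff ξ g y + sinCoeff ξ f y * sinCoeff ξ g y) ∂ν := by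
  set τ := torusMeasure n with hτ
  have hfa : StronglyMeasurable fun p : UnitAddTorus (Fin n) × (UnitAddTorus (Fin n) × Y) =>
      f (p.2.1 + p.1, p.2.2) := hfm.comp_measurable (by fun_prop)
  have hmp : ∀ a : UnitAddTorus (Fin n), MeasurePreserving
      (fun z : UnitAddTorus (Fin n) × Y => (z.1 + a, z.2)) (τ.prod ν) (τ.prod ν) := fun a =>
    (measurePreserving_torusShift a).prod (MeasurePreserving.id _)
  have hf2 : Integrable (fun z => f z ^ 2) (τ.prod ν) := hf.integrable_sq
  have h1 : Integrable (fun p : UnitAddTorus (Fin n) × (UnitAddTorus (Fin n) × Y) =>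
      f (p.2.1 + p.1, p.2.2) ^ 2) (τ.prod (τ.prod ν)) := by
    have hm : AEStronglyMeasurable (fun p : UnitAddTorus (Fin n) × (UnitAddTorus (Fin n) × Y) =>
      f (p.2.1 + p.1, p.2.2) ^ 2) (τ.prod (τ.prod ν)) := (hfa.pow 2).aestronglyMeasurable
    rw [integrable_prod_iff hm]
    have hi : ∀ a, Integrable (fun z : UnitAddTorus (Fin n) × Y => f (z.1 + a, z.2) ^ 2)
        (τ.prod ν) := fun a => (hmp a).integrable_comp_of_integrable hf2
    refine ⟨ae_of_all _ hi, ?_⟩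
    have hc : ∀ a, ∫ z : UnitAddTorus (Fin n) × Y, ‖f (z.1 + a, z.2) ^ 2‖ ∂τ.prod ν =
        ∫ z, ‖f z ^ 2‖ ∂τ.prod ν := fun a =>
      integral_map (φ := fun z : UnitAddTorus (Fin n) × Y => (z.1 + a, z.2))
        (f := fun z => ‖f z ^ 2‖) (hmp a).measurable.aemeasurable
        (by rw [(hmp a).map_eq]; exact hf2.1.norm) |>.symm.trans (by rw [(hmp a).map_eq])
    simp only [hc]
    exact integrable_const _
  have h2 : Integrable (fun p : UnitAddTorus (Fin n) × (UnitAddTorus (Fin n) × Y) => g p.2 ^ 2)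
      (τ.prod (τ.prod ν)) := hg.integrable_sq.comp_snd _
  have hF : Integrable (fun p : UnitAddTorus (Fin n) × (UnitAddTorus (Fin n) × Y) =>
      cosChar ξ p.1 * (f (p.2.1 + p.1, p.2.2) * g p.2)) (τ.prod (τ.prod ν)) := by
    refine (h1.add h2).mono' ?_ (ae_of_all _ fun p => ?_)
    · refine ((continuous_cosChar ξ).stronglyMeasurable.comp_measurable
        measurable_fst).aestronglyMeasurable.mul (hfa.aestronglyMeasurable.mul hg.1.comp_snd)
    · rw [norm_mul, Real.norm_eq_abs, Real.norm_eq_abs, Pi.add_apply]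
      refine (mul_le_of_le_one_left (abs_nonneg _) (abs_cosChar_le ξ _)).trans ?_
      rw [abs_le]
      constructor <;> nlinarith [sq_nonneg (f (p.2.1 + p.1, p.2.2) - g p.2),
        sq_nonneg (f (p.2.1 + p.1, p.2.2) + g p.2)]
  have hcf := memLp_cosCoeff ξ hf
  have hsf := memLp_sinCoeff ξ hf
  have hC := integral_mul_coeff (continuous_cosChar ξ) (abs_cosChar_le ξ) hg hcf
  have hS := integral_mul_coeff (continuous_sinChar ξ) (abs_sinChar_le ξ) hg hsf
  have hsec : ∀ᵐ y ∂ν, Integrable (fun x => f (x, y)) τ :=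
    (hf.integrable (by norm_num)).prod_left_ae
  have hsec' : ∀ᵐ z ∂τ.prod ν, Integrable (fun x => f (x, z.2)) τ :=
    (measurePreserving_snd (μ := τ) (ν := ν)).quasiMeasurePreserving.ae hsec
  have hk : ∀ {k : UnitAddTorus (Fin n) → ℝ}, Continuous k → (∀ x, |k x| ≤ 1) → ∀ {y : Y},
      Integrable (fun x => f (x, y)) τ → Integrable (fun x => f (x, y) * k x) τ :=
    fun hk hk1 y hy => hy.mul_bdd (c := 1) hk.aestronglyMeasurable (ae_of_all _ hk1)
  calc ∫ a, cosChar ξ a * ∫ z, f (z.1 + a, z.2) * g z ∂τ.prod ν ∂τ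
      = ∫ a, ∫ z, cosChar ξ a * (f (z.1 + a, z.2) * g z) ∂τ.prod ν ∂τ := by
        simp only [integral_const_mul]
    _ = ∫ z, ∫ a, cosChar ξ a * (f (z.1 + a, z.2) * g z) ∂τ ∂τ.prod ν :=
        integral_integral_swap hF
    _ = ∫ z, (g z * (cosChar ξ z.1 * cosCoeff ξ f z.2) +
          g z * (sinChar ξ z.1 * sinCoeff ξ f z.2)) ∂τ.prod ν := by
        refine integral_congr_ae ?_
        filter_upwards [hsec'] with z hz
        have e1 : ∫ a, cosChar ξ a * (f (z.1 + a, z.2) * g z) ∂τ =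
            ∫ a, cosChar ξ (a - z.1) * (f (a, z.2) * g z) ∂τ := by
          rw [← integral_torusShift z.1 fun a => cosChar ξ (a - z.1) * (f (a, z.2) * g z)]
          simp only [add_sub_cancel_right, add_comm z.1]
          rfl
        have e2 : ∀ a, cosChar ξ (a - z.1) * (f (a, z.2) * g z) =
            g z * cosChar ξ z.1 * (f (a, z.2) * cosChar ξ a) +
              g z * sinChar ξ z.1 * (f (a, z.2) * sinChar ξ a) := fun a => by
          rw [cosChar_sub]; ring
        rw [e1]
        simp only [e2]
        rw [integral_add ((hk (continuous_cosChar ξ) (abs_cosChar_le ξ) hz).const_mul _)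
          ((hk (continuous_sinChar ξ) (abs_sinChar_le ξ) hz).const_mul _), integral_const_mul,
          integral_const_mul, cosCoeff, sinCoeff]
        ring
    _ = _ := by
        rw [integral_add hC.1 hS.1, hC.2, hS.2, ← integral_add]
        · refine integral_congr_ae (ae_of_all _ fun y => ?_)
          simp only [cosCoeff, sinCoeff]
          ring
        · exact (memLp_cosCoeff ξ hg).integrable_mul hcf
        · exact (memLp_sinCoeff ξ hg).integrable_mul hsf

end Coefficients

end

section

variable {n : ℕ} {ℓ : ℝ}

/-! ### The projector at a frequency -/

theorem memLp_coord {α ι : Type*} [MeasurableSpace α] {μ : Measure α} [Fintype ι]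
    (w : Lp (EuclideanSpace ℝ ι) 2 μ) (j : ι) : MemLp (fun z => w z j) 2 μ :=
  (EuclideanSpace.proj (𝕜 := ℝ) j).comp_memLp' (Lp.memLp w)

section Projector

variable {ι : Type*} [Fintype ι]

theorem inner_slab_eq (w w' : Lp (EuclideanSpace ℝ ι) 2 (slabMeasure n ℓ)) :
    ⟪w, w'⟫_ℝ = ∑ j, ∫ z, w z j * w' z j ∂slabMeasure n ℓ := by
  rw [L2.inner_def, ← integral_finsetSum]
  · refine integral_congr_ae (ae_of_all _ fun z => ?_)
    simp only [PiLp.inner_apply, RCLike.inner_apply, conj_trivial]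
    exact Finset.sum_congr rfl fun j _ => mul_comm _ _
  · exact fun j _ => (memLp_coord w j).integrable_mul (memLp_coord w' j)

/-- The link between the abstract projector and Fourier coefficients. Symmetry, positivity and
Parseval for the projector are all read off from it. -/
theorem inner_average_eq (ξ : Fin n → ℤ) (w w' : Lp (EuclideanSpace ℝ ι) 2 (slabMeasure n ℓ)) :
    ⟪(slabTranslation n ℓ _).average ξ w, w'⟫_ℝ =
      ∑ j, ∫ y in Ioo 0 ℓ, (cosCoeff ξ (fun z => w z j) y * cosCoeff ξ (fun z => w' z j) y +
        sinCoeff ξ (fun z => w z j) y * sinCoeff ξ (fun z => w' z j) y) := by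
  have h1 : ⟪(slabTranslation n ℓ _).average ξ w, w'⟫_ℝ =
      ∫ a, cosChar ξ a * ⟪(slabTranslation n ℓ _).map a w, w'⟫_ℝ ∂torusMeasure n := by
    have := (slabTranslation n ℓ _).map_average ξ (innerSL ℝ w') w
    simp only [innerSL_apply_apply, smul_eq_mul] at this
    simp only [real_inner_comm w']
    exact this
  have h2 : ∀ a, ⟪(slabTranslation n ℓ _).map a w, w'⟫_ℝ =
      ∑ j, ∫ z, w (z.1 + a, z.2) j * w' z j ∂slabMeasure n ℓ := fun a => by
    rw [inner_slab_eq]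
    refine Finset.sum_congr rfl fun j _ => integral_congr_ae ?_
    filter_upwards [coeFn_slabTranslation a w] with z hz
    rw [hz]
  rw [h1]
  simp only [h2, Finset.mul_sum]
  have hsm : ∀ j, StronglyMeasurable fun z => w z j := fun j =>
    (EuclideanSpace.proj (𝕜 := ℝ) j).continuous.comp_stronglyMeasurable (Lp.stronglyMeasurable w)
  rw [integral_finsetSum]
  · refine Finset.sum_congr rfl fun j _ => ?_
    exact integral_cosChar_mul_translate ξ (hsm j) (memLp_coord w j) (memLp_coord w' j)
  · intro j _
    have hc : Continuous fun a => ∫ z, w (z.1 + a, z.2) j * w' z j ∂slabMeasure n ℓ := by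
      let A := (EuclideanSpace.proj (𝕜 := ℝ) j : EuclideanSpace ℝ ι →L[ℝ] ℝ).compLpL 2
        (slabMeasure n ℓ)
      have hA : ∀ v, A v =ᵐ[slabMeasure n ℓ] fun z => v z j := fun v =>
        ContinuousLinearMap.coeFn_compLpL _ v
      have : (fun a => ∫ z, w (z.1 + a, z.2) j * w' z j ∂slabMeasure n ℓ) =
          fun a => ⟪A ((slabTranslation n ℓ _).map a w), A w'⟫_ℝ := by
        funext a
        rw [L2.inner_def]
        refine integral_congr_ae ?_
        filter_upwards [coeFn_slabTranslation a w, hA ((slabTranslation n ℓ _).map a w), hA w']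
          with z h3 h4 h5
        rw [h4, h5, h3]
        simp [mul_comm]
      rw [this]
      exact (A.continuous.comp ((slabTranslation n ℓ _).continuous_map w)).inner continuous_const
    exact ((continuous_cosChar ξ).mul hc).integrable_of_hasCompactSupport
      (HasCompactSupport.of_compactSpace _)

theorem inner_average_self (ξ : Fin n → ℤ) (w : Lp (EuclideanSpace ℝ ι) 2 (slabMeasure n ℓ)) :
    ⟪(slabTranslation n ℓ _).average ξ w, w⟫_ℝ =
      ∑ j, ∫ y in Ioo 0 ℓ, (cosCoeff ξ (fun z => w z j) y ^ 2 +
        sinCoeff ξ (fun z => w z j) y ^ 2) := by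
  simp only [inner_average_eq, sq]

theorem inner_average_comm (ξ : Fin n → ℤ) (w w' : Lp (EuclideanSpace ℝ ι) 2 (slabMeasure n ℓ)) :
    ⟪(slabTranslation n ℓ _).average ξ w, w'⟫_ℝ = ⟪w, (slabTranslation n ℓ _).average ξ w'⟫_ℝ := by
  rw [real_inner_comm _ w, inner_average_eq, inner_average_eq]
  simp only [mul_comm]

theorem inner_average_self_nonneg (ξ : Fin n → ℤ)
    (w : Lp (EuclideanSpace ℝ ι) 2 (slabMeasure n ℓ)) :
    0 ≤ ⟪(slabTranslation n ℓ _).average ξ w, w⟫_ℝ := by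
  rw [inner_average_self]
  exact Finset.sum_nonneg fun j _ => integral_nonneg fun y => by positivity

theorem inner_average_self_le (ξ : Fin n → ℤ) (w : Lp (EuclideanSpace ℝ ι) 2 (slabMeasure n ℓ)) :
    ⟪(slabTranslation n ℓ _).average ξ w, w⟫_ℝ ≤ ‖w‖ ^ 2 := by
  refine (real_inner_le_norm _ _).trans ?_
  rw [sq]
  exact mul_le_mul_of_nonneg_right (ContractionFamily.norm_average_le _ _ _) (norm_nonneg _)

/-- The Cauchy–Schwarz inequality for the projector. -/
theorem sq_inner_average_le (ξ : Fin n → ℤ) (w w' : Lp (EuclideanSpace ℝ ι) 2 (slabMeasure n ℓ)) :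
    ⟪(slabTranslation n ℓ _).average ξ w, w'⟫_ℝ ^ 2 ≤
      ⟪(slabTranslation n ℓ _).average ξ w, w⟫_ℝ * ‖w'‖ ^ 2 := by
  have h3 : ⟪(slabTranslation n ℓ _).average ξ w', w⟫_ℝ =
      ⟪(slabTranslation n ℓ _).average ξ w, w'⟫_ℝ := by
    rw [inner_average_comm, real_inner_comm]
  -- Positivity of the form on `c • w - w'` for all `c` bounds the discriminant; the form at `w'` is
  -- then replaced by `‖w'‖²`.
  have key : discrim ⟪(slabTranslation n ℓ _).average ξ w, w⟫_ℝ
      (-2 * ⟪(slabTranslation n ℓ _).average ξ w, w'⟫_ℝ)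
      ⟪(slabTranslation n ℓ _).average ξ w', w'⟫_ℝ ≤ 0 := by
    refine discrim_le_zero fun c => ?_
    have h := inner_average_self_nonneg ξ (c • w - w')
    simp only [map_sub, map_smul, inner_sub_left, inner_sub_right, real_inner_smul_left,
      real_inner_smul_right, h3] at h
    linarith
  rw [discrim] at key
  have h1 := mul_le_mul_of_nonneg_left (inner_average_self_le ξ w') (inner_average_self_nonneg ξ w)
  linarith

end Projector

/-! ### The projector on the torus -/

/-- The coefficient `∫ b(x) cos (2π ξ·x) dx`. -/
def cosMode (ξ : Fin n → ℤ) (b : L2Torus n) : ℝ := ∫ x, b x * cosChar ξ x ∂torusMeasure n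

/-- The coefficient `∫ b(x) sin (2π ξ·x) dx`. -/
def sinMode (ξ : Fin n → ℤ) (b : L2Torus n) : ℝ := ∫ x, b x * sinChar ξ x ∂torusMeasure n

theorem integral_mul_torusAverage (ξ : Fin n → ℤ) (m b : L2Torus n) :
    ∫ x, m x * (torusTranslation n).average ξ b x ∂torusMeasure n =
      cosMode ξ b * cosMode ξ m + sinMode ξ b * sinMode ξ m := by
  have h0 : ∀ f g : L2Torus n, ∫ x, f x * g x ∂torusMeasure n = ⟪f, g⟫_ℝ := fun f g => by
    rw [L2.inner_def]
    simp [mul_comm]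
  have h1 : ⟪m, (torusTranslation n).average ξ b⟫_ℝ =
      ∫ a, cosChar ξ a * ⟪m, (torusTranslation n).map a b⟫_ℝ ∂torusMeasure n := by
    have := (torusTranslation n).map_average ξ (innerSL ℝ m) b
    simpa only [innerSL_apply_apply, smul_eq_mul] using this
  -- The torus is treated as a slab whose vertical fibre is one point carrying a Dirac mass.
  have hmp : MeasurePreserving (Prod.fst : UnitAddTorus (Fin n) × Unit → _)
      ((torusMeasure n).prod (Measure.dirac ())) (torusMeasure n) := measurePreserving_fst
  have key := integral_cosChar_mul_translate (ν := Measure.dirac ()) ξ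
    (f := fun z => b z.1) (g := fun z => m z.1)
    ((Lp.stronglyMeasurable b).comp_measurable measurable_fst)
    ((Lp.memLp b).comp_measurePreserving hmp) ((Lp.memLp m).comp_measurePreserving hmp)
  simp only [integral_dirac, cosCoeff, sinCoeff] at key
  rw [h0, h1, cosMode, cosMode, sinMode, sinMode, ← key]
  refine integral_congr_ae (ae_of_all _ fun a => ?_)
  simp only
  congr 1
  rw [integral_fun_fst (fun x => b (x + a) * m x), ← h0]
  simp only [probReal_univ, one_smul]
  refine integral_congr_ae ?_
  filter_upwards [coeFn_torusTranslation a b] with x hx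
  rw [hx, mul_comm]

end

section

variable {n : ℕ} {ℓ : ℝ}

/-! ### Parseval identities -/

theorem fourier_eq {f : UnitAddTorus (Fin n) → ℝ} (hf : Integrable f (torusMeasure n))
    (ξ : Fin n → ℤ) : fourier f ξ =
      ⟨∫ x, f x * cosChar ξ x ∂torusMeasure n, -∫ x, f x * sinChar ξ x ∂torusMeasure n⟩ := by
  have h0 : fourier f ξ = ∫ x, UnitAddTorus.mFourier (-ξ) x • (f x : ℂ) ∂torusMeasure n := rfl
  have hi : Integrable (fun x => UnitAddTorus.mFourier (-ξ) x • (f x : ℂ)) (torusMeasure n) := by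
    simp only [smul_eq_mul]
    refine hf.ofReal.bdd_mul (c := 1) (UnitAddTorus.mFourier (-ξ)).continuous.aestronglyMeasurable
      (ae_of_all _ fun x => ?_)
    exact (ContinuousMap.norm_coe_le_norm _ x).trans_eq UnitAddTorus.mFourier_norm
  rw [h0]
  apply Complex.ext
  · refine (integral_re hi).symm.trans ?_
    congr 1
    funext x
    simp [UnitAddTorus.mFourier_neg, cosChar, mul_comm]
  · refine (integral_im hi).symm.trans ?_
    rw [← integral_neg]
    congr 1
    funext x
    simp [UnitAddTorus.mFourier_neg, sinChar, mul_comm]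

theorem enorm_fourier_sq {f : UnitAddTorus (Fin n) → ℝ} (hf : Integrable f (torusMeasure n))
    (ξ : Fin n → ℤ) : ‖fourier f ξ‖ₑ ^ 2 =
      ENNReal.ofReal ((∫ x, f x * cosChar ξ x ∂torusMeasure n) ^ 2 +
        (∫ x, f x * sinChar ξ x ∂torusMeasure n) ^ 2) := by
  rw [enorm_sq_eq, Complex.sq_norm, fourier_eq hf, Complex.normSq_mk]
  congr 1
  ring

theorem lintegral_enorm_sq_eq_tsum {f : UnitAddTorus (Fin n) → ℝ}
    (hf : MemLp f 2 (torusMeasure n)) :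
    ∫⁻ x, ‖f x‖ₑ ^ 2 ∂torusMeasure n = ∑' ξ, ‖fourier f ξ‖ₑ ^ 2 := by
  have hfc : MemLp (fun x => (f x : ℂ)) 2 (torusMeasure n) := hf.ofReal
  have hs : HasSum (fun ξ => ‖UnitAddTorus.mFourierCoeff (hfc.toLp _) ξ‖ ^ 2)
      (∫ x, ‖hfc.toLp _ x‖ ^ 2 ∂torusMeasure n) :=
    UnitAddTorus.hasSum_sq_mFourierCoeff (hfc.toLp _)
  have hc : ∀ ξ, UnitAddTorus.mFourierCoeff (hfc.toLp _) ξ = fourier f ξ := fun ξ => by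
    refine integral_congr_ae ?_
    change _ =ᵐ[torusMeasure n] _
    filter_upwards [hfc.coeFn_toLp] with x hx
    rw [hx]
  have hi : ∫ x, ‖hfc.toLp _ x‖ ^ 2 ∂torusMeasure n = ∫ x, ‖f x‖ ^ 2 ∂torusMeasure n := by
    refine integral_congr_ae ?_
    filter_upwards [hfc.coeFn_toLp] with x hx
    rw [hx]
    simp
  simp only [hc] at hs
  rw [hi] at hs
  simp only [enorm_sq_eq]
  rw [← ENNReal.ofReal_tsum_of_nonneg (fun ξ => by positivity) hs.summable, hs.tsum_eq,
    ofReal_integral_eq_lintegral_ofReal hf.integrable_norm_pow'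
      (ae_of_all _ fun x => by positivity)]

theorem enorm_fourier_sq_eq_modes (b : L2Torus n) (ξ : Fin n → ℤ) :
    ‖fourier b ξ‖ₑ ^ 2 = ENNReal.ofReal (cosMode ξ b ^ 2 + sinMode ξ b ^ 2) :=
  enorm_fourier_sq ((Lp.memLp b).integrable (by norm_num)) ξ

theorem IsMultiplierOf.modes {μ : (Fin n → ℤ) → ℝ} {h m : L2Torus n} (hm : IsMultiplierOf μ h m)
    (ξ : Fin n → ℤ) : cosMode ξ m = μ ξ * cosMode ξ h ∧ sinMode ξ m = μ ξ * sinMode ξ h := by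
  have h1 := hm ξ
  rw [fourier_eq ((Lp.memLp h).integrable (by norm_num)),
    fourier_eq ((Lp.memLp m).integrable (by norm_num))] at h1
  have h2 := congrArg Complex.re h1
  have h3 := congrArg Complex.im h1
  simp only [Complex.mul_re, Complex.mul_im, Complex.ofReal_re, Complex.ofReal_im, zero_mul,
    sub_zero, add_zero] at h2 h3
  refine ⟨h2, ?_⟩
  simp only [sinMode]
  linarith

theorem enorm_sq_le_sobolevSq {s : ℝ} (hs : 0 ≤ s) (b : L2Torus n) : ‖b‖ₑ ^ 2 ≤ sobolevSq s b := by
  have h1 : ‖b‖ₑ ^ 2 = ∫⁻ x, ‖b x‖ₑ ^ 2 ∂torusMeasure n := by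
    rw [Lp.enorm_def, eLpNorm_eq_lintegral_rpow_enorm_toReal (by norm_num) (by norm_num)]
    simp only [ENNReal.toReal_ofNat, ENNReal.rpow_ofNat]
    rw [← ENNReal.rpow_two, ← ENNReal.rpow_mul]
    norm_num
  rw [h1, lintegral_enorm_sq_eq_tsum (Lp.memLp b), sobolevSq]
  refine ENNReal.tsum_le_tsum fun ξ => le_mul_of_one_le_left' ?_
  rw [ENNReal.one_le_ofReal]
  exact Real.one_le_rpow (by nlinarith [sq_nonneg (freqNorm ξ)]) hs

section Slab

variable (w : L2Vec n ℓ)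

theorem ae_memLp_section (j : Fin (n + 1)) :
    ∀ᵐ y ∂volume.restrict (Ioo 0 ℓ), MemLp (fun x => w (x, y) j) 2 (torusMeasure n) := by
  have h := memLp_coord w j
  have h1 := h.integrable_sq.prod_left_ae
  have h2 := h.1.prod_swap.prodMk_left
  filter_upwards [h1, h2] with y hy1 hy2
  exact (memLp_two_iff_integrable_sq hy2).2 hy1

/-- Tonelli exchanges the sum over `ξ` with the integral over `y`. In this form the norm of the data
is expressed by the same quadratic forms that decay. -/
theorem sobolevSlabSq_eq (s : ℝ) : sobolevSlabSq ℓ s w =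
    ∑' ξ, ENNReal.ofReal ((1 + freqNorm ξ ^ 2) ^ s) *
      ENNReal.ofReal ⟪(slabTranslation n ℓ _).average ξ w, w⟫_ℝ := by
  have hi : ∀ ξ : Fin n → ℤ, ∀ j, Integrable (fun y => cosCoeff ξ (fun z => w z j) y ^ 2 +
      sinCoeff ξ (fun z => w z j) y ^ 2) (volume.restrict (Ioo 0 ℓ)) := fun ξ j =>
    (memLp_cosCoeff ξ (memLp_coord w j)).integrable_sq.add
      (memLp_sinCoeff ξ (memLp_coord w j)).integrable_sq
  have h1 : sobolevSlabSq ℓ s w = ∫⁻ y in Ioo 0 ℓ, ∑' ξ : Fin n → ℤ,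
      ENNReal.ofReal ((1 + freqNorm ξ ^ 2) ^ s) * ENNReal.ofReal (∑ j,
        (cosCoeff ξ (fun z => w z j) y ^ 2 + sinCoeff ξ (fun z => w z j) y ^ 2)) := by
    refine lintegral_congr_ae ?_
    filter_upwards [ae_all_iff.2 (ae_memLp_section w)] with y hy
    congr 1
    funext ξ
    congr 1
    rw [ENNReal.ofReal_sum_of_nonneg fun j _ => by positivity]
    exact Finset.sum_congr rfl fun j _ => enorm_fourier_sq ((hy j).integrable (by norm_num)) ξ
  have hs : ∀ ξ : Fin n → ℤ, Integrable (fun y => ∑ j, (cosCoeff ξ (fun z => w z j) y ^ 2 +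
      sinCoeff ξ (fun z => w z j) y ^ 2)) (volume.restrict (Ioo 0 ℓ)) := fun ξ =>
    integrable_finsetSum _ fun j _ => hi ξ j
  rw [h1, lintegral_tsum fun ξ => ((hs ξ).aemeasurable.ennreal_ofReal).const_mul _]
  congr 1
  funext ξ
  rw [lintegral_const_mul' _ _ ENNReal.ofReal_ne_top, ← ofReal_integral_eq_lintegral_ofReal (hs ξ)
    (ae_of_all _ fun y => Finset.sum_nonneg fun j _ => by positivity), inner_average_self,
    integral_finsetSum _ fun j _ => hi ξ j]

theorem lintegral_enorm_sq_slab_eq : ∫⁻ z, ‖w z‖ₑ ^ 2 ∂slabMeasure n ℓ =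
    ∑' ξ, ENNReal.ofReal ⟪(slabTranslation n ℓ _).average ξ w, w⟫_ℝ := by
  have h1 : sobolevSlabSq ℓ 0 w =
      ∑' ξ, ENNReal.ofReal ⟪(slabTranslation n ℓ _).average ξ w, w⟫_ℝ := by
    simp [sobolevSlabSq_eq]
  rw [← h1, sobolevSlabSq]
  refine (lintegral_prod_symm (μ := torusMeasure n) (ν := volume.restrict (Ioo 0 ℓ)) _
    ((Lp.aestronglyMeasurable w).enorm.pow_const 2)).trans (lintegral_congr_ae ?_)
  filter_upwards [ae_all_iff.2 (ae_memLp_section w)] with y hy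
  simp only [Real.rpow_zero, ENNReal.ofReal_one, one_mul]
  rw [Summable.tsum_finsetSum fun j _ => ENNReal.summable]
  simp only [← lintegral_enorm_sq_eq_tsum (hy _)]
  rw [← lintegral_finsetSum' _ fun j _ => (hy j).1.enorm.pow_const 2]
  congr 1
  funext x
  simp only [enorm_sq_eq, EuclideanSpace.norm_sq_eq]
  rw [ENNReal.ofReal_sum_of_nonneg fun j _ => by positivity]

end Slab

end

section

variable {n : ℕ} {ℓ : ℝ}

/-! ### Products of a character and a profile -/

/-- A smooth function on the torus that is bounded by `1`. -/
structure IsSmoothChar (k : UnitAddTorus (Fin n) → ℝ) : Prop where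
  smooth : ContDiff ℝ ∞ fun p : Fin n → ℝ => k fun i => (p i : UnitAddCircle)
  continuous : Continuous k
  abs_le : ∀ x, |k x| ≤ 1

theorem contDiff_phase (ξ : Fin n → ℤ) : ContDiff ℝ ∞ (phase ξ) := by
  unfold phase; fun_prop

theorem isSmoothChar_cosChar (ξ : Fin n → ℤ) : IsSmoothChar (cosChar ξ) where
  smooth := by
    simp only [cosChar_lift]
    exact Real.contDiff_cos.comp (contDiff_phase ξ)
  continuous := continuous_cosChar ξ
  abs_le := abs_cosChar_le ξ

theorem isSmoothChar_sinChar (ξ : Fin n → ℤ) : IsSmoothChar (sinChar ξ) where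
  smooth := by
    simp only [sinChar_lift]
    exact Real.contDiff_sin.comp (contDiff_phase ξ)
  continuous := continuous_sinChar ξ
  abs_le := abs_sinChar_le ξ

theorem IsSmoothChar.isSmooth_mul {k : UnitAddTorus (Fin n) → ℝ} (hk : IsSmoothChar k) {η : ℝ → ℝ}
    (hη : ContDiff ℝ ∞ η) : IsSmooth fun z : UnitAddTorus (Fin n) × ℝ => k z.1 * η z.2 :=
  ContDiff.mul (hk.smooth.comp contDiff_fst) (hη.comp contDiff_snd)

theorem lift_add_single (p : Fin n → ℝ) (i : Fin n) (s : ℝ) :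
    (fun i => (p i : UnitAddCircle)) +
        Pi.single (M := fun _ => UnitAddCircle) i (s : UnitAddCircle) =
      fun j => (((fun j => p j + Pi.single (M := fun _ => ℝ) i s j) j : ℝ) : UnitAddCircle) := by
  funext j
  by_cases hj : j = i
  · subst hj; simp
  · simp [hj]

theorem phase_single (ξ : Fin n → ℤ) (i : Fin n) (s : ℝ) :
    phase ξ (Pi.single i s) = 2 * Real.pi * ξ i * s := by
  simp only [phase, Pi.single_apply, mul_ite, mul_zero, Finset.sum_ite_eq', Finset.mem_univ,
    if_true]
  ring

theorem hasDerivAt_phase_shift (ξ : Fin n → ℤ) (i : Fin n) (p : Fin n → ℝ) :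
    HasDerivAt (fun s : ℝ => phase ξ p + 2 * Real.pi * ξ i * s) (2 * Real.pi * ξ i) 0 := by
  simpa using ((hasDerivAt_id (0 : ℝ)).const_mul (2 * Real.pi * ξ i)).const_add (phase ξ p)

theorem hasDerivAt_cosChar (ξ : Fin n → ℤ) (i : Fin n) (x : UnitAddTorus (Fin n)) :
    HasDerivAt (fun s : ℝ => cosChar ξ (x + Pi.single i (s : UnitAddCircle)))
      (-(2 * Real.pi * ξ i) * sinChar ξ x) 0 := by
  obtain ⟨p, rfl⟩ := exists_lift x
  simp only [lift_add_single, cosChar_lift, sinChar_lift, phase_add ξ p, phase_single]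
  convert (hasDerivAt_phase_shift ξ i p).cos using 1
  simp only [mul_zero, add_zero]
  ring

theorem hasDerivAt_sinChar (ξ : Fin n → ℤ) (i : Fin n) (x : UnitAddTorus (Fin n)) :
    HasDerivAt (fun s : ℝ => sinChar ξ (x + Pi.single i (s : UnitAddCircle)))
      (2 * Real.pi * ξ i * cosChar ξ x) 0 := by
  obtain ⟨p, rfl⟩ := exists_lift x
  simp only [lift_add_single, cosChar_lift, sinChar_lift, phase_add ξ p, phase_single]
  convert (hasDerivAt_phase_shift ξ i p).sin using 1
  simp only [mul_zero, add_zero]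
  ring

theorem partialDeriv_castSucc_mul {k : UnitAddTorus (Fin n) → ℝ} {d : ℝ} {i : Fin n}
    {z : UnitAddTorus (Fin n) × ℝ}
    (hk : HasDerivAt (fun s : ℝ => k (z.1 + Pi.single i (s : UnitAddCircle))) d 0) (η : ℝ → ℝ) :
    partialDeriv i.castSucc (fun z => k z.1 * η z.2) z = d * η z.2 := by
  simp only [partialDeriv, displacement, Fin.lastCases_castSucc, Prod.fst_add, Prod.snd_add,
    add_zero]
  exact (hk.mul_const _).deriv

theorem partialDeriv_last_mul (k : UnitAddTorus (Fin n) → ℝ) {η : ℝ → ℝ} (hη : Differentiable ℝ η)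
    (z : UnitAddTorus (Fin n) × ℝ) :
    partialDeriv (Fin.last n) (fun z => k z.1 * η z.2) z = k z.1 * deriv η z.2 := by
  simp only [partialDeriv, displacement, Fin.lastCases_last, Prod.fst_add, Prod.snd_add, add_zero]
  have h : HasDerivAt (fun s : ℝ => η (z.2 + s)) (deriv η z.2) 0 := by
    have h1 := (hη (z.2 + 0)).hasDerivAt.comp_const_add z.2 0
    simpa using h1
  exact (h.const_mul _).deriv

/-! ### Horizontal Fourier coefficients of a divergence-free field -/

theorem memLp_profile {η : ℝ → ℝ} (hη : Continuous η) : MemLp η 2 (volume.restrict (Ioo 0 ℓ)) := by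
  obtain ⟨C, hC⟩ := (isCompact_Icc (a := (0 : ℝ)) (b := ℓ)).exists_bound_of_continuousOn
    hη.continuousOn
  refine MemLp.of_bound hη.aestronglyMeasurable C ?_
  filter_upwards [ae_restrict_mem measurableSet_Ioo] with y hy
  exact hC y (Ioo_subset_Icc_self hy)

theorem sq_setIntegral_le {b : ℝ → ℝ} {ℓ : ℝ} (hℓ : 0 < ℓ)
    (hb : MemLp b 2 (volume.restrict (Ioo 0 ℓ))) :
    (∫ t in Ioo 0 ℓ, b t) ^ 2 ≤ ℓ * ∫ t in Ioo 0 ℓ, b t ^ 2 := by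
  set m := (∫ t in Ioo 0 ℓ, b t) / ℓ with hm
  have h0 : 0 ≤ ∫ t in Ioo 0 ℓ, (b t - m) ^ 2 := integral_nonneg fun t => sq_nonneg _
  have hbi := hb.integrable (by norm_num)
  have h1 : ∫ t in Ioo 0 ℓ, (b t - m) ^ 2 =
      (∫ t in Ioo 0 ℓ, b t ^ 2) - 2 * m * (∫ t in Ioo 0 ℓ, b t) + m ^ 2 * ℓ := by
    have e : ∀ t, (b t - m) ^ 2 = b t ^ 2 - 2 * m * b t + m ^ 2 := fun t => by ring
    simp only [e]
    have i1 : Integrable (fun t => b t ^ 2 - 2 * m * b t) (volume.restrict (Ioo 0 ℓ)) :=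
      hb.integrable_sq.sub (hbi.const_mul _)
    rw [integral_add i1 (integrable_const _),
      integral_sub hb.integrable_sq (hbi.const_mul _), integral_const_mul]
    simp [hℓ.le, mul_comm]
  have h2 : ∫ t in Ioo 0 ℓ, b t = m * ℓ := by rw [hm]; field_simp
  rw [h1, h2] at h0
  rw [h2]
  nlinarith

theorem sq_intervalIntegral_le {b : ℝ → ℝ} {ℓ y : ℝ} (hb : MemLp b 2 (volume.restrict (Ioo 0 ℓ)))
    (hy : y ∈ Ioo 0 ℓ) : (∫ t in 0..y, b t) ^ 2 ≤ ℓ * ∫ t in Ioo 0 ℓ, b t ^ 2 := by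
  have hsub : Ioo 0 y ⊆ Ioo 0 ℓ := Ioo_subset_Ioo_right hy.2.le
  rw [intervalIntegral.integral_of_le hy.1.le, integral_Ioc_eq_integral_Ioo]
  refine (sq_setIntegral_le hy.1 (hb.mono_measure (Measure.restrict_mono hsub le_rfl))).trans ?_
  refine mul_le_mul hy.2.le ?_ (integral_nonneg fun t => sq_nonneg _) (hy.1.trans hy.2).le
  exact setIntegral_mono_set hb.integrable_sq (ae_of_all _ fun t => sq_nonneg _)
    hsub.eventuallyLE

section Identities

variable (v : divFree n ℓ)

theorem memLp_comp (j : Fin (n + 1)) : MemLp (comp v j) 2 (slabMeasure n ℓ) := memLp_coord _ j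

theorem memLp_dcomp (i j : Fin (n + 1)) : MemLp (dcomp v i j) 2 (slabMeasure n ℓ) :=
  memLp_coord _ (i, j)

variable {v}

/-- Horizontal differentiation acts on coefficients as multiplication. The weak derivative is tested
against products `k(x) η(y)` with `η` in `C_c^∞(0, ℓ)`, and the fundamental lemma in `y` removes
`η`. -/
theorem coeff_dcomp_castSucc {k k' : UnitAddTorus (Fin n) → ℝ} (hk : IsSmoothChar k)
    (hk' : IsSmoothChar k') {d : ℝ} {i : Fin n}
    (hd : ∀ x, HasDerivAt (fun s : ℝ => k (x + Pi.single i (s : UnitAddCircle))) (d * k' x) 0)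
    (j : Fin (n + 1)) :
    (fun y => ∫ x, dcomp v i.castSucc j (x, y) * k x ∂torusMeasure n)
      =ᵐ[volume.restrict (Ioo 0 ℓ)]
      fun y => -d * ∫ x, comp v j (x, y) * k' x ∂torusMeasure n := by
  have hG := memLp_coeff (ν := volume.restrict (Ioo 0 ℓ)) hk.continuous hk.abs_le
    (memLp_dcomp v i.castSucc j)
  have ha := memLp_coeff (ν := volume.restrict (Ioo 0 ℓ)) hk'.continuous hk'.abs_le
    (memLp_comp v j)
  have hi : Integrable (fun y => (∫ x, dcomp v i.castSucc j (x, y) * k x ∂torusMeasure n) +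
      d * ∫ x, comp v j (x, y) * k' x ∂torusMeasure n) (volume.restrict (Ioo 0 ℓ)) :=
    (hG.integrable (by norm_num)).add ((ha.integrable (by norm_num)).const_mul _)
  have key := (isOpen_Ioo (a := (0 : ℝ)) (b := ℓ)).ae_eq_zero_of_integral_contDiff_smul_eq_zero
    (μ := volume) (f := fun y => (∫ x, dcomp v i.castSucc j (x, y) * k x ∂torusMeasure n) +
      d * ∫ x, comp v j (x, y) * k' x ∂torusMeasure n)
    (IntegrableOn.locallyIntegrableOn hi) ?_
  · rw [Filter.EventuallyEq, ae_restrict_iff' measurableSet_Ioo]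
    filter_upwards [key] with y hy hy'
    linarith [hy hy']
  · intro η hη hηc hηs
    have hφ := hk.isSmooth_mul hη
    have h1 := v.2.grad i.castSucc j _ hφ (by
      intro z hz
      refine ⟨mem_univ _, hηs ?_⟩
      have h2 := tsupport_mul_subset_right (f := fun z : UnitAddTorus (Fin n) × ℝ => k z.1)
        (g := fun z => η z.2) hz
      exact tsupport_comp_subset_preimage η continuous_snd h2)
    simp only [partialDeriv_castSucc_mul (hd _)] at h1
    have hηp := memLp_profile (ℓ := ℓ) hη.continuous
    have e1 := (integral_mul_coeff (ν := volume.restrict (Ioo 0 ℓ)) hk.continuous hk.abs_le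
      (memLp_dcomp v i.castSucc j) hηp).2
    have e2 := (integral_mul_coeff (ν := volume.restrict (Ioo 0 ℓ)) hk'.continuous hk'.abs_le
      (memLp_comp v j) hηp).2
    have e3 : ∫ z, comp v j z * (d * k' z.1 * η z.2) ∂slabMeasure n ℓ =
        d * ∫ y in Ioo 0 ℓ, (∫ x, comp v j (x, y) * k' x ∂torusMeasure n) * η y := by
      rw [← e2, ← integral_const_mul]
      congr 1
      funext z
      ring
    have h3 : d * ∫ y in Ioo 0 ℓ, (∫ x, comp v j (x, y) * k' x ∂torusMeasure n) * η y =
        - ∫ y in Ioo 0 ℓ, (∫ x, dcomp v i.castSucc j (x, y) * k x ∂torusMeasure n) * η y := by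
      rw [← e3, ← e1]; exact h1
    have h4 : ∫ y, η y • ((∫ x, dcomp v i.castSucc j (x, y) * k x ∂torusMeasure n) +
        d * ∫ x, comp v j (x, y) * k' x ∂torusMeasure n) =
        ∫ y in Ioo 0 ℓ, η y • ((∫ x, dcomp v i.castSucc j (x, y) * k x ∂torusMeasure n) +
          d * ∫ x, comp v j (x, y) * k' x ∂torusMeasure n) := by
      refine (setIntegral_eq_integral_of_forall_compl_eq_zero fun y hy => ?_).symm
      rw [image_eq_zero_of_notMem_tsupport fun h => hy (hηs h), zero_smul]
    rw [h4]
    have h5 : ∀ y, η y • ((∫ x, dcomp v i.castSucc j (x, y) * k x ∂torusMeasure n) +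
        d * ∫ x, comp v j (x, y) * k' x ∂torusMeasure n) =
        (∫ x, dcomp v i.castSucc j (x, y) * k x ∂torusMeasure n) * η y +
          d * ((∫ x, comp v j (x, y) * k' x ∂torusMeasure n) * η y) := fun y => by
      rw [smul_eq_mul]; ring
    simp only [h5]
    have i1 : Integrable (fun y => (∫ x, dcomp v i.castSucc j (x, y) * k x ∂torusMeasure n) * η y)
      (volume.restrict (Ioo 0 ℓ)) := hG.integrable_mul hηp
    have i2 : Integrable (fun y => (∫ x, comp v j (x, y) * k' x ∂torusMeasure n) * η y)
      (volume.restrict (Ioo 0 ℓ)) := ha.integrable_mul hηp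
    rw [integral_add i1 (i2.const_mul d), integral_const_mul, h3, add_neg_cancel]

theorem integral_vertical {k : UnitAddTorus (Fin n) → ℝ} (hk : IsSmoothChar k) {η : ℝ → ℝ}
    (hη : ContDiff ℝ ∞ η) (j : Fin (n + 1)) :
    ∫ z, (comp v j z * partialDeriv (Fin.last n) (fun z => k z.1 * η z.2) z +
      dcomp v (Fin.last n) j z * (k z.1 * η z.2)) ∂slabMeasure n ℓ =
    (∫ y in Ioo 0 ℓ, (∫ x, comp v j (x, y) * k x ∂torusMeasure n) * deriv η y) +
      ∫ y in Ioo 0 ℓ, (∫ x, dcomp v (Fin.last n) j (x, y) * k x ∂torusMeasure n) * η y := by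
  simp only [partialDeriv_last_mul k (hη.differentiable (by simp))]
  have e1 := integral_mul_coeff (ν := volume.restrict (Ioo 0 ℓ)) hk.continuous hk.abs_le
    (memLp_comp v j) (memLp_profile (ℓ := ℓ) (hη.continuous_deriv (by simp)))
  have e2 := integral_mul_coeff (ν := volume.restrict (Ioo 0 ℓ)) hk.continuous hk.abs_le
    (memLp_dcomp v (Fin.last n) j) (memLp_profile (ℓ := ℓ) hη.continuous)
  rw [← e1.2, ← e2.2]
  exact integral_add e1.1 e2.1

/-- The du Bois-Reymond lemma with `y` in the role of time: the vanishing trace at the bottom is the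
initial value `0`. Poincaré's inequality for the coefficients follows. -/
theorem coeff_comp_eq_primitive (hℓ : 0 < ℓ) {k : UnitAddTorus (Fin n) → ℝ} (hk : IsSmoothChar k)
    (j : Fin (n + 1)) : ∀ᵐ y ∂volume.restrict (Ioo 0 ℓ),
      ∫ x, comp v j (x, y) * k x ∂torusMeasure n =
        ∫ t in 0..y, ∫ x, dcomp v (Fin.last n) j (x, t) * k x ∂torusMeasure n := by
  have hG := memLp_coeff (ν := volume.restrict (Ioo 0 ℓ)) hk.continuous hk.abs_le
    (memLp_dcomp v (Fin.last n) j)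
  have ha := memLp_coeff (ν := volume.restrict (Ioo 0 ℓ)) hk.continuous hk.abs_le
    (memLp_comp v j)
  have := ae_eq_primitive_of_weakDeriv (a₀ := 0) hℓ (ha.integrable (by norm_num))
    (hG.integrable (by norm_num)) ?_
  · simpa using this
  · rintro η hη ⟨S, hS, hηS⟩
    have h1 := v.2.bottom j _ (hk.isSmooth_mul hη) fun x => by
      simp [hηS ℓ hS.le]
    have h2 := (integral_vertical (v := v) hk hη j).symm.trans h1
    simp only [mul_comm (deriv η _), mul_comm (η _)]
    linarith

theorem integral_sq_coeff_comp_le (hℓ : 0 < ℓ) {k : UnitAddTorus (Fin n) → ℝ}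
    (hk : IsSmoothChar k) (j : Fin (n + 1)) :
    ∫ y in Ioo 0 ℓ, (∫ x, comp v j (x, y) * k x ∂torusMeasure n) ^ 2 ≤
      ℓ ^ 2 * ∫ y in Ioo 0 ℓ, (∫ x, dcomp v (Fin.last n) j (x, y) * k x ∂torusMeasure n) ^ 2 := by
  have hG := memLp_coeff (ν := volume.restrict (Ioo 0 ℓ)) hk.continuous hk.abs_le
    (memLp_dcomp v (Fin.last n) j)
  set b := fun y => ∫ x, dcomp v (Fin.last n) j (x, y) * k x ∂torusMeasure n with hb
  have h1 : ∀ᵐ y ∂volume.restrict (Ioo 0 ℓ),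
      (∫ x, comp v j (x, y) * k x ∂torusMeasure n) ^ 2 ≤ ℓ * ∫ t in Ioo 0 ℓ, b t ^ 2 := by
    filter_upwards [coeff_comp_eq_primitive hℓ hk j, ae_restrict_mem measurableSet_Ioo]
      with y hy hy'
    rw [hy]
    exact sq_intervalIntegral_le hG hy'
  refine (integral_mono_of_nonneg (ae_of_all _ fun y => sq_nonneg _)
    (integrable_const _) h1).trans ?_
  simp only [integral_const, MeasurableSet.univ, measureReal_restrict_apply, univ_inter,
    Real.volume_real_Ioo_of_le hℓ.le, sub_zero, smul_eq_mul]
  exact le_of_eq (by ring)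

/-- Top traces are tested by functions vanishing at the bottom, and bottom traces by functions
vanishing at the top. The constant profile, which would give the identity at once, is admissible for
neither; it is split as `y/ℓ + (1 - y/ℓ)`, one piece for each test. -/
theorem IsTopTraceOf.mode_eq (hℓ : 0 < ℓ) {b : L2Torus n} (h : IsTopTraceOf v b)
    {k : UnitAddTorus (Fin n) → ℝ} (hk : IsSmoothChar k) :
    ∫ x, b x * k x ∂torusMeasure n = ∫ y in Ioo 0 ℓ,
      ∫ x, dcomp v (Fin.last n) (Fin.last n) (x, y) * k x ∂torusMeasure n := by
  have hη1 : ContDiff ℝ ∞ fun y : ℝ => y / ℓ := by fun_prop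
  have hη2 : ContDiff ℝ ∞ fun y : ℝ => 1 - y / ℓ := by fun_prop
  have h1 := h _ (hk.isSmooth_mul hη1) fun x => by simp
  have h2 := v.2.bottom (Fin.last n) _ (hk.isSmooth_mul hη2) fun x => by simp [hℓ.ne']
  have h1' := (integral_vertical (v := v) hk hη1 (Fin.last n)).symm.trans h1
  have h2' := (integral_vertical (v := v) hk hη2 (Fin.last n)).symm.trans h2
  have hd1 : ∀ y, deriv (fun y : ℝ => y / ℓ) y = 1 / ℓ := fun y =>
    ((hasDerivAt_id y).div_const ℓ).deriv
  have hd2 : ∀ y, deriv (fun y : ℝ => 1 - y / ℓ) y = -(1 / ℓ) := fun y =>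
    (((hasDerivAt_id y).div_const ℓ).const_sub 1).deriv
  simp only [hd1, hd2, div_self hℓ.ne', mul_one, mul_neg, integral_neg] at h1' h2'
  have hG := memLp_coeff (ν := volume.restrict (Ioo 0 ℓ)) hk.continuous hk.abs_le
    (memLp_dcomp v (Fin.last n) (Fin.last n))
  have h3 : ∫ y in Ioo 0 ℓ, (∫ x, dcomp v (Fin.last n) (Fin.last n) (x, y) * k x ∂torusMeasure n) =
      (∫ y in Ioo 0 ℓ, (∫ x, dcomp v (Fin.last n) (Fin.last n) (x, y) * k x ∂torusMeasure n) *
        (y / ℓ)) +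
      ∫ y in Ioo 0 ℓ, (∫ x, dcomp v (Fin.last n) (Fin.last n) (x, y) * k x ∂torusMeasure n) *
        (1 - y / ℓ) := by
    have i : ∀ {η : ℝ → ℝ}, Continuous η → Integrable (fun y =>
        (∫ x, dcomp v (Fin.last n) (Fin.last n) (x, y) * k x ∂torusMeasure n) * η y)
        (volume.restrict (Ioo 0 ℓ)) := fun hη => hG.integrable_mul (memLp_profile hη)
    rw [← integral_add (i hη1.continuous) (i hη2.continuous)]
    congr 1
    funext y
    ring
  rw [h3]
  linarith

theorem IsTopTraceOf.sq_mode_le (hℓ : 0 < ℓ) {b : L2Torus n} (h : IsTopTraceOf v b)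
    {k : UnitAddTorus (Fin n) → ℝ} (hk : IsSmoothChar k) :
    (∫ x, b x * k x ∂torusMeasure n) ^ 2 ≤ ℓ * ∫ y in Ioo 0 ℓ,
      (∫ x, dcomp v (Fin.last n) (Fin.last n) (x, y) * k x ∂torusMeasure n) ^ 2 := by
  rw [h.mode_eq hℓ hk]
  exact sq_setIntegral_le hℓ (memLp_coeff (ν := volume.restrict (Ioo 0 ℓ)) hk.continuous hk.abs_le
    (memLp_dcomp v (Fin.last n) (Fin.last n)))

end Identities

end

section

variable {n : ℕ} {ℓ : ℝ}

/-! ### The symmetric gradient -/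

/-- The map `A ↦ A + Aᵀ`. -/
def addTranspose (ι : Type*) [Fintype ι] :
    EuclideanSpace ℝ (ι × ι) →L[ℝ] EuclideanSpace ℝ (ι × ι) :=
  LinearMap.toContinuousLinearMap
    { toFun := fun A => WithLp.toLp 2 fun p => A p + A p.swap
      map_add' := fun A B => by ext p; simp; ring
      map_smul' := fun c A => by ext p; simp; ring }

/-- The symmetrization of a velocity gradient. -/
def symOp (n : ℕ) (ℓ : ℝ) : L2Mat n ℓ →L[ℝ] L2Mat n ℓ :=
  (addTranspose (Fin (n + 1))).compLpL 2 (slabMeasure n ℓ)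

theorem coeFn_symOp (G : L2Mat n ℓ) :
    symOp n ℓ G =ᵐ[slabMeasure n ℓ] fun z => addTranspose _ (G z) :=
  ContinuousLinearMap.coeFn_compLpL _ G

theorem symOp_average (ξ : Fin n → ℤ) (G : L2Mat n ℓ) :
    symOp n ℓ ((slabTranslation n ℓ _).average ξ G) =
      (slabTranslation n ℓ _).average ξ (symOp n ℓ G) := by
  refine ContractionFamily.average_intertwine _ _ _ (fun a v => ?_) ξ G
  apply Lp.ext
  filter_upwards [coeFn_symOp ((slabTranslation n ℓ _).map a v), coeFn_slabTranslation a v,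
    coeFn_slabTranslation a (symOp n ℓ v),
    (measurePreserving_slabShift ℓ a).quasiMeasurePreserving.ae (coeFn_symOp v)] with z h1 h2 h3 h4
  rw [h1, h2, h3, h4]

theorem norm_symOp_le (G : L2Mat n ℓ) : ‖symOp n ℓ G‖ ≤ 2 * ‖G‖ := by
  have h : ‖addTranspose (Fin (n + 1))‖ ≤ 2 := by
    refine ContinuousLinearMap.opNorm_le_bound _ (by norm_num) fun A => ?_
    have h1 : addTranspose (Fin (n + 1)) A =
        A + LinearIsometryEquiv.piLpCongrLeft 2 ℝ ℝ (Equiv.prodComm _ _) A := by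
      ext p
      rfl
    rw [h1, two_mul]
    exact (norm_add_le _ _).trans_eq (by rw [LinearIsometryEquiv.norm_map])
  exact ((addTranspose (Fin (n + 1))).norm_compLp_le G).trans
    (mul_le_mul_of_nonneg_right h (norm_nonneg _))

/-- The symmetric gradient of a divergence-free field. -/
def symGrad (n : ℕ) (ℓ : ℝ) : divFree n ℓ →L[ℝ] L2Mat n ℓ := (symOp n ℓ).comp (gradient n ℓ)

theorem coeFn_symGrad (v : divFree n ℓ) : ∀ᵐ z ∂slabMeasure n ℓ, ∀ i j,
    symGrad n ℓ v z (i, j) = dcomp v i j z + dcomp v j i z := by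
  filter_upwards [coeFn_symOp (gradient n ℓ v)] with z hz i j
  rw [symGrad, ContinuousLinearMap.comp_apply, hz]
  rfl

theorem symGradInner_eq (u v : divFree n ℓ) :
    symGradInner u v = ⟪symGrad n ℓ u, symGrad n ℓ v⟫_ℝ := by
  rw [L2.inner_def, symGradInner]
  refine integral_congr_ae ?_
  filter_upwards [coeFn_symGrad u, coeFn_symGrad v] with z h1 h2
  simp only [PiLp.inner_apply, RCLike.inner_apply, conj_trivial, Fintype.sum_prod_type, h1, h2,
    mul_comm]

theorem symGrad_average (ξ : Fin n → ℤ) (v : divFree n ℓ) :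
    symGrad n ℓ ((divFreeTranslation n ℓ).average ξ v) =
      (slabTranslation n ℓ _).average ξ (symGrad n ℓ v) := by
  simp only [symGrad, ContinuousLinearMap.comp_apply, gradient_average, symOp_average]

/-! ### Coercivity at a frequency -/

/-- The integral over `(0, ℓ)` of the squared modulus of a horizontal Fourier coefficient. -/
def modeSq (ℓ : ℝ) (ξ : Fin n → ℤ) (f : UnitAddTorus (Fin n) × ℝ → ℝ) : ℝ :=
  ∫ y in Ioo 0 ℓ, (cosCoeff ξ f y ^ 2 + sinCoeff ξ f y ^ 2)

theorem modeSq_nonneg (ξ : Fin n → ℤ) (f : UnitAddTorus (Fin n) × ℝ → ℝ) : 0 ≤ modeSq ℓ ξ f :=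
  integral_nonneg fun y => by positivity

theorem coeff_congr {f g : UnitAddTorus (Fin n) × ℝ → ℝ} (h : f =ᵐ[slabMeasure n ℓ] g)
    (k : UnitAddTorus (Fin n) → ℝ) : ∀ᵐ y ∂volume.restrict (Ioo 0 ℓ),
      ∫ x, f (x, y) * k x ∂torusMeasure n = ∫ x, g (x, y) * k x ∂torusMeasure n := by
  have h1 : ∀ᵐ z ∂(volume.restrict (Ioo 0 ℓ)).prod (torusMeasure n), f z.swap = g z.swap :=
    Measure.measurePreserving_swap.quasiMeasurePreserving.ae h
  filter_upwards [Measure.ae_ae_of_ae_prod h1] with y hy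
  refine integral_congr_ae ?_
  filter_upwards [hy] with x hx
  have : f (x, y) = g (x, y) := hx
  rw [this]

theorem modeSq_congr (ξ : Fin n → ℤ) {f g : UnitAddTorus (Fin n) × ℝ → ℝ}
    (h : f =ᵐ[slabMeasure n ℓ] g) : modeSq ℓ ξ f = modeSq ℓ ξ g := by
  refine integral_congr_ae ?_
  filter_upwards [coeff_congr h (cosChar ξ), coeff_congr h (sinChar ξ)] with y h1 h2
  simp only [cosCoeff, sinCoeff, h1, h2]

theorem coeff_add {f g : UnitAddTorus (Fin n) × ℝ → ℝ} (hf : MemLp f 2 (slabMeasure n ℓ))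
    (hg : MemLp g 2 (slabMeasure n ℓ)) {k : UnitAddTorus (Fin n) → ℝ} (hk : IsSmoothChar k) :
    ∀ᵐ y ∂volume.restrict (Ioo 0 ℓ), ∫ x, (f (x, y) + g (x, y)) * k x ∂torusMeasure n =
      ∫ x, f (x, y) * k x ∂torusMeasure n + ∫ x, g (x, y) * k x ∂torusMeasure n := by
  have hi : ∀ {f : UnitAddTorus (Fin n) × ℝ → ℝ}, MemLp f 2 (slabMeasure n ℓ) →
      ∀ᵐ y ∂volume.restrict (Ioo 0 ℓ), Integrable (fun x => f (x, y) * k x) (torusMeasure n) := by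
    intro f hf
    have h1 : ∀ᵐ y ∂volume.restrict (Ioo 0 ℓ), Integrable (fun x => f (x, y)) (torusMeasure n) :=
      Integrable.prod_left_ae (hf.integrable (by norm_num))
    filter_upwards [h1] with y hy
    exact hy.mul_bdd (c := 1) hk.continuous.aestronglyMeasurable (ae_of_all _ hk.abs_le)
  filter_upwards [hi hf, hi hg] with y h1 h2
  rw [← integral_add h1 h2]
  simp only [add_mul]

theorem inner_average_symGrad (ξ : Fin n → ℤ) (v : divFree n ℓ) :
    ⟪(slabTranslation n ℓ _).average ξ (symGrad n ℓ v), symGrad n ℓ v⟫_ℝ =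
      ∑ i, ∑ j, modeSq ℓ ξ fun z => dcomp v i j z + dcomp v j i z := by
  rw [inner_average_self, Fintype.sum_prod_type]
  refine Finset.sum_congr rfl fun i _ => Finset.sum_congr rfl fun j _ => modeSq_congr ξ ?_
  filter_upwards [coeFn_symGrad v] with z hz
  exact hz i j

theorem inner_average_velocity (ξ : Fin n → ℤ) (v : divFree n ℓ) :
    ⟪(slabTranslation n ℓ _).average ξ (velocity n ℓ v), velocity n ℓ v⟫_ℝ =
      ∑ j, modeSq ℓ ξ (comp v j) :=
  inner_average_self ξ _

theorem modeSq_two_mul (ξ : Fin n → ℤ) (f : UnitAddTorus (Fin n) × ℝ → ℝ) :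
    modeSq ℓ ξ (fun z => f z + f z) = 4 * modeSq ℓ ξ f := by
  rw [modeSq, modeSq, ← integral_const_mul]
  congr 1
  funext y
  simp only [cosCoeff, sinCoeff, ← two_mul, mul_assoc, integral_const_mul]
  ring

theorem integrable_modeSq (ξ : Fin n → ℤ) {f : UnitAddTorus (Fin n) × ℝ → ℝ}
    (hf : MemLp f 2 (slabMeasure n ℓ)) :
    Integrable (fun y => cosCoeff ξ f y ^ 2 + sinCoeff ξ f y ^ 2) (volume.restrict (Ioo 0 ℓ)) :=
  (memLp_cosCoeff (ν := volume.restrict (Ioo 0 ℓ)) ξ hf).integrable_sq.add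
    (memLp_sinCoeff (ν := volume.restrict (Ioo 0 ℓ)) ξ hf).integrable_sq

theorem modeSq_eq_add (ξ : Fin n → ℤ) {f : UnitAddTorus (Fin n) × ℝ → ℝ}
    (hf : MemLp f 2 (slabMeasure n ℓ)) : modeSq ℓ ξ f =
      (∫ y in Ioo 0 ℓ, cosCoeff ξ f y ^ 2) + ∫ y in Ioo 0 ℓ, sinCoeff ξ f y ^ 2 :=
  integral_add (memLp_cosCoeff (ν := volume.restrict (Ioo 0 ℓ)) ξ hf).integrable_sq
    (memLp_sinCoeff (ν := volume.restrict (Ioo 0 ℓ)) ξ hf).integrable_sq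

theorem modeSq_comp_le (hℓ : 0 < ℓ) (ξ : Fin n → ℤ) (v : divFree n ℓ) (j : Fin (n + 1)) :
    modeSq ℓ ξ (comp v j) ≤ ℓ ^ 2 * modeSq ℓ ξ (dcomp v (Fin.last n) j) := by
  rw [modeSq_eq_add ξ (memLp_comp v j), modeSq_eq_add ξ (memLp_dcomp v _ j), mul_add]
  exact add_le_add (integral_sq_coeff_comp_le hℓ (isSmoothChar_cosChar ξ) j)
    (integral_sq_coeff_comp_le hℓ (isSmoothChar_sinChar ξ) j)

theorem modes_sq_le (hℓ : 0 < ℓ) (ξ : Fin n → ℤ) {v : divFree n ℓ} {b : L2Torus n}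
    (h : IsTopTraceOf v b) : cosMode ξ b ^ 2 + sinMode ξ b ^ 2 ≤
      ℓ * modeSq ℓ ξ (dcomp v (Fin.last n) (Fin.last n)) := by
  rw [modeSq_eq_add ξ (memLp_dcomp v _ _), mul_add]
  exact add_le_add (h.sq_mode_le hℓ (isSmoothChar_cosChar ξ))
    (h.sq_mode_le hℓ (isSmoothChar_sinChar ξ))

/-- The vertical diagonal entry of `𝔻v` is `2 ∂_N v_N`, and every other entry contributes a
nonnegative amount. -/
theorem four_mul_modeSq_le (ξ : Fin n → ℤ) (v : divFree n ℓ) :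
    4 * modeSq ℓ ξ (dcomp v (Fin.last n) (Fin.last n)) ≤
      ⟪(slabTranslation n ℓ _).average ξ (symGrad n ℓ v), symGrad n ℓ v⟫_ℝ := by
  rw [inner_average_symGrad, ← modeSq_two_mul]
  refine (Finset.single_le_sum (f := fun j => modeSq ℓ ξ fun z =>
    dcomp v (Fin.last n) j z + dcomp v j (Fin.last n) z) (fun j _ => modeSq_nonneg ξ _)
      (Finset.mem_univ (Fin.last n))).trans ?_
  exact Finset.single_le_sum (f := fun i => ∑ j, modeSq ℓ ξ fun z =>
    dcomp v i j z + dcomp v j i z) (fun i _ => Finset.sum_nonneg fun j _ => modeSq_nonneg ξ _)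
      (Finset.mem_univ (Fin.last n))

/-- `dcomp` in a horizontal direction, in terms of the coefficients of the field. -/
theorem coeff_dcomp_horizontal (ξ : Fin n → ℤ) (v : divFree n ℓ) (i : Fin n) (j : Fin (n + 1)) :
    ∀ᵐ y ∂volume.restrict (Ioo 0 ℓ),
      cosCoeff ξ (dcomp v i.castSucc j) y = 2 * Real.pi * ξ i * sinCoeff ξ (comp v j) y ∧
      sinCoeff ξ (dcomp v i.castSucc j) y = -(2 * Real.pi * ξ i) * cosCoeff ξ (comp v j) y := by
  filter_upwards [coeff_dcomp_castSucc (isSmoothChar_cosChar ξ) (isSmoothChar_sinChar ξ)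
      (hasDerivAt_cosChar ξ i) j (v := v), coeff_dcomp_castSucc (isSmoothChar_sinChar ξ)
      (isSmoothChar_cosChar ξ) (hasDerivAt_sinChar ξ i) j (v := v)] with y h1 h2
  refine ⟨h1.trans ?_, h2⟩
  rw [neg_neg, sinCoeff]

/-- Expanding the square leaves `2 |x|² |a|² + 2 (x·a)²`. This is the symbol form of Korn's
inequality for the horizontal block. -/
theorem sum_sq_symm_ge {ι : Type*} [Fintype ι] (x a : ι → ℝ) :
    2 * (∑ i, x i ^ 2) * (∑ j, a j ^ 2) ≤ ∑ i, ∑ j, (x i * a j + x j * a i) ^ 2 := by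
  have h : ∑ i, ∑ j, (x i * a j + x j * a i) ^ 2 =
      2 * (∑ i, x i ^ 2) * (∑ j, a j ^ 2) + 2 * (∑ i, x i * a i) ^ 2 := by
    have e : ∀ i j, (x i * a j + x j * a i) ^ 2 =
        x i ^ 2 * a j ^ 2 + a i ^ 2 * x j ^ 2 + 2 * ((x i * a i) * (x j * a j)) :=
      fun i j => by ring
    simp only [e, Finset.sum_add_distrib, ← Finset.mul_sum, ← Finset.sum_mul]
    ring
  rw [h]
  nlinarith [sq_nonneg (∑ i, x i * a i)]

theorem freqNorm_sq (ξ : Fin n → ℤ) : freqNorm ξ ^ 2 = ∑ i, (ξ i : ℝ) ^ 2 :=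
  Real.sq_sqrt (Finset.sum_nonneg fun _ _ => sq_nonneg _)

theorem one_le_freqNorm {ξ : Fin n → ℤ} (hξ : ξ ≠ 0) : 1 ≤ freqNorm ξ := by
  obtain ⟨i, hi⟩ := Function.ne_iff.1 hξ
  rw [freqNorm, Real.one_le_sqrt]
  have h1 : (1 : ℝ) ≤ (ξ i : ℝ) ^ 2 := by
    have : (1 : ℤ) ≤ ξ i ^ 2 := by
      have := sq_pos_of_ne_zero (a := ξ i) hi
      omega
    exact_mod_cast this
  exact h1.trans (Finset.single_le_sum (f := fun i => (ξ i : ℝ) ^ 2) (fun i _ => sq_nonneg _)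
    (Finset.mem_univ i))

/-- At frequency `ξ` the entries of the horizontal block have coefficients `2π (ξ_i a_j + ξ_j a_i)`
up to sign. The algebraic inequality `sum_sq_symm_ge` then yields `(2π)² · 2 |ξ|² = 8π² |ξ|²`,
pointwise in `y`. -/
theorem sum_modeSq_horizontal_le (ξ : Fin n → ℤ) (v : divFree n ℓ) :
    8 * Real.pi ^ 2 * freqNorm ξ ^ 2 * ∑ j : Fin n, modeSq ℓ ξ (comp v j.castSucc) ≤
      ∑ i : Fin n, ∑ j : Fin n, modeSq ℓ ξ fun z =>
        dcomp v i.castSucc j.castSucc z + dcomp v j.castSucc i.castSucc z := by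
  simp only [modeSq]
  have hD : ∀ i j, MemLp (fun z => dcomp v i j z + dcomp v j i z) 2 (slabMeasure n ℓ) := fun i j =>
    (memLp_dcomp v i j).add (memLp_dcomp v j i)
  rw [← integral_finsetSum _ fun j _ => integrable_modeSq ξ (memLp_comp v _), ← integral_const_mul]
  have h1 : ∀ i : Fin n, ∑ j : Fin n, ∫ y in Ioo 0 ℓ,
      (cosCoeff ξ (fun z =>
        dcomp v i.castSucc j.castSucc z + dcomp v j.castSucc i.castSucc z) y ^ 2 +
      sinCoeff ξ (fun z => dcomp v i.castSucc j.castSucc z + dcomp v j.castSucc i.castSucc z) y ^ 2)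
      = ∫ y in Ioo 0 ℓ, ∑ j : Fin n,
      (cosCoeff ξ (fun z =>
        dcomp v i.castSucc j.castSucc z + dcomp v j.castSucc i.castSucc z) y ^ 2 +
      sinCoeff ξ (fun z => dcomp v i.castSucc j.castSucc z + dcomp v j.castSucc i.castSucc z) y ^ 2)
      := fun i => (integral_finsetSum _ fun j _ => integrable_modeSq ξ (hD _ _)).symm
  simp only [h1]
  rw [← integral_finsetSum _ fun i _ => integrable_finsetSum _ fun j _ =>
    integrable_modeSq ξ (hD _ _)]
  refine integral_mono_ae ((integrable_finsetSum _ fun j _ =>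
    integrable_modeSq ξ (memLp_comp v _)).const_mul _)
    (integrable_finsetSum _ fun i _ => integrable_finsetSum _ fun j _ =>
      integrable_modeSq ξ (hD _ _)) ?_
  have hc : ∀ i j : Fin n, ∀ᵐ y ∂volume.restrict (Ioo 0 ℓ),
      cosCoeff ξ (fun z => dcomp v i.castSucc j.castSucc z + dcomp v j.castSucc i.castSucc z) y =
        2 * Real.pi * (ξ i * sinCoeff ξ (comp v j.castSucc) y +
          ξ j * sinCoeff ξ (comp v i.castSucc) y) ∧
      sinCoeff ξ (fun z => dcomp v i.castSucc j.castSucc z + dcomp v j.castSucc i.castSucc z) y =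
        -(2 * Real.pi * (ξ i * cosCoeff ξ (comp v j.castSucc) y +
          ξ j * cosCoeff ξ (comp v i.castSucc) y)) := fun i j => by
    filter_upwards [coeff_add (memLp_dcomp v i.castSucc j.castSucc)
        (memLp_dcomp v j.castSucc i.castSucc) (isSmoothChar_cosChar ξ),
      coeff_add (memLp_dcomp v i.castSucc j.castSucc)
        (memLp_dcomp v j.castSucc i.castSucc) (isSmoothChar_sinChar ξ),
      coeff_dcomp_horizontal ξ v i j.castSucc, coeff_dcomp_horizontal ξ v j i.castSucc]
      with y a1 a2 a3 a4
    refine ⟨a1.trans ?_, a2.trans ?_⟩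
    · change cosCoeff ξ _ y + cosCoeff ξ _ y = _
      rw [a3.1, a4.1]; ring
    · change sinCoeff ξ _ y + sinCoeff ξ _ y = _
      rw [a3.2, a4.2]; ring
  filter_upwards [ae_all_iff.2 fun i => ae_all_iff.2 fun j => hc i j] with y hy
  simp only [hy, Finset.sum_add_distrib, neg_sq, mul_pow, ← Finset.mul_sum]
  have s1 := sum_sq_symm_ge (fun i => (ξ i : ℝ)) fun j : Fin n => sinCoeff ξ (comp v j.castSucc) y
  have s2 := sum_sq_symm_ge (fun i => (ξ i : ℝ)) fun j : Fin n => cosCoeff ξ (comp v j.castSucc) y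
  rw [freqNorm_sq]
  nlinarith [mul_le_mul_of_nonneg_left s1 (sq_nonneg (2 * Real.pi)),
    mul_le_mul_of_nonneg_left s2 (sq_nonneg (2 * Real.pi))]

/-- Korn's inequality at a single frequency. -/
theorem korn_average (hℓ : 0 < ℓ) (ξ : Fin n → ℤ) (v : divFree n ℓ) :
    min (ℓ ^ 2)⁻¹ (8 * Real.pi ^ 2) *
      ⟪(slabTranslation n ℓ _).average ξ (velocity n ℓ v), velocity n ℓ v⟫_ℝ ≤
      ⟪(slabTranslation n ℓ _).average ξ (symGrad n ℓ v), symGrad n ℓ v⟫_ℝ := by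
  rw [inner_average_velocity]
  -- Poincaré for the vertical component, through the diagonal entry of `𝔻v`; the spare factor `4`
  -- is discarded.
  have hN : (ℓ ^ 2)⁻¹ * modeSq ℓ ξ (comp v (Fin.last n)) ≤
      modeSq ℓ ξ fun z => dcomp v (Fin.last n) (Fin.last n) z +
        dcomp v (Fin.last n) (Fin.last n) z := by
    rw [modeSq_two_mul, inv_mul_le_iff₀ (by positivity)]
    have := modeSq_comp_le hℓ ξ v (Fin.last n)
    have h2 := modeSq_nonneg (ℓ := ℓ) ξ (dcomp v (Fin.last n) (Fin.last n))
    nlinarith [mul_nonneg (sq_nonneg ℓ) h2]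
  have hpos : 0 ≤ min (ℓ ^ 2)⁻¹ (8 * Real.pi ^ 2) := by positivity
  by_cases hξ : ξ = 0
  -- At zero frequency horizontal derivatives have zero coefficient, so the last row of `𝔻v` reduces
  -- to vertical derivatives and Poincaré applies to each component.
  · have hrow : ∀ j : Fin (n + 1), (ℓ ^ 2)⁻¹ * modeSq ℓ ξ (comp v j) ≤
        modeSq ℓ ξ fun z => dcomp v (Fin.last n) j z + dcomp v j (Fin.last n) z := by
      refine Fin.lastCases hN fun j => ?_
      have h1 : modeSq ℓ ξ (fun z => dcomp v (Fin.last n) j.castSucc z +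
          dcomp v j.castSucc (Fin.last n) z) = modeSq ℓ ξ (dcomp v (Fin.last n) j.castSucc) := by
        refine integral_congr_ae ?_
        filter_upwards [coeff_add (memLp_dcomp v (Fin.last n) j.castSucc)
            (memLp_dcomp v j.castSucc (Fin.last n)) (isSmoothChar_cosChar ξ),
          coeff_add (memLp_dcomp v (Fin.last n) j.castSucc)
            (memLp_dcomp v j.castSucc (Fin.last n)) (isSmoothChar_sinChar ξ),
          coeff_dcomp_horizontal ξ v j (Fin.last n)] with y a1 a2 a3
        have a1' := a1.trans (congrArg (_ + ·) a3.1)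
        have a2' := a2.trans (congrArg (_ + ·) a3.2)
        simp only [hξ, Pi.zero_apply, Int.cast_zero, mul_zero, zero_mul, neg_zero, add_zero]
          at a1' a2'
        simp only [cosCoeff, sinCoeff, hξ, a1', a2']
      rw [h1, inv_mul_le_iff₀ (by positivity)]
      exact modeSq_comp_le hℓ ξ v _
    rw [inner_average_symGrad]
    refine le_trans ?_ (Finset.single_le_sum (f := fun i => ∑ j, modeSq ℓ ξ fun z =>
      dcomp v i j z + dcomp v j i z) (fun i _ => Finset.sum_nonneg fun j _ => modeSq_nonneg ξ _)
        (Finset.mem_univ (Fin.last n)))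
    rw [Finset.mul_sum]
    refine Finset.sum_le_sum fun j _ => le_trans ?_ (hrow j)
    exact mul_le_mul_of_nonneg_right (min_le_left _ _) (modeSq_nonneg ξ _)
  -- At nonzero frequency the horizontal block controls the horizontal components, since `|ξ| ≥ 1`,
  -- and the remaining diagonal entry controls the vertical one.
  · rw [inner_average_symGrad, Fin.sum_univ_castSucc, Fin.sum_univ_castSucc (n := n), mul_add]
    refine add_le_add ?_ ?_
    · refine le_trans ?_ ((sum_modeSq_horizontal_le ξ v).trans (Finset.sum_le_sum fun i _ => ?_))
      · refine mul_le_mul_of_nonneg_right ((min_le_right _ _).trans ?_)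
          (Finset.sum_nonneg fun j _ => modeSq_nonneg ξ _)
        have := one_le_freqNorm hξ
        nlinarith [Real.pi_pos, sq_nonneg Real.pi, mul_nonneg (sq_nonneg Real.pi)
          (by nlinarith : (0 : ℝ) ≤ freqNorm ξ ^ 2 - 1)]
      · rw [Fin.sum_univ_castSucc]
        exact le_add_of_nonneg_right (modeSq_nonneg ξ _)
    · refine le_trans (mul_le_mul_of_nonneg_right (min_le_left _ _) (modeSq_nonneg ξ _))
        (hN.trans ?_)
      exact Finset.single_le_sum (f := fun j => modeSq ℓ ξ fun z =>
        dcomp v (Fin.last n) j z + dcomp v j (Fin.last n) z) (fun j _ => modeSq_nonneg ξ _)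
          (Finset.mem_univ (Fin.last n))

end

section

variable {n : ℕ} {ℓ : ℝ}

/-! ### Integration by parts for smooth functions on the slab -/

theorem displacement_add (j : Fin (n + 1)) (s t : ℝ) :
    displacement j (s + t) = displacement j s + displacement j t := by
  refine Fin.lastCases ?_ (fun i => ?_) j
  · simp [displacement]
  · simp only [displacement, Fin.lastCases_castSucc, Prod.mk_add_mk, add_zero]
    rw [← Pi.single_add]
    simp

theorem displacement_zero (j : Fin (n + 1)) : displacement j 0 = 0 := by
  have := displacement_add j (0 : ℝ) 0
  rw [add_zero] at this
  exact left_eq_add.1 this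

/-- Differentiability at parameter `0` comes from the periodic lift; the additivity of
`displacement` carries it to every point of the line. -/
theorem IsSmooth.hasDerivAt {φ : UnitAddTorus (Fin n) × ℝ → ℝ} (hφ : IsSmooth φ) (j : Fin (n + 1))
    (z : UnitAddTorus (Fin n) × ℝ) (s : ℝ) :
    HasDerivAt (fun s : ℝ => φ (z + displacement j s)) (partialDeriv j φ (z + displacement j s))
      s := by
  have h0 : ∀ z : UnitAddTorus (Fin n) × ℝ,
      DifferentiableAt ℝ (fun s : ℝ => φ (z + displacement j s)) 0 := fun z => by
    obtain ⟨p, hp⟩ := (isOpenQuotientMap_lift n).surjective z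
    let e : (Fin n → ℝ) × ℝ :=
      Fin.lastCases (motive := fun _ => (Fin n → ℝ) × ℝ) (0, 1) (fun i => (Pi.single i 1, 0)) j
    have hline : (fun s : ℝ => φ (z + displacement j s)) = fun s : ℝ =>
        φ (fun i => ((p + s • e).1 i : UnitAddCircle), (p + s • e).2) := by
      funext s
      rw [← hp]
      simp only [e, displacement]
      congr 1
      refine Fin.lastCases ?_ (fun i => ?_) j
      · simp
      · simp only [Fin.lastCases_castSucc]
        ext k
        · by_cases hk : k = i
          · subst hk; simp
          · simp [hk]
        · simp
    rw [hline]
    have hd : DifferentiableAt ℝ (fun p : (Fin n → ℝ) × ℝ =>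
        φ (fun i => (p.1 i : UnitAddCircle), p.2)) (p + (0 : ℝ) • e) :=
      (ContDiff.differentiable hφ (by simp)).differentiableAt
    exact hd.comp (0 : ℝ) (f := fun s : ℝ => p + s • e) (by fun_prop)
  have h1 := (h0 (z + displacement j s)).hasDerivAt
  have h2 : HasDerivAt (fun t => φ (z + displacement j s + displacement j (t - s)))
      (partialDeriv j φ (z + displacement j s)) s := by
    have h3 : HasDerivAt (fun t : ℝ => φ (z + displacement j s + displacement j t))
      (partialDeriv j φ (z + displacement j s)) (s - s) := by rw [sub_self]; exact h1
    exact h3.comp_sub_const s s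
  refine h2.congr_of_eventuallyEq (Eventually.of_forall fun t => ?_)
  simp only
  rw [add_assoc, ← displacement_add, add_sub_cancel]

theorem IsSmooth.mul {φ ψ : UnitAddTorus (Fin n) × ℝ → ℝ} (hφ : IsSmooth φ) (hψ : IsSmooth ψ) :
    IsSmooth fun z => φ z * ψ z := ContDiff.mul hφ hψ

theorem partialDeriv_mul {φ ψ : UnitAddTorus (Fin n) × ℝ → ℝ} (hφ : IsSmooth φ) (hψ : IsSmooth ψ)
    (j : Fin (n + 1)) (z : UnitAddTorus (Fin n) × ℝ) :
    partialDeriv j (fun z => φ z * ψ z) z =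
      φ z * partialDeriv j ψ z + partialDeriv j φ z * ψ z := by
  have h := (hφ.hasDerivAt j z 0).mul (hψ.hasDerivAt j z 0)
  simp only [displacement_zero, add_zero] at h
  exact h.deriv.trans (by ring)

theorem integrable_slab_of_continuous (ℓ : ℝ) {F : UnitAddTorus (Fin n) × ℝ → ℝ}
    (hF : Continuous F) : Integrable F (slabMeasure n ℓ) :=
  (memLp_of_continuous ℓ hF).integrable (by norm_num)

/-- The integral of a horizontal translate does not depend on the shift; differentiation under the
integral sign gives the result without charts on the torus. -/
theorem integral_partialDeriv_castSucc (ℓ : ℝ) {F : UnitAddTorus (Fin n) × ℝ → ℝ} (hF : IsSmooth F)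
    (i : Fin n) : ∫ z, partialDeriv i.castSucc F z ∂slabMeasure n ℓ = 0 := by
  have hFc := hF.continuous
  have hDc := hF.continuous_partialDeriv i.castSucc
  obtain ⟨C, hC⟩ := ((isCompact_univ.prod isCompact_Icc :
    IsCompact ((univ : Set (UnitAddTorus (Fin n))) ×ˢ Icc 0 ℓ))).exists_bound_of_continuousOn
      hDc.continuousOn
  have hae : ∀ᵐ z ∂slabMeasure n ℓ, z.2 ∈ Ioo 0 ℓ :=
    (Measure.quasiMeasurePreserving_snd (μ := torusMeasure n)
      (ν := volume.restrict (Ioo 0 ℓ))).ae (ae_restrict_mem measurableSet_Ioo)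
  have hcs : ∀ s : ℝ, Continuous fun z : UnitAddTorus (Fin n) × ℝ =>
      z + displacement i.castSucc s := fun s => by fun_prop
  have key := hasDerivAt_integral_of_dominated_loc_of_deriv_le (μ := slabMeasure n ℓ)
    (x₀ := (0 : ℝ))
    (F := fun s z => F (z + displacement i.castSucc s))
    (F' := fun s z => partialDeriv i.castSucc F (z + displacement i.castSucc s))
    (bound := fun _ => C) (s := univ) univ_mem
    (Eventually.of_forall fun s => (hFc.comp (hcs s)).aestronglyMeasurable)
    (integrable_slab_of_continuous ℓ (hFc.comp (hcs 0)))
    (hDc.comp (hcs 0)).aestronglyMeasurable ?_ (integrable_const C)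
    (ae_of_all _ fun z s _ => hF.hasDerivAt i.castSucc z s)
  · have hconst : ∀ s : ℝ, ∫ z, F (z + displacement i.castSucc s) ∂slabMeasure n ℓ =
        ∫ z, F z ∂slabMeasure n ℓ := fun s => by
      rw [← integral_slabShift ℓ (Pi.single i (s : UnitAddCircle)) F]
      congr 1
      funext z
      congr 1
      ext1 <;> simp [displacement]
    simp only [hconst, displacement_zero, add_zero] at key
    exact key.2.unique (hasDerivAt_const _ _)
  · filter_upwards [hae] with z hz s _
    refine hC _ ⟨mem_univ _, ?_⟩
    simpa [displacement] using Ioo_subset_Icc_self hz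

theorem integral_partialDeriv_last (hℓ : 0 < ℓ) {F : UnitAddTorus (Fin n) × ℝ → ℝ}
    (hF : IsSmooth F) : ∫ z, partialDeriv (Fin.last n) F z ∂slabMeasure n ℓ =
      ∫ x, (F (x, ℓ) - F (x, 0)) ∂torusMeasure n := by
  have hDc := hF.continuous_partialDeriv (Fin.last n)
  refine (integral_prod (μ := torusMeasure n) (ν := volume.restrict (Ioo 0 ℓ)) _
    (integrable_slab_of_continuous ℓ hDc)).trans ?_
  congr 1
  funext x
  rw [← integral_Ioc_eq_integral_Ioo, ← intervalIntegral.integral_of_le hℓ.le]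
  refine intervalIntegral.integral_eq_sub_of_hasDerivAt (f := fun y => F (x, y)) (fun y _ => ?_)
    ((hDc.comp (by fun_prop)).intervalIntegrable _ _)
  have h := hF.hasDerivAt (Fin.last n) (x, 0) y
  simpa [displacement] using h

theorem IsSmooth.isWeakPartial {f : UnitAddTorus (Fin n) × ℝ → ℝ} (hf : IsSmooth f) (hℓ : 0 < ℓ)
    (i : Fin (n + 1)) : IsWeakPartial ℓ i f (partialDeriv i f) := by
  intro φ hφ hs
  have h0 : ∫ z, partialDeriv i (fun z => f z * φ z) z ∂slabMeasure n ℓ = 0 := by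
    revert i
    refine Fin.lastCases ?_ fun i => integral_partialDeriv_castSucc ℓ (hf.mul hφ) i
    rw [integral_partialDeriv_last hℓ (hf.mul hφ)]
    have h1 : ∀ x y, y ∉ Ioo 0 ℓ → φ (x, y) = 0 := fun x y hy =>
      image_eq_zero_of_notMem_tsupport fun h => hy (hs h).2
    simp [h1 _ ℓ (by simp), h1 _ 0 (by simp)]
  simp only [partialDeriv_mul hf hφ] at h0
  have i1 : Integrable (fun z => f z * partialDeriv i φ z) (slabMeasure n ℓ) :=
    integrable_slab_of_continuous ℓ (hf.continuous.mul (hφ.continuous_partialDeriv i))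
  have i2 : Integrable (fun z => partialDeriv i f z * φ z) (slabMeasure n ℓ) :=
    integrable_slab_of_continuous ℓ ((hf.continuous_partialDeriv i).mul hφ.continuous)
  rw [integral_add i1 i2] at h0
  linarith

theorem IsSmooth.integral_vertical {f φ : UnitAddTorus (Fin n) × ℝ → ℝ} (hf : IsSmooth f)
    (hφ : IsSmooth φ) (hℓ : 0 < ℓ) :
    ∫ z, (f z * partialDeriv (Fin.last n) φ z + partialDeriv (Fin.last n) f z * φ z)
      ∂slabMeasure n ℓ = ∫ x, (f (x, ℓ) * φ (x, ℓ) - f (x, 0) * φ (x, 0)) ∂torusMeasure n := by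
  rw [← integral_partialDeriv_last hℓ (hf.mul hφ)]
  simp only [partialDeriv_mul hf hφ]

/-! ### Divergence-free fields from smooth ones -/

section SmoothField

theorem memLp_vec {ι : Type*} [Fintype ι] {f : ι → UnitAddTorus (Fin n) × ℝ → ℝ}
    (hf : ∀ j, Continuous (f j)) :
    MemLp (fun z => (WithLp.toLp 2 fun j => f j z : EuclideanSpace ℝ ι)) 2 (slabMeasure n ℓ) :=
  memLp_piLp_iff.2 fun j => memLp_of_continuous ℓ (hf j)

/-- Classical smooth fields belong to the space, with their classical gradient and trace. It is the
only source of explicit test fields below. -/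
theorem exists_divFree_of_smooth (hℓ : 0 < ℓ) {f : Fin (n + 1) → UnitAddTorus (Fin n) × ℝ → ℝ}
    (hf : ∀ j, IsSmooth (f j)) (h0 : ∀ j x, f j (x, 0) = 0)
    (hdiv : ∀ z, ∑ i, partialDeriv i (f i) z = 0) :
    ∃ v : divFree n ℓ, (∀ᵐ z ∂slabMeasure n ℓ, ∀ j, velocity n ℓ v z j = f j z) ∧
      (∀ᵐ z ∂slabMeasure n ℓ, ∀ p, gradient n ℓ v z p = partialDeriv p.1 (f p.2) z) ∧
      ∀ b : L2Torus n, (∀ᵐ x ∂torusMeasure n, b x = f (Fin.last n) (x, ℓ)) → IsTopTraceOf v b := by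
  have hU := memLp_vec (ℓ := ℓ) (f := f) fun j => (hf j).continuous
  have hG := memLp_vec (ℓ := ℓ) (f := fun p : Fin (n + 1) × Fin (n + 1) =>
    partialDeriv p.1 (f p.2)) fun p => (hf p.2).continuous_partialDeriv p.1
  have hUe : ∀ᵐ z ∂slabMeasure n ℓ, ∀ j, hU.toLp _ z j = f j z := by
    filter_upwards [hU.coeFn_toLp] with z hz j
    rw [hz]
  have hGe : ∀ᵐ z ∂slabMeasure n ℓ, ∀ p, hG.toLp _ z p = partialDeriv p.1 (f p.2) z := by
    filter_upwards [hG.coeFn_toLp] with z hz j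
    rw [hz]
  have hv : IsDivFreeField (hU.toLp _) (hG.toLp _) := by
    refine ⟨fun i j φ hφ hs => ?_, fun j φ hφ hb => ?_, ?_⟩
    · refine (integral_congr_ae ?_).trans (((hf j).isWeakPartial hℓ i φ hφ hs).trans
        (congrArg Neg.neg (integral_congr_ae ?_)))
      · filter_upwards [hUe] with z hz
        rw [hz]
      · filter_upwards [hGe] with z hz
        rw [hz]
    · refine (integral_congr_ae ?_).trans (((hf j).integral_vertical hφ hℓ).trans ?_)
      · filter_upwards [hUe, hGe] with z h1 h2
        rw [h1, h2]
      · simp [hb, h0]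
    · filter_upwards [hGe] with z hz
      simp only [hz]
      exact hdiv z
  refine ⟨⟨WithLp.toLp 2 (hU.toLp _, hG.toLp _), hv⟩, hUe, hGe, fun b hb φ hφ hφ0 => ?_⟩
  refine (integral_congr_ae ?_).trans (((hf (Fin.last n)).integral_vertical hφ hℓ).trans
    (integral_congr_ae ?_))
  · filter_upwards [hUe, hGe] with z h1 h2
    exact congrArg₂ (· + ·) (congrArg (· * _) (h1 _)) (congrArg (· * _) (h2 (_, _)))
  · filter_upwards [hb] with x hx
    simp [h0, hx]

end SmoothField

end

section

variable {n : ℕ} {ℓ : ℝ}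

/-! ### Divergence-free fields with a prescribed character as trace -/

theorem norm_sq_le_of_profile {ι : Type*} [Fintype ι]
    (w : Lp (EuclideanSpace ℝ ι) 2 (slabMeasure n ℓ)) {η : ℝ → ℝ} (hη : Continuous η)
    (h : ∀ᵐ z ∂slabMeasure n ℓ, ∑ j, w z j ^ 2 ≤ η z.2) :
    ‖w‖ ^ 2 ≤ ∫ y in Ioo 0 ℓ, η y := by
  have h1 : ‖w‖ ^ 2 = ∫ z, ∑ j, w z j ^ 2 ∂slabMeasure n ℓ := by
    rw [← real_inner_self_eq_norm_sq, L2.inner_def]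
    refine integral_congr_ae (ae_of_all _ fun z => ?_)
    simp only [real_inner_self_eq_norm_sq, EuclideanSpace.real_norm_sq_eq]
  have hc : Continuous fun z : UnitAddTorus (Fin n) × ℝ => η z.2 := hη.comp continuous_snd
  have h2 : ∫ z, η z.2 ∂slabMeasure n ℓ = ∫ y in Ioo 0 ℓ, η y := by
    refine (integral_fun_snd (μ := torusMeasure n) (ν := volume.restrict (Ioo 0 ℓ)) η).trans ?_
    simp
  rw [h1, ← h2]
  exact integral_mono_of_nonneg (ae_of_all _ fun z => Finset.sum_nonneg fun j _ => sq_nonneg _)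
    (integrable_slab_of_continuous ℓ hc) h

/-- A pair of conjugate characters at the frequency `ξ`, i.e. `cos` and `sin` up to the order. -/
structure IsConjugatePair (ξ : Fin n → ℤ) (θ : ℝ) (k k' : UnitAddTorus (Fin n) → ℝ) : Prop where
  sq_sign : θ ^ 2 = 1
  fst : IsSmoothChar k
  snd : IsSmoothChar k'
  deriv_fst : ∀ i x, HasDerivAt (fun s : ℝ => k (x + Pi.single i (s : UnitAddCircle)))
    (θ * (2 * Real.pi * ξ i) * k' x) 0
  deriv_snd : ∀ i x, HasDerivAt (fun s : ℝ => k' (x + Pi.single i (s : UnitAddCircle)))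
    (-(θ * (2 * Real.pi * ξ i)) * k x) 0

theorem isConjugatePair_cos_sin (ξ : Fin n → ℤ) :
    IsConjugatePair ξ (-1) (cosChar ξ) (sinChar ξ) where
  sq_sign := by norm_num
  fst := isSmoothChar_cosChar ξ
  snd := isSmoothChar_sinChar ξ
  deriv_fst i x := by simpa only [neg_one_mul] using hasDerivAt_cosChar ξ i x
  deriv_snd i x := by simpa only [neg_one_mul, neg_neg] using hasDerivAt_sinChar ξ i x

theorem isConjugatePair_sin_cos (ξ : Fin n → ℤ) :
    IsConjugatePair ξ 1 (sinChar ξ) (cosChar ξ) where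
  sq_sign := by norm_num
  fst := isSmoothChar_sinChar ξ
  snd := isSmoothChar_cosChar ξ
  deriv_fst i x := by simpa only [one_mul] using hasDerivAt_sinChar ξ i x
  deriv_snd i x := by simpa only [one_mul] using hasDerivAt_cosChar ξ i x

/-- The components of the divergence-free field built from a conjugate pair and a profile `φ`, with
`φ₁` the derivative of `φ`. -/
def liftField (ξ : Fin n → ℤ) (θ : ℝ) (k k' : UnitAddTorus (Fin n) → ℝ) (φ φ₁ : ℝ → ℝ) :
    Fin (n + 1) → UnitAddTorus (Fin n) × ℝ → ℝ :=
  Fin.lastCases (motive := fun _ => UnitAddTorus (Fin n) × ℝ → ℝ) (fun z => k z.1 * φ z.2)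
    fun j z => k' z.1 * (θ * ξ j / (2 * Real.pi * freqNorm ξ ^ 2) * φ₁ z.2)

section LiftField

variable {ξ : Fin n → ℤ} {θ : ℝ} {k k' : UnitAddTorus (Fin n) → ℝ} {φ φ₁ φ₂ : ℝ → ℝ}

theorem liftField_last (z : UnitAddTorus (Fin n) × ℝ) :
    liftField ξ θ k k' φ φ₁ (Fin.last n) z = k z.1 * φ z.2 := by
  simp [liftField]

theorem liftField_castSucc (j : Fin n) (z : UnitAddTorus (Fin n) × ℝ) :
    liftField ξ θ k k' φ φ₁ j.castSucc z =
      k' z.1 * (θ * ξ j / (2 * Real.pi * freqNorm ξ ^ 2) * φ₁ z.2) := by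
  simp [liftField]

theorem isSmooth_liftField (h : IsConjugatePair ξ θ k k') (hφ : ContDiff ℝ ∞ φ)
    (hφ₁ : ContDiff ℝ ∞ φ₁) (j : Fin (n + 1)) : IsSmooth (liftField ξ θ k k' φ φ₁ j) := by
  refine Fin.lastCases ?_ (fun j => ?_) j
  · simpa only [liftField, Fin.lastCases_last] using h.fst.isSmooth_mul hφ
  · simpa only [liftField, Fin.lastCases_castSucc] using
      h.snd.isSmooth_mul (contDiff_const.mul hφ₁)

theorem partialDeriv_liftField_castSucc_last (h : IsConjugatePair ξ θ k k')
    (z : UnitAddTorus (Fin n) × ℝ) (i : Fin n) :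
    partialDeriv i.castSucc (liftField ξ θ k k' φ φ₁ (Fin.last n)) z =
      θ * (2 * Real.pi * ξ i) * k' z.1 * φ z.2 := by
  simp only [liftField, Fin.lastCases_last]
  exact partialDeriv_castSucc_mul (h.deriv_fst i z.1) φ

theorem partialDeriv_liftField_castSucc_castSucc (h : IsConjugatePair ξ θ k k')
    (z : UnitAddTorus (Fin n) × ℝ) (i j : Fin n) :
    partialDeriv i.castSucc (liftField ξ θ k k' φ φ₁ j.castSucc) z =
      -(ξ i * ξ j / freqNorm ξ ^ 2) * (k z.1 * φ₁ z.2) := by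
  simp only [liftField, Fin.lastCases_castSucc]
  rw [partialDeriv_castSucc_mul (h.deriv_snd i z.1) fun y =>
    θ * ξ j / (2 * Real.pi * freqNorm ξ ^ 2) * φ₁ y]
  have h2 := Real.pi_pos.ne'
  have h3 := h.sq_sign
  have e : -(θ * (2 * Real.pi * ξ i)) * k z.1 *
      (θ * ξ j / (2 * Real.pi * freqNorm ξ ^ 2) * φ₁ z.2) =
      -(θ ^ 2 * (ξ i * ξ j / freqNorm ξ ^ 2) * ((2 * Real.pi) / (2 * Real.pi))) *
        (k z.1 * φ₁ z.2) := by ring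
  rw [e, h3, div_self (by positivity)]
  ring

theorem partialDeriv_liftField_last_last (hd : ∀ y, HasDerivAt φ (φ₁ y) y)
    (z : UnitAddTorus (Fin n) × ℝ) :
    partialDeriv (Fin.last n) (liftField ξ θ k k' φ φ₁ (Fin.last n)) z = k z.1 * φ₁ z.2 := by
  simp only [liftField, Fin.lastCases_last]
  rw [partialDeriv_last_mul k (fun y => (hd y).differentiableAt), (hd _).deriv]

theorem partialDeriv_liftField_last_castSucc (hd₁ : ∀ y, HasDerivAt φ₁ (φ₂ y) y)
    (z : UnitAddTorus (Fin n) × ℝ) (j : Fin n) :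
    partialDeriv (Fin.last n) (liftField ξ θ k k' φ φ₁ j.castSucc) z =
      k' z.1 * (θ * ξ j / (2 * Real.pi * freqNorm ξ ^ 2) * φ₂ z.2) := by
  simp only [liftField, Fin.lastCases_castSucc]
  rw [partialDeriv_last_mul k' (η := fun y => θ * ξ j / (2 * Real.pi * freqNorm ξ ^ 2) * φ₁ y)
    (fun y => ((hd₁ y).const_mul _).differentiableAt), ((hd₁ _).const_mul _).deriv]

/-- The horizontal part of the field is `φ₁ ∇k / (4π² |ξ|²)`. Since `Δk = -4π² |ξ|² k`, its
divergence is `-k φ₁`, which cancels the vertical derivative of `k φ`. -/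
theorem sum_partialDeriv_liftField (h : IsConjugatePair ξ θ k k') (hd : ∀ y, HasDerivAt φ (φ₁ y) y)
    (z : UnitAddTorus (Fin n) × ℝ) (hξ : ξ ≠ 0) :
    ∑ i, partialDeriv i (liftField ξ θ k k' φ φ₁ i) z = 0 := by
  have hpos : 0 < freqNorm ξ := zero_lt_one.trans_le (one_le_freqNorm hξ)
  rw [Fin.sum_univ_castSucc, partialDeriv_liftField_last_last hd z]
  simp only [partialDeriv_liftField_castSucc_castSucc h z]
  rw [← Finset.sum_mul, Finset.sum_neg_distrib, ← Finset.sum_div]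
  simp only [← sq]
  rw [← freqNorm_sq, div_self (by positivity)]
  ring

theorem sum_sq_liftField_le (h : IsConjugatePair ξ θ k k')
    (z : UnitAddTorus (Fin n) × ℝ) (hξ : ξ ≠ 0) : ∑ j, liftField ξ θ k k' φ φ₁ j z ^ 2 ≤
    φ z.2 ^ 2 + φ₁ z.2 ^ 2 / (4 * Real.pi ^ 2 * freqNorm ξ ^ 2) := by
  have hpos : 0 < freqNorm ξ := zero_lt_one.trans_le (one_le_freqNorm hξ)
  have hk := (sq_le_one_iff_abs_le_one _).2 (h.fst.abs_le z.1)
  have hk' := (sq_le_one_iff_abs_le_one _).2 (h.snd.abs_le z.1)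
  rw [Fin.sum_univ_castSucc]
  simp only [liftField_last, liftField_castSucc, mul_pow, div_pow, h.sq_sign, one_mul]
  rw [← Finset.mul_sum, ← Finset.sum_mul, ← Finset.sum_div, ← freqNorm_sq, add_comm]
  refine add_le_add (mul_le_of_le_one_left (sq_nonneg _) hk)
    ((mul_le_of_le_one_left (by positivity) hk').trans (le_of_eq ?_))
  field_simp
  ring

/-- A profile varying on the scale `1/|ξ|` has `φ₁ ~ |ξ| φ` and `φ₂ ~ |ξ|² φ`, and the powers of
`|ξ|` are arranged so that all three terms are then of order `|ξ|² φ²`. -/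
theorem sum_sq_partialDeriv_liftField_le (h : IsConjugatePair ξ θ k k')
    (hd : ∀ y, HasDerivAt φ (φ₁ y) y) (hd₁ : ∀ y, HasDerivAt φ₁ (φ₂ y) y)
    (z : UnitAddTorus (Fin n) × ℝ) (hξ : ξ ≠ 0) :
    ∑ p : Fin (n + 1) × Fin (n + 1), partialDeriv p.1 (liftField ξ θ k k' φ φ₁ p.2) z ^ 2 ≤
    4 * Real.pi ^ 2 * freqNorm ξ ^ 2 * φ z.2 ^ 2 + 2 * φ₁ z.2 ^ 2 +
      φ₂ z.2 ^ 2 / (4 * Real.pi ^ 2 * freqNorm ξ ^ 2) := by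
  have hpos : 0 < freqNorm ξ := zero_lt_one.trans_le (one_le_freqNorm hξ)
  have hk := (sq_le_one_iff_abs_le_one _).2 (h.fst.abs_le z.1)
  have hk' := (sq_le_one_iff_abs_le_one _).2 (h.snd.abs_le z.1)
  rw [Fintype.sum_prod_type, Fin.sum_univ_castSucc, Fin.sum_univ_castSucc (n := n)]
  simp only [Fin.sum_univ_castSucc (n := n), partialDeriv_liftField_castSucc_last h z,
    partialDeriv_liftField_castSucc_castSucc h z, partialDeriv_liftField_last_last hd z,
    partialDeriv_liftField_last_castSucc hd₁ z, Finset.sum_add_distrib]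
  have e1 : ∑ i : Fin n, ∑ j : Fin n, (-(ξ i * ξ j / freqNorm ξ ^ 2) * (k z.1 * φ₁ z.2)) ^ 2 ≤
      φ₁ z.2 ^ 2 := by
    have : ∀ i j, (-(ξ i * ξ j / freqNorm ξ ^ 2) * (k z.1 * φ₁ z.2)) ^ 2 =
        (ξ i : ℝ) ^ 2 * ((ξ j : ℝ) ^ 2 * (k z.1 ^ 2 * φ₁ z.2 ^ 2 / freqNorm ξ ^ 4)) := fun i j => by
      field_simp
    simp only [this, ← Finset.mul_sum, ← Finset.sum_mul, ← freqNorm_sq]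
    refine le_trans (le_of_eq ?_) (mul_le_of_le_one_left (sq_nonneg (φ₁ z.2)) hk)
    field_simp
  have e2 : ∑ i : Fin n, (θ * (2 * Real.pi * ξ i) * k' z.1 * φ z.2) ^ 2 ≤
      4 * Real.pi ^ 2 * freqNorm ξ ^ 2 * φ z.2 ^ 2 := by
    have : ∀ i, (θ * (2 * Real.pi * ξ i) * k' z.1 * φ z.2) ^ 2 =
        (ξ i : ℝ) ^ 2 * (θ ^ 2 * (4 * Real.pi ^ 2 * k' z.1 ^ 2 * φ z.2 ^ 2)) := fun i => by ring
    simp only [this, ← Finset.sum_mul, ← freqNorm_sq, h.sq_sign]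
    refine le_trans (le_of_eq ?_) (mul_le_of_le_one_left
      (by positivity : 0 ≤ 4 * Real.pi ^ 2 * freqNorm ξ ^ 2 * φ z.2 ^ 2) hk')
    ring
  have e3 : ∑ j : Fin n, (k' z.1 * (θ * ξ j / (2 * Real.pi * freqNorm ξ ^ 2) * φ₂ z.2)) ^ 2 ≤
      φ₂ z.2 ^ 2 / (4 * Real.pi ^ 2 * freqNorm ξ ^ 2) := by
    have : ∀ j, (k' z.1 * (θ * ξ j / (2 * Real.pi * freqNorm ξ ^ 2) * φ₂ z.2)) ^ 2 =
        (ξ j : ℝ) ^ 2 * (θ ^ 2 * (k' z.1 ^ 2 * φ₂ z.2 ^ 2 / (4 * Real.pi ^ 2 * freqNorm ξ ^ 4))) :=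
      fun j => by
        field_simp
        ring
    simp only [this, ← Finset.sum_mul, ← freqNorm_sq, h.sq_sign]
    refine le_trans (le_of_eq ?_) (mul_le_of_le_one_left
      (by positivity : 0 ≤ φ₂ z.2 ^ 2 / (4 * Real.pi ^ 2 * freqNorm ξ ^ 2)) hk')
    field_simp
  have e4 : (k z.1 * φ₁ z.2) ^ 2 ≤ φ₁ z.2 ^ 2 := by
    rw [mul_pow]; exact mul_le_of_le_one_left (sq_nonneg _) hk
  linarith

end LiftField

theorem integral_profile_pow (hℓ : 0 < ℓ) (A : ℝ) (M : ℕ) :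
    ∫ y in Ioo 0 ℓ, A * (y / ℓ) ^ (2 * M) = A * (ℓ / (2 * M + 1)) := by
  rw [← integral_Ioc_eq_integral_Ioo, ← intervalIntegral.integral_of_le hℓ.le,
    intervalIntegral.integral_const_mul,
    intervalIntegral.integral_comp_div (fun y => y ^ (2 * M)) hℓ.ne', integral_pow]
  simp only [zero_div, div_self hℓ.ne', smul_eq_mul, one_pow]
  rw [zero_pow (by omega)]
  push_cast
  ring

/-- A character of nonzero frequency is the trace of a divergence-free field whose gradient is
bounded by the square root of the frequency. -/
theorem exists_trace_lift (hℓ : 0 < ℓ) {ξ : Fin n → ℤ} (hξ : ξ ≠ 0) {θ : ℝ}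
    {k k' : UnitAddTorus (Fin n) → ℝ} (h : IsConjugatePair ξ θ k k') :
    ∃ v : divFree n ℓ, ‖velocity n ℓ v‖ ^ 2 ≤ ℓ * (1 + 4 / (Real.pi ^ 2 * ℓ ^ 2)) ∧
      ‖gradient n ℓ v‖ ^ 2 ≤
        ℓ * (4 * Real.pi ^ 2 + 32 / ℓ ^ 2 + 64 / (Real.pi ^ 2 * ℓ ^ 4)) * freqNorm ξ ∧
      ∀ b : L2Torus n, (∀ᵐ x ∂torusMeasure n, b x = k x) → IsTopTraceOf v b := by
  set κ := freqNorm ξ with hκ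
  have hκ1 : 1 ≤ κ := one_le_freqNorm hξ
  have hκ0 : 0 < κ := zero_lt_one.trans_le hκ1
  -- The profile `(y/ℓ)^(M+2)` with `M ~ |ξ|` is a polynomial boundary layer of thickness about
  -- `1/|ξ|` below the top. The extra `2` makes `φ` and `φ₁` vanish at the bottom and keeps a factor
  -- `(y/ℓ)^M` in `φ₂`.
  set M := ⌈κ⌉₊ with hM
  have hM1 : κ ≤ M := Nat.le_ceil κ
  have hM2 : (M : ℝ) < κ + 1 := Nat.ceil_lt_add_one hκ0.le
  let φ : ℝ → ℝ := fun y => (y / ℓ) ^ (M + 2)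
  let φ₁ : ℝ → ℝ := fun y => ((M + 2 : ℕ) / ℓ) * (y / ℓ) ^ (M + 1)
  let φ₂ : ℝ → ℝ := fun y => ((M + 2 : ℕ) / ℓ) * (((M + 1 : ℕ) / ℓ) * (y / ℓ) ^ M)
  have hpow : ∀ (p : ℕ) y, HasDerivAt (fun y : ℝ => (y / ℓ) ^ (p + 1))
      (((p + 1 : ℕ) / ℓ) * (y / ℓ) ^ p) y := fun p y => by
    refine (((hasDerivAt_id y).div_const ℓ).pow (p + 1)).congr_deriv ?_
    simp only [add_tsub_cancel_right, id]
    ring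
  have hd : ∀ y, HasDerivAt φ (φ₁ y) y := hpow (M + 1)
  have hd₁ : ∀ y, HasDerivAt φ₁ (φ₂ y) y := fun y => (hpow M y).const_mul _
  have hsφ : ContDiff ℝ ∞ φ := by simp only [φ]; fun_prop
  have hsφ₁ : ContDiff ℝ ∞ φ₁ := by simp only [φ₁]; fun_prop
  obtain ⟨v, hv1, hv2, hv3⟩ := exists_divFree_of_smooth hℓ
    (isSmooth_liftField h hsφ hsφ₁) (fun j x => by
      refine Fin.lastCases ?_ (fun j => ?_) j
      · simp [liftField_last, φ]
      · simp [liftField_castSucc, φ₁]) fun z => sum_partialDeriv_liftField h hd z hξ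
  have hae : ∀ᵐ z ∂slabMeasure n ℓ, z.2 ∈ Ioo 0 ℓ :=
    (Measure.quasiMeasurePreserving_snd (μ := torusMeasure n)
      (ν := volume.restrict (Ioo 0 ℓ))).ae (ae_restrict_mem measurableSet_Ioo)
  have hb0 : ∀ y ∈ Ioo 0 ℓ, φ y ^ 2 ≤ (y / ℓ) ^ (2 * M) := fun y hy => by
    simp only [φ, ← pow_mul]
    exact pow_le_pow_of_le_one (div_nonneg hy.1.le hℓ.le) ((div_le_one hℓ).2 hy.2.le) (by omega)
  -- Here `M + 2 < κ + 3 ≤ 4 κ`, because `κ ≥ 1`.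
  have hm1 : ((M + 2 : ℕ) : ℝ) / ℓ ≤ 4 * κ / ℓ := by
    push_cast
    exact div_le_div_of_nonneg_right (by linarith) hℓ.le
  have hm2 : ((M + 1 : ℕ) : ℝ) / ℓ ≤ 4 * κ / ℓ := by
    push_cast
    exact div_le_div_of_nonneg_right (by linarith) hℓ.le
  have hb1 : ∀ y ∈ Ioo 0 ℓ, φ₁ y ^ 2 ≤ (4 * κ / ℓ) ^ 2 * (y / ℓ) ^ (2 * M) := fun y hy => by
    simp only [φ₁, mul_pow, ← pow_mul]
    refine mul_le_mul (pow_le_pow_left₀ (by positivity) hm1 2) (pow_le_pow_of_le_one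
      (div_nonneg hy.1.le hℓ.le) ((div_le_one hℓ).2 hy.2.le) (by omega)) ?_ (by positivity)
    exact pow_nonneg (div_nonneg hy.1.le hℓ.le) _
  have hb2 : ∀ y ∈ Ioo 0 ℓ, φ₂ y ^ 2 ≤ (4 * κ / ℓ) ^ 4 * (y / ℓ) ^ (2 * M) := fun y hy => by
    have e : φ₂ y ^ 2 = ((((M + 2 : ℕ) : ℝ) / ℓ) ^ 2 * (((M + 1 : ℕ) : ℝ) / ℓ) ^ 2) *
        (y / ℓ) ^ (2 * M) := by
      simp only [φ₂]; ring
    rw [e]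
    refine mul_le_mul_of_nonneg_right ?_ (pow_nonneg (div_nonneg hy.1.le hℓ.le) _)
    calc (((M + 2 : ℕ) : ℝ) / ℓ) ^ 2 * (((M + 1 : ℕ) : ℝ) / ℓ) ^ 2
        ≤ (4 * κ / ℓ) ^ 2 * (4 * κ / ℓ) ^ 2 :=
          mul_le_mul (pow_le_pow_left₀ (by positivity) hm1 2)
            (pow_le_pow_left₀ (by positivity) hm2 2) (by positivity) (by positivity)
      _ = _ := by ring
  -- Integrating the layer gains `1/κ`, which lowers the growth of `‖∇v‖²` from `κ²` to `κ`.
  have hint : ℓ / (2 * M + 1) ≤ ℓ / κ := div_le_div_of_nonneg_left hℓ.le hκ0 (by linarith)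
  have hpi := Real.pi_pos
  refine ⟨v, ?_, ?_, fun b hb => hv3 b ?_⟩
  · refine (norm_sq_le_of_profile (η := fun y => (1 + 4 / (Real.pi ^ 2 * ℓ ^ 2)) *
      (y / ℓ) ^ (2 * M)) _ (by fun_prop) ?_).trans ?_
    · filter_upwards [hv1, hae] with z hz hz2
      simp only [hz]
      refine (sum_sq_liftField_le h z hξ).trans ?_
      have e : (1 + 4 / (Real.pi ^ 2 * ℓ ^ 2)) * (z.2 / ℓ) ^ (2 * M) = (z.2 / ℓ) ^ (2 * M) +
          (4 * κ / ℓ) ^ 2 * (z.2 / ℓ) ^ (2 * M) / (4 * Real.pi ^ 2 * κ ^ 2) := by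
        field_simp
      rw [e]
      exact add_le_add (hb0 _ hz2) (div_le_div_of_nonneg_right (hb1 _ hz2) (by positivity))
    · rw [integral_profile_pow hℓ, mul_comm]
      refine mul_le_mul_of_nonneg_right (hint.trans ?_) (by positivity)
      exact div_le_self hℓ.le hκ1
  · refine (norm_sq_le_of_profile (η := fun y => κ ^ 2 * (4 * Real.pi ^ 2 + 32 / ℓ ^ 2 +
      64 / (Real.pi ^ 2 * ℓ ^ 4)) * (y / ℓ) ^ (2 * M)) _ (by fun_prop) ?_).trans ?_
    · filter_upwards [hv2, hae] with z hz hz2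
      simp only [hz]
      refine (sum_sq_partialDeriv_liftField_le h hd hd₁ z hξ).trans ?_
      have e : κ ^ 2 * (4 * Real.pi ^ 2 + 32 / ℓ ^ 2 + 64 / (Real.pi ^ 2 * ℓ ^ 4)) *
          (z.2 / ℓ) ^ (2 * M) = 4 * Real.pi ^ 2 * κ ^ 2 * (z.2 / ℓ) ^ (2 * M) +
          2 * ((4 * κ / ℓ) ^ 2 * (z.2 / ℓ) ^ (2 * M)) +
          (4 * κ / ℓ) ^ 4 * (z.2 / ℓ) ^ (2 * M) / (4 * Real.pi ^ 2 * κ ^ 2) := by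
        field_simp
        ring
      rw [e]
      exact add_le_add (add_le_add (mul_le_mul_of_nonneg_left (hb0 _ hz2) (by positivity))
        (mul_le_mul_of_nonneg_left (hb1 _ hz2) (by norm_num)))
        (div_le_div_of_nonneg_right (hb2 _ hz2) (by positivity))
    · rw [integral_profile_pow hℓ]
      refine (mul_le_mul_of_nonneg_left hint (by positivity)).trans (le_of_eq ?_)
      field_simp
  · filter_upwards [hb] with x hx
    rw [hx, liftField_last]
    simp [φ, hℓ.ne']

end

section

variable {n : ℕ} {ℓ : ℝ}

/-! ### Orthogonality of the characters -/

/-- The slab formula on a slab of height `1`, with constant vertical profile. -/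
theorem integral_torus_deriv {k d : UnitAddTorus (Fin n) → ℝ} (hk : IsSmoothChar k) {i : Fin n}
    (hd : ∀ x, HasDerivAt (fun s : ℝ => k (x + Pi.single i (s : UnitAddCircle))) (d x) 0) :
    ∫ x, d x ∂torusMeasure n = 0 := by
  have hη : ContDiff ℝ ∞ fun _ : ℝ => (1 : ℝ) := contDiff_const
  have h := integral_partialDeriv_castSucc 1 (hk.isSmooth_mul hη) i
  have e : ∀ z : UnitAddTorus (Fin n) × ℝ,
      partialDeriv i.castSucc (fun z => k z.1 * (fun _ => (1 : ℝ)) z.2) z = d z.1 := fun z =>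
    (partialDeriv_castSucc_mul (hd z.1) fun _ => 1).trans (mul_one _)
  have h1 := integral_fun_fst (μ := torusMeasure n) (ν := volume.restrict (Ioo (0 : ℝ) 1)) d
  have h2 := h1.symm.trans ((integral_congr_ae (ae_of_all _ e)).symm.trans h)
  simpa using h2

theorem IsSmoothChar.mul {k k' : UnitAddTorus (Fin n) → ℝ} (hk : IsSmoothChar k)
    (hk' : IsSmoothChar k') : IsSmoothChar fun x => k x * k' x where
  smooth := hk.smooth.mul hk'.smooth
  continuous := hk.continuous.mul hk'.continuous
  abs_le x := by
    rw [abs_mul]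
    exact mul_le_one₀ (hk.abs_le x) (abs_nonneg _) (hk'.abs_le x)

/-- The derivatives of `sin cos` and of `sin²` in a direction with `ξ i ≠ 0` integrate to zero, and
`cos² + sin² = 1` fixes the normalization. -/
theorem integral_torus_characters {ξ : Fin n → ℤ} (hξ : ξ ≠ 0) :
    ∫ x, cosChar ξ x * cosChar ξ x ∂torusMeasure n = 1 / 2 ∧
    ∫ x, sinChar ξ x * sinChar ξ x ∂torusMeasure n = 1 / 2 ∧
    ∫ x, cosChar ξ x * sinChar ξ x ∂torusMeasure n = 0 := by
  obtain ⟨i, hi⟩ := Function.ne_iff.1 hξ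
  have hi' : (2 * Real.pi * ξ i : ℝ) ≠ 0 :=
    mul_ne_zero (by positivity) (by exact_mod_cast hi)
  have hint : ∀ {f : UnitAddTorus (Fin n) → ℝ}, Continuous f → Integrable f (torusMeasure n) :=
    fun hf => hf.integrable_of_hasCompactSupport (HasCompactSupport.of_compactSpace _)
  have hc := continuous_cosChar ξ
  have hs := continuous_sinChar ξ
  have h1 := integral_torus_deriv ((isSmoothChar_sinChar ξ).mul (isSmoothChar_cosChar ξ))
    (d := fun x => 2 * Real.pi * ξ i * (cosChar ξ x * cosChar ξ x - sinChar ξ x * sinChar ξ x))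
    (fun x => by
      refine ((hasDerivAt_sinChar ξ i x).mul (hasDerivAt_cosChar ξ i x)).congr_deriv ?_
      simp only [AddCircle.coe_zero, Pi.single_zero, add_zero]
      ring)
  have h2 := integral_torus_deriv ((isSmoothChar_sinChar ξ).mul (isSmoothChar_sinChar ξ))
    (d := fun x => 2 * Real.pi * ξ i * (2 * (cosChar ξ x * sinChar ξ x)))
    (fun x => by
      refine ((hasDerivAt_sinChar ξ i x).mul (hasDerivAt_sinChar ξ i x)).congr_deriv ?_
      simp only [AddCircle.coe_zero, Pi.single_zero, add_zero]
      ring)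
  have h3 : ∫ x, (cosChar ξ x * cosChar ξ x + sinChar ξ x * sinChar ξ x) ∂torusMeasure n = 1 := by
    have : ∀ x, cosChar ξ x * cosChar ξ x + sinChar ξ x * sinChar ξ x = 1 := fun x => by
      rw [← cosChar_sq_add_sinChar_sq ξ x]; ring
    simp [this]
  rw [integral_const_mul, integral_sub (hint (by fun_prop)) (hint (by fun_prop))] at h1
  rw [integral_add (hint (by fun_prop)) (hint (by fun_prop))] at h3
  rw [integral_const_mul, integral_const_mul] at h2
  have h1' := (mul_eq_zero.1 h1).resolve_left hi'
  have h2' := (mul_eq_zero.1 h2).resolve_left hi'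
  refine ⟨by linarith, by linarith, by linarith⟩

/-- A bounded smooth function on the torus as an element of `L²`. -/
def IsSmoothChar.toLp {k : UnitAddTorus (Fin n) → ℝ} (hk : IsSmoothChar k) : L2Torus n :=
  (memLp_torus_of_continuous hk.continuous).toLp k

theorem IsSmoothChar.coeFn_toLp {k : UnitAddTorus (Fin n) → ℝ} (hk : IsSmoothChar k) :
    hk.toLp =ᵐ[torusMeasure n] k := MemLp.coeFn_toLp _

theorem IsSmoothChar.integral_toLp_mul {k : UnitAddTorus (Fin n) → ℝ} (hk : IsSmoothChar k)
    (m : UnitAddTorus (Fin n) → ℝ) :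
    ∫ x, hk.toLp x * m x ∂torusMeasure n = ∫ x, k x * m x ∂torusMeasure n := by
  refine integral_congr_ae ?_
  filter_upwards [hk.coeFn_toLp] with x hx
  rw [hx]

theorem IsSmoothChar.inner_toLp {k : UnitAddTorus (Fin n) → ℝ} (hk : IsSmoothChar k)
    (b : L2Torus n) : ⟪b, hk.toLp⟫_ℝ = ∫ x, b x * k x ∂torusMeasure n := by
  rw [L2.inner_def]
  refine integral_congr_ae ?_
  filter_upwards [hk.coeFn_toLp] with x hx
  rw [hx]
  simp [mul_comm]

/-- For `ξ ≠ 0` the averaging operator is half of the orthogonal projector onto the span of the two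
real characters. This is the origin of the factor `1/2` in front of `μ c` in the momentum balance.
-/
theorem integral_mul_average_cosChar {ξ : Fin n → ℤ} (hξ : ξ ≠ 0) (m : L2Torus n) :
    ∫ x, m x * (torusTranslation n).average ξ (isSmoothChar_cosChar ξ).toLp x ∂torusMeasure n =
      1 / 2 * cosMode ξ m := by
  have h := integral_torus_characters hξ
  rw [integral_mul_torusAverage, cosMode, sinMode, IsSmoothChar.integral_toLp_mul,
    IsSmoothChar.integral_toLp_mul, h.1, h.2.2]
  ring

theorem integral_mul_average_sinChar {ξ : Fin n → ℤ} (hξ : ξ ≠ 0) (m : L2Torus n) :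
    ∫ x, m x * (torusTranslation n).average ξ (isSmoothChar_sinChar ξ).toLp x ∂torusMeasure n =
      1 / 2 * sinMode ξ m := by
  have h := integral_torus_characters hξ
  rw [integral_mul_torusAverage, cosMode, sinMode, IsSmoothChar.integral_toLp_mul,
    IsSmoothChar.integral_toLp_mul, h.2.1]
  simp only [mul_comm (sinChar ξ _), h.2.2]
  ring

/-! ### A Lyapunov functional -/

/-- Smallness of the cross term: it makes the Lyapunov functional comparable to the energy. -/
theorem abs_cross_le {X p q c d μ ε C₁ : ℝ} (hε : 0 < ε) (hX : 0 ≤ X) (hε1 : ε * C₁ ≤ 1 / 4)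
    (hεμ : 2 * ε ≤ μ) (hp : p ^ 2 ≤ C₁ * X) (hq : q ^ 2 ≤ C₁ * X) :
    |ε * (p * c + q * d)| ≤ 1 / 4 * (X + μ * (c ^ 2 + d ^ 2)) := by
  have h1 : |p * c + q * d| ≤ 1 / 2 * (p ^ 2 + q ^ 2) + 1 / 2 * (c ^ 2 + d ^ 2) := by
    rw [abs_le]
    constructor
    · linarith [sq_nonneg (p + c), sq_nonneg (q + d), add_sq p c, add_sq q d]
    · linarith [sq_nonneg (p - c), sq_nonneg (q - d), sub_sq p c, sub_sq q d]
  have h2 : ε * (1 / 2 * (p ^ 2 + q ^ 2)) ≤ 1 / 4 * X := by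
    have := mul_le_mul_of_nonneg_left (add_le_add hp hq) hε.le
    have := mul_le_mul_of_nonneg_right hε1 hX
    linarith
  have h3 := mul_le_mul_of_nonneg_right hεμ (add_nonneg (sq_nonneg c) (sq_nonneg d))
  rw [abs_mul, abs_of_pos hε]
  have := mul_le_mul_of_nonneg_left h1 hε.le
  linarith

/-- Young's inequality with weight `μ`: half of the damping `½ ε μ y²` absorbs the viscous term. The
hypothesis `ε * A ≤ μ / 8` is the one that later limits the rate, since `A` grows like `|ξ|`. -/
theorem damping_term_le {B x y μ ε A : ℝ} (hε : 0 < ε) (hμ : 0 < μ) (hB : 0 ≤ B)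
    (hεA : ε * A ≤ μ / 8) (hx : x ^ 2 ≤ A * B) :
    ε * (-(1 / 2) * x * y) ≤ ε * (1 / 4 * μ * y ^ 2) + 1 / 32 * B := by
  have h1 : -(1 / 2) * x * y ≤ 1 / 4 * μ * y ^ 2 + x ^ 2 / (4 * μ) := by
    have h : 0 ≤ (μ * y + x) ^ 2 / (4 * μ) := by positivity
    have e : (μ * y + x) ^ 2 / (4 * μ) = 1 / 4 * μ * y ^ 2 + x ^ 2 / (4 * μ) + 1 / 2 * x * y := by
      field_simp
      ring
    linarith
  have h2 : ε * (x ^ 2 / (4 * μ)) ≤ 1 / 32 * B := by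
    rw [← mul_div_assoc, div_le_iff₀ (by positivity)]
    have := mul_le_mul_of_nonneg_left hx hε.le
    have := mul_le_mul_of_nonneg_right hεA hB
    linarith
  have := mul_le_mul_of_nonneg_left h1 hε.le
  linarith

/-- Momentum is controlled by `X`, hence by the dissipation through Korn's inequality; the velocity
of the surface is controlled by the dissipation through the trace estimate. -/
theorem coupling_term_le {X B p q x y ε C₁ C₃ cP : ℝ} (hε : 0 < ε) (hcP : 0 < cP) (hC₁ : 0 ≤ C₁)
    (hεC : ε * (2 * C₁ / cP + C₃) ≤ 1 / 8) (hB0 : 0 ≤ B) (hB : cP * X ≤ B)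
    (hp : p ^ 2 ≤ C₁ * X) (hq : q ^ 2 ≤ C₁ * X) (hxy : x ^ 2 + y ^ 2 ≤ C₃ * B) :
    ε * (p * x + q * y) ≤ 1 / 16 * B := by
  have hXB : X ≤ B / cP := (le_div_iff₀ hcP).2 (by linarith)
  have h1 : p * x + q * y ≤ 1 / 2 * ((2 * C₁ / cP + C₃) * B) := by
    have h2 : C₁ * X ≤ C₁ * (B / cP) := mul_le_mul_of_nonneg_left hXB hC₁
    have e : (2 * C₁ / cP + C₃) * B = 2 * (C₁ * (B / cP)) + C₃ * B := by ring
    linarith [sq_nonneg (p - x), sq_nonneg (q - y), sub_sq p x, sub_sq q y]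
  have := mul_le_mul_of_nonneg_left h1 hε.le
  have := mul_le_mul_of_nonneg_right hεC hB0
  linarith

/-- Decay of the solutions of a damped system of differential equations, where `X` and `B` are the
kinetic energy and the dissipation, `(c, d)` the elevation and `(p, q)` the momentum that is
conjugate to it. -/
theorem lyapunov_decay {T : ℝ} (hT : 0 ≤ T) {X X' c c' d d' p p' q q' a b B : ℝ → ℝ}
    {μ ε A C₁ C₃ cP : ℝ} (hε : 0 < ε) (hcP : 0 < cP) (hC₁ : 0 ≤ C₁)
    (hεA : ε * A ≤ μ / 8) (hεC : ε * (2 * C₁ / cP + C₃) ≤ 1 / 8) (hεP : ε ≤ cP)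
    (hε1 : ε * C₁ ≤ 1 / 4) (hεμ : 2 * ε ≤ μ)
    (hX : IsPrimitiveOn T X X') (hc : IsPrimitiveOn T c c') (hd : IsPrimitiveOn T d d')
    (hp : IsPrimitiveOn T p p') (hq : IsPrimitiveOn T q q') (hX0 : ∀ t, 0 ≤ X t)
    (hpX : ∀ t, p t ^ 2 ≤ C₁ * X t) (hqX : ∀ t, q t ^ 2 ≤ C₁ * X t)
    (h : ∀ᵐ t ∂volume.restrict (Ioo 0 T), X' t = -B t - 2 * (μ * (c t * c' t + d t * d' t)) ∧
      p' t = -(1 / 2) * a t - 1 / 2 * (μ * c t) ∧ q' t = -(1 / 2) * b t - 1 / 2 * (μ * d t) ∧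
      cP * X t ≤ B t ∧ c' t ^ 2 + d' t ^ 2 ≤ C₃ * B t ∧ a t ^ 2 ≤ A * B t ∧ b t ^ 2 ≤ A * B t) :
    ∀ t ∈ Icc 0 T, X t + μ * (c t ^ 2 + d t ^ 2) ≤
      4 * Real.exp (-(ε / 4) * t) * (X 0 + μ * (c 0 ^ 2 + d 0 ^ 2)) := by
  have hμ : 0 < μ := by linarith
  -- The functional is `½ (X + μ (c² + d²)) + ε (p c + q d)`. By `hcross` it lies between `1/4` and
  -- `3/4` of `X + μ (c² + d²)`, hence the factor `4` in the conclusion.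
  have hL := (((hX.const_mul (1 / 2)).add (((hc.mul hT hc).add (hd.mul hT hd)).const_mul
    (μ / 2))).add (((hp.mul hT hc).add (hq.mul hT hd)).const_mul ε))
  have hcross : ∀ t, |ε * (p t * c t + q t * d t)| ≤
      1 / 4 * (X t + μ * (c t ^ 2 + d t ^ 2)) := fun t =>
    abs_cross_le hε (hX0 t) hε1 hεμ (hpX t) (hqX t)
  have hdecay := hL.le_exp_mul hT (ε / 4) ?_
  · intro t ht
    have h1 := hdecay t ht
    have h2 := abs_le.1 (hcross t)
    have h3 := abs_le.1 (hcross 0)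
    have he := (Real.exp_pos (-(ε / 4) * t)).le
    have h4 : 1 / 4 * (X t + μ * (c t ^ 2 + d t ^ 2)) ≤ Real.exp (-(ε / 4) * t) *
        (X 0 + μ * (c 0 ^ 2 + d 0 ^ 2)) := by
      refine le_trans ?_ (h1.trans (mul_le_mul_of_nonneg_left ?_ he))
      · linarith [mul_nonneg hμ.le (add_nonneg (sq_nonneg (c t)) (sq_nonneg (d t))), hX0 t]
      · linarith [hX0 0, mul_nonneg hμ.le (add_nonneg (sq_nonneg (c 0)) (sq_nonneg (d 0)))]
    linarith
  -- The dissipation `½ B` loses `2 · B/32` to the viscous terms and `B/16` to the coupling. What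
  -- remains is `3/8 B + ¼ ε μ (c² + d²)`, and `ε X ≤ B` lets it dominate `ε/4` times the
  -- functional.
  · filter_upwards [h] with t ht
    obtain ⟨e1, e2, e3, hB, htr, ha, hb⟩ := ht
    have hB0 : 0 ≤ B t := (mul_nonneg hcP.le (hX0 t)).trans hB
    have f2 := coupling_term_le hε hcP hC₁ hεC hB0 hB (hpX t) (hqX t) htr
    have f3 := damping_term_le (y := c t) hε hμ hB0 hεA ha
    have f4 := damping_term_le (y := d t) hε hμ hB0 hεA hb
    have f5 := (abs_le.1 (hcross t)).2
    have f6 : ε * X t ≤ B t := (mul_le_mul_of_nonneg_right hεP (hX0 t)).trans hB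
    have f7 : 0 ≤ X t + μ * (c t ^ 2 + d t ^ 2) := by
      have := hX0 t
      positivity
    have f8 : ε / 4 * (1 / 2 * X t + μ / 2 * (c t * c t + d t * d t) +
        ε * (p t * c t + q t * d t)) ≤ ε / 4 * (X t + μ * (c t ^ 2 + d t ^ 2)) :=
      mul_le_mul_of_nonneg_left (by linarith) (by positivity)
    rw [e1, e2, e3]
    linarith

end

section

variable {n : ℕ} {ℓ : ℝ}

/-! ### Continuous representatives of a weak solution -/

/-- `U` and `H` are representatives of `u` and `h` that are continuous in time, and for which the
equations hold in integrated form. -/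
structure IsRepresentative (u₀ : L2Vec n ℓ) (h₀ : L2Torus n) (u : ℝ → divFree n ℓ)
    (h : ℝ → L2Torus n) (du : ℝ → (divFree n ℓ →L[ℝ] ℝ)) (dh : ℝ → L2Torus n)
    (U : ℝ → L2Vec n ℓ) (H : ℝ → L2Torus n) : Prop where
  continuousOn_fst : ContinuousOn U (Ici 0)
  continuousOn_snd : ContinuousOn H (Ici 0)
  fst_eq : ∀ᵐ t ∂volume.restrict (Ioi 0), velocity n ℓ (u t) = U t
  snd_eq : ∀ᵐ t ∂volume.restrict (Ioi 0), h t = H t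
  fst_zero : U 0 = u₀
  snd_zero : H 0 = h₀
  fst_primitive : ∀ v T, 0 ≤ T →
    IsPrimitiveOn T (fun t => ⟪U t, velocity n ℓ v⟫_ℝ) (fun t => du t v)
  snd_primitive : ∀ ψ T, 0 ≤ T → IsPrimitiveOn T (fun t => ⟪H t, ψ⟫_ℝ) (fun t => ⟪dh t, ψ⟫_ℝ)
  energy_primitive : ∀ ξ T, 0 ≤ T →
    IsPrimitiveOn T (fun t => ⟪(slabTranslation n ℓ _).average ξ (U t), U t⟫_ℝ)
      (fun t => 2 * du t ((divFreeTranslation n ℓ).average ξ (u t)))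

theorem memL2Loc_of_sobolevSq {dh : ℝ → L2Torus n} {s : ℝ} (hs : 0 ≤ s)
    (hm : ∀ T : ℝ, 0 < T → AEStronglyMeasurable dh (volume.restrict (Ioo 0 T)))
    (hfin : ∀ T : ℝ, 0 < T → ∫⁻ t in Ioo 0 T, sobolevSq s (dh t) < ⊤) : MemL2Loc dh := by
  intro T hT
  refine ⟨hm T hT, ?_⟩
  rw [eLpNorm_lt_top_iff_lintegral_rpow_enorm_lt_top (by norm_num) (by norm_num)]
  refine lt_of_le_of_lt (lintegral_mono fun t => ?_) (hfin T hT)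
  simpa using enorm_sq_le_sobolevSq hs (dh t)

/-- The representation theorem is applied to the velocity, with the projectors as commuting
self-adjoint operators, and to the elevation, with `V = H = L²(Σ)`. -/
theorem IsWeakSolutionWith.exists_representative {μ : (Fin n → ℤ) → ℝ} {u₀ : L2Vec n ℓ}
    {h₀ : L2Torus n} {u : ℝ → divFree n ℓ} {h : ℝ → L2Torus n} {du : ℝ → (divFree n ℓ →L[ℝ] ℝ)}
    {dh mh : ℝ → L2Torus n} (hw : IsWeakSolutionWith μ u₀ h₀ u h du dh mh) :
    ∃ U H, IsRepresentative u₀ h₀ u h du dh U H := by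
  obtain ⟨U, hU1, hU2, hU3, hU4, hU5⟩ := exists_continuous_representative (velocity n ℓ) hw.u_init
    hw.u_mem hw.du_mem hw.u_deriv
  -- `dh t` is viewed as a functional on `L²(Σ)` by the Riesz map; its `H^{1/2}` bound is used only
  -- through the `L²` norm.
  have hdh : MemL2Loc fun t => innerSL ℝ (dh t) := fun T hT =>
    (innerSL ℝ (E := L2Torus n)).comp_memLp'
      (memL2Loc_of_sobolevSq (by norm_num) hw.dh_meas hw.dh_mem T hT)
  obtain ⟨H, hH1, hH2, hH3, hH4, -⟩ := exists_continuous_representative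
    (ContinuousLinearMap.id ℝ (L2Torus n)) (u₀ := h₀) (u := h) (du := fun t => innerSL ℝ (dh t))
    (subset_closure ⟨h₀, rfl⟩) hw.h_mem hdh hw.h_deriv
  exact ⟨U, H, hU1, hH1, hU2, hH2, hU3, hH3, hU4, hH4, fun ξ => hU5 _ _ (velocity_average ξ)
    (inner_average_comm ξ)⟩

/-! ### Decay at a single frequency -/

theorem fracSymbol_ge {g σ r : ℝ} (hσ : 0 < σ) (ξ : Fin n → ℤ) :
    g ≤ fracSymbol g σ r ξ := by
  unfold fracSymbol
  have : 0 ≤ (2 * Real.pi * freqNorm ξ) ^ (2 * r) :=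
    Real.rpow_nonneg (mul_nonneg (by positivity) (Real.sqrt_nonneg _)) _
  nlinarith

theorem fracSymbol_ge_rpow {g σ r : ℝ} (hg : 0 < g) (hσ : 0 < σ) (hr0 : 0 ≤ r) (ξ : Fin n → ℤ) :
    σ * freqNorm ξ ^ (2 * r) ≤ fracSymbol g σ r ξ := by
  unfold fracSymbol
  have hk : 0 ≤ freqNorm ξ := Real.sqrt_nonneg _
  have h1 : freqNorm ξ ^ (2 * r) ≤ (2 * Real.pi * freqNorm ξ) ^ (2 * r) := by
    refine Real.rpow_le_rpow hk ?_ (by linarith)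
    nlinarith [Real.pi_gt_three]
  nlinarith

section ModeDecay

variable {g σ r : ℝ} {u₀ : L2Vec n ℓ} {h₀ : L2Torus n} {u : ℝ → divFree n ℓ} {h : ℝ → L2Torus n}
  {du : ℝ → (divFree n ℓ →L[ℝ] ℝ)} {dh mh : ℝ → L2Torus n} {U : ℝ → L2Vec n ℓ} {H : ℝ → L2Torus n}
  {μ : (Fin n → ℤ) → ℝ}

theorem ae_restrict_Ioo_of_Ioi {p : ℝ → Prop} (h : ∀ᵐ t ∂volume.restrict (Ioi 0), p t) (T : ℝ) :
    ∀ᵐ t ∂volume.restrict (Ioo 0 T), p t :=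
  ae_mono (Measure.restrict_mono Ioo_subset_Ioi_self le_rfl) h

/-- The energy identity at a single frequency. -/
theorem IsWeakSolutionWith.energy_mode (hw : IsWeakSolutionWith μ u₀ h₀ u h du dh mh)
    (hR : IsRepresentative u₀ h₀ u h du dh U H) (ξ : Fin n → ℤ) {T : ℝ} (hT : 0 < T) :
    ∀ᵐ t ∂volume.restrict (Ioo 0 T), 2 * du t ((divFreeTranslation n ℓ).average ξ (u t)) =
      -⟪(slabTranslation n ℓ _).average ξ (symGrad n ℓ (u t)), symGrad n ℓ (u t)⟫_ℝ -
        2 * (μ ξ * (cosMode ξ (H t) * cosMode ξ (dh t) + sinMode ξ (H t) * sinMode ξ (dh t))) := by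
  have hmom := hw.momentum T hT (fun t => (divFreeTranslation n ℓ).average ξ (u t))
    (((divFreeTranslation n ℓ).average ξ).comp_memLp' (hw.u_mem T hT))
    (fun t => (torusTranslation n).average ξ (dh t))
    (by filter_upwards [ae_restrict_Ioo_of_Ioi hw.kinematic T] with t ht using ht.average ξ)
  filter_upwards [hmom, ae_restrict_Ioo_of_Ioi hw.mh_eq T, ae_restrict_Ioo_of_Ioi hR.snd_eq T]
    with t h1 h2 h3
  rw [symGradInner_eq, symGrad_average, real_inner_comm, integral_mul_torusAverage,
    (h2.modes ξ).1, (h2.modes ξ).2, h3] at h1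
  linarith

/-- The momentum balance tested with the projection of a fixed field. -/
theorem IsWeakSolutionWith.momentum_mode (hw : IsWeakSolutionWith μ u₀ h₀ u h du dh mh)
    (ξ : Fin n → ℤ) {T : ℝ} (hT : 0 < T) {v : divFree n ℓ} {b : L2Torus n} (hv : IsTopTraceOf v b) :
    ∀ᵐ t ∂volume.restrict (Ioo 0 T), du t ((divFreeTranslation n ℓ).average ξ v) =
      -(1 / 2) * ⟪(slabTranslation n ℓ _).average ξ (symGrad n ℓ (u t)), symGrad n ℓ v⟫_ℝ -
        ∫ x, mh t x * (torusTranslation n).average ξ b x ∂torusMeasure n := by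
  have hmom := hw.momentum T hT (fun _ => (divFreeTranslation n ℓ).average ξ v) (memLp_const _)
    (fun _ => (torusTranslation n).average ξ b) (ae_of_all _ fun t => hv.average ξ)
  filter_upwards [hmom] with t h1
  rw [symGradInner_eq, symGrad_average, ← inner_average_comm] at h1
  linarith

theorem IsRepresentative.cosMode_primitive (hR : IsRepresentative u₀ h₀ u h du dh U H)
    (ξ : Fin n → ℤ) {T : ℝ} (hT : 0 ≤ T) :
    IsPrimitiveOn T (fun t => cosMode ξ (H t)) (fun t => cosMode ξ (dh t)) := by
  have := hR.snd_primitive (isSmoothChar_cosChar ξ).toLp T hT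
  simp only [IsSmoothChar.inner_toLp] at this
  exact this

theorem IsRepresentative.sinMode_primitive (hR : IsRepresentative u₀ h₀ u h du dh U H)
    (ξ : Fin n → ℤ) {T : ℝ} (hT : 0 ≤ T) :
    IsPrimitiveOn T (fun t => sinMode ξ (H t)) (fun t => sinMode ξ (dh t)) := by
  have := hR.snd_primitive (isSmoothChar_sinChar ξ).toLp T hT
  simp only [IsSmoothChar.inner_toLp] at this
  exact this

/-- Twice the energy at the frequency `ξ`. -/
def modeEnergy (μ : (Fin n → ℤ) → ℝ) (ξ : Fin n → ℤ) (w : L2Vec n ℓ) (b : L2Torus n) : ℝ :=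
  ⟪(slabTranslation n ℓ _).average ξ w, w⟫_ℝ + μ ξ * (cosMode ξ b ^ 2 + sinMode ξ b ^ 2)

/-- Zero average removes `h` at this frequency, so the kinetic part decays by Korn's inequality
alone. -/
theorem IsWeakSolutionWith.decay_mode_zero (hℓ : 0 < ℓ)
    (hw : IsWeakSolutionWith μ u₀ h₀ u h du dh mh) (hR : IsRepresentative u₀ h₀ u h du dh U H)
    {t : ℝ} (ht : 0 < t) :
    modeEnergy μ 0 (U t) (H t) ≤ Real.exp (-(min (ℓ ^ 2)⁻¹ (8 * Real.pi ^ 2)) * t) *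
      modeEnergy μ 0 (U 0) (H 0) := by
  have hc := hR.cosMode_primitive 0 ht.le
  have hs := hR.sinMode_primitive 0 ht.le
  have hL := (hR.energy_primitive 0 t ht.le).add
    (((hc.mul ht.le hc).add (hs.mul ht.le hs)).const_mul (μ 0))
  have := hL.le_exp_mul ht.le (min (ℓ ^ 2)⁻¹ (8 * Real.pi ^ 2)) ?_ t ⟨ht.le, le_rfl⟩
  · simpa only [modeEnergy, sq] using this
  · filter_upwards [hw.energy_mode hR 0 ht, ae_restrict_Ioo_of_Ioi hR.fst_eq t,
      ae_restrict_Ioo_of_Ioi hR.snd_eq t, ae_restrict_Ioo_of_Ioi hw.zero_avg t] with τ h1 h2 h3 h4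
    have e1 : cosMode 0 (H τ) = 0 := by
      rw [← h3]
      simpa only [cosMode, cosChar_zero, mul_one] using h4
    have e2 : ∀ b : L2Torus n, sinMode 0 b = 0 := fun b => by simp [sinMode, sinChar_zero]
    have h5 := korn_average hℓ 0 (u τ)
    rw [h2] at h5
    rw [h1]
    simp only [e1, e2]
    linarith

theorem sq_le_mul_of_le {A B x y : ℝ} (h : x ^ 2 ≤ A * y) (hy : y ≤ B) (hA : 0 ≤ A) :
    x ^ 2 ≤ B * A := by
  nlinarith

/-- The lifts of `cos` and `sin` provide the conjugate momenta `p` and `q` of `lyapunov_decay`.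
There `A = 4 C₂ |ξ|`, where the `4` comes from the symmetrization bound, and `C₃ = ℓ/4`. -/
theorem IsWeakSolutionWith.decay_mode (hℓ : 0 < ℓ)
    (hw : IsWeakSolutionWith μ u₀ h₀ u h du dh mh) (hR : IsRepresentative u₀ h₀ u h du dh U H)
    {ξ : Fin n → ℤ} (hξ : ξ ≠ 0) {ε C₁ C₂ cP : ℝ} (hcP : cP = min (ℓ ^ 2)⁻¹ (8 * Real.pi ^ 2))
    (hC₁ : C₁ = ℓ * (1 + 4 / (Real.pi ^ 2 * ℓ ^ 2)))
    (hC₂ : C₂ = ℓ * (4 * Real.pi ^ 2 + 32 / ℓ ^ 2 + 64 / (Real.pi ^ 2 * ℓ ^ 4)))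
    (hε : 0 < ε) (hεA : ε * (4 * (C₂ * freqNorm ξ)) ≤ μ ξ / 8)
    (hεC : ε * (2 * C₁ / cP + ℓ / 4) ≤ 1 / 8) (hεP : ε ≤ cP) (hε1 : ε * C₁ ≤ 1 / 4)
    (hεμ : 2 * ε ≤ μ ξ) {t : ℝ} (ht : 0 < t) :
    modeEnergy μ ξ (U t) (H t) ≤ 4 * Real.exp (-(ε / 4) * t) * modeEnergy μ ξ (U 0) (H 0) := by
  obtain ⟨v, hv1, hv2, hv3⟩ := exists_trace_lift hℓ hξ (isConjugatePair_cos_sin ξ)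
  obtain ⟨v', hv1', hv2', hv3'⟩ := exists_trace_lift hℓ hξ (isConjugatePair_sin_cos ξ)
  rw [← hC₁] at hv1 hv1'
  rw [← hC₂] at hv2 hv2'
  have hsym : ∀ v : divFree n ℓ, ‖gradient n ℓ v‖ ^ 2 ≤ C₂ * freqNorm ξ →
      ‖symGrad n ℓ v‖ ^ 2 ≤ 4 * (C₂ * freqNorm ξ) := fun v hv => by
    have h1 : ‖symGrad n ℓ v‖ ≤ 2 * ‖gradient n ℓ v‖ := norm_symOp_le _
    have h2 := pow_le_pow_left₀ (norm_nonneg _) h1 2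
    rw [mul_pow] at h2
    linarith
  have hcP0 : 0 < cP := by rw [hcP]; positivity
  have hC₁0 : 0 ≤ C₁ := by rw [hC₁]; positivity
  have hprim : ∀ v : divFree n ℓ, IsPrimitiveOn t
      (fun τ => ⟪(slabTranslation n ℓ _).average ξ (U τ), velocity n ℓ v⟫_ℝ)
      (fun τ => du τ ((divFreeTranslation n ℓ).average ξ v)) := fun v => by
    have := hR.fst_primitive ((divFreeTranslation n ℓ).average ξ v) t ht.le
    simpa only [velocity_average, ← inner_average_comm] using this
  have hbound : ∀ v : divFree n ℓ, ‖velocity n ℓ v‖ ^ 2 ≤ C₁ → ∀ τ,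
      ⟪(slabTranslation n ℓ _).average ξ (U τ), velocity n ℓ v⟫_ℝ ^ 2 ≤
        C₁ * ⟪(slabTranslation n ℓ _).average ξ (U τ), U τ⟫_ℝ := fun v hv τ =>
    sq_le_mul_of_le (sq_inner_average_le ξ (U τ) (velocity n ℓ v)) hv
      (inner_average_self_nonneg ξ _)
  refine lyapunov_decay ht.le hε hcP0 hC₁0 hεA hεC hεP hε1 hεμ
    (B := fun τ => ⟪(slabTranslation n ℓ _).average ξ (symGrad n ℓ (u τ)), symGrad n ℓ (u τ)⟫_ℝ)
    (a := fun τ => ⟪(slabTranslation n ℓ _).average ξ (symGrad n ℓ (u τ)), symGrad n ℓ v⟫_ℝ)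
    (b := fun τ => ⟪(slabTranslation n ℓ _).average ξ (symGrad n ℓ (u τ)), symGrad n ℓ v'⟫_ℝ)
    (hR.energy_primitive ξ t ht.le) (hR.cosMode_primitive ξ ht.le) (hR.sinMode_primitive ξ ht.le)
    (hprim v) (hprim v') (fun τ => inner_average_self_nonneg ξ _) (hbound v hv1) (hbound v' hv1')
    ?_ t ⟨ht.le, le_rfl⟩
  filter_upwards [hw.energy_mode hR ξ ht,
    hw.momentum_mode ξ ht (hv3 _ (isSmoothChar_cosChar ξ).coeFn_toLp),
    hw.momentum_mode ξ ht (hv3' _ (isSmoothChar_sinChar ξ).coeFn_toLp),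
    ae_restrict_Ioo_of_Ioi hR.fst_eq t, ae_restrict_Ioo_of_Ioi hR.snd_eq t,
    ae_restrict_Ioo_of_Ioi hw.mh_eq t, ae_restrict_Ioo_of_Ioi hw.kinematic t]
    with τ h1 h2 h3 h4 h5 h6 h7
  rw [integral_mul_average_cosChar hξ, (h6.modes ξ).1, h5] at h2
  rw [integral_mul_average_sinChar hξ, (h6.modes ξ).2, h5] at h3
  refine ⟨h1, h2, h3, ?_, ?_, ?_, ?_⟩
  · rw [hcP, ← h4]
    exact korn_average hℓ ξ (u τ)
  -- The trace costs a factor `ℓ`, and the vertical diagonal entry of `𝔻u` gains `4`: together `C₃ =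
  -- ℓ/4`.
  · have e1 := modes_sq_le hℓ ξ h7
    have e2 := mul_le_mul_of_nonneg_left (four_mul_modeSq_le ξ (u τ)) hℓ.le
    linarith
  · exact sq_le_mul_of_le (sq_inner_average_le ξ _ _) (hsym v hv2) (inner_average_self_nonneg ξ _)
  · exact sq_le_mul_of_le (sq_inner_average_le ξ _ _) (hsym v' hv2') (inner_average_self_nonneg ξ _)

end ModeDecay

end

section

variable {n : ℕ} {ℓ : ℝ}

/-! ### Summation over the frequencies -/

/-- Among the smallness conditions on `ε` only the one involving `|ξ|` degenerates at high
frequency. Since `μ(ξ) ≥ σ |ξ|^(2r)`, it is met by a fixed multiple of `|ξ|^(2r-1)`, which dominates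
`(1+|ξ|²)^(-(1/2-r))`. -/
theorem exists_decay_rate (n : ℕ) {ℓ g σ r : ℝ} (hℓ : 0 < ℓ) (hg : 0 < g) (hσ : 0 < σ)
    (hr0 : 0 ≤ r) (hr : r < 1 / 2) :
    ∃ ρ : ℝ, 0 < ρ ∧ ∀ (u₀ : L2Vec n ℓ) (h₀ : L2Torus n) (u : ℝ → divFree n ℓ) (h : ℝ → L2Torus n)
      (du : ℝ → (divFree n ℓ →L[ℝ] ℝ)) (dh mh : ℝ → L2Torus n) (U : ℝ → L2Vec n ℓ)
      (H : ℝ → L2Torus n), IsWeakSolutionWith (fracSymbol g σ r) u₀ h₀ u h du dh mh →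
      IsRepresentative u₀ h₀ u h du dh U H → ∀ (ξ : Fin n → ℤ) (t : ℝ), 0 ≤ t →
      modeEnergy (fracSymbol g σ r) ξ (U t) (H t) ≤
        4 * Real.exp (-ρ * ((1 + freqNorm ξ ^ 2) ^ (-(1 / 2 - r)) * t)) *
          modeEnergy (fracSymbol g σ r) ξ (U 0) (H 0) := by
  obtain ⟨cP, hcP⟩ : ∃ c, c = min (ℓ ^ 2)⁻¹ (8 * Real.pi ^ 2) := ⟨_, rfl⟩
  obtain ⟨C₁, hC₁⟩ : ∃ c, c = ℓ * (1 + 4 / (Real.pi ^ 2 * ℓ ^ 2)) := ⟨_, rfl⟩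
  obtain ⟨C₂, hC₂⟩ : ∃ c, c = ℓ * (4 * Real.pi ^ 2 + 32 / ℓ ^ 2 + 64 / (Real.pi ^ 2 * ℓ ^ 4)) :=
    ⟨_, rfl⟩
  have hcP0 : 0 < cP := by rw [hcP]; positivity
  have hC₁0 : 0 < C₁ := by rw [hC₁]; positivity
  have hC₂0 : 0 < C₂ := by rw [hC₂]; positivity
  have hD0 : 0 < 2 * C₁ / cP + ℓ / 4 := by positivity
  -- One bound for each smallness condition of `decay_mode`, stripped of its dependence on the
  -- frequency; `32 = 8 · 4` collects the constants of the first.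
  obtain ⟨ε, hε, hε1, hε2, hε3, hε4, hε5⟩ : ∃ ε > 0, ε ≤ σ / (32 * C₂) ∧
      ε ≤ 1 / (8 * (2 * C₁ / cP + ℓ / 4)) ∧ ε ≤ cP ∧ ε ≤ 1 / (4 * C₁) ∧ ε ≤ g / 2 :=
    ⟨min (σ / (32 * C₂)) (min (1 / (8 * (2 * C₁ / cP + ℓ / 4))) (min cP
      (min (1 / (4 * C₁)) (g / 2)))),
      by positivity, min_le_left _ _, (min_le_right _ _).trans (min_le_left _ _),
      (min_le_right _ _).trans ((min_le_right _ _).trans (min_le_left _ _)),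
      (min_le_right _ _).trans ((min_le_right _ _).trans ((min_le_right _ _).trans
        (min_le_left _ _))), (min_le_right _ _).trans ((min_le_right _ _).trans
        ((min_le_right _ _).trans (min_le_right _ _)))⟩
  rw [le_div_iff₀ (by positivity)] at hε1 hε2 hε4
  refine ⟨ε / 4, by positivity, fun u₀ h₀ u h du dh mh U H hw hR ξ t ht => ?_⟩
  have hμg := fracSymbol_ge (g := g) (r := r) hσ ξ
  have hE0 : 0 ≤ modeEnergy (fracSymbol g σ r) ξ (U 0) (H 0) :=
    add_nonneg (inner_average_self_nonneg ξ _) (mul_nonneg (hg.le.trans hμg) (by positivity))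
  have hw1 : 1 ≤ 1 + freqNorm ξ ^ 2 := by linarith [sq_nonneg (freqNorm ξ)]
  have hy1 : (1 + freqNorm ξ ^ 2) ^ (-(1 / 2 - r)) ≤ 1 :=
    Real.rpow_le_one_of_one_le_of_nonpos hw1 (by linarith)
  -- The estimates at a single frequency work on `(0, t)` with `t > 0`; time `0` is trivial.
  rcases ht.eq_or_lt with rfl | ht
  · rw [mul_zero, mul_zero, Real.exp_zero]
    linarith
  by_cases hξ : ξ = 0
  · subst hξ
    refine (hw.decay_mode_zero hℓ hR ht).trans (mul_le_mul_of_nonneg_right ?_ hE0)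
    rw [← hcP]
    have : Real.exp (-cP * t) ≤
        Real.exp (-(ε / 4) * ((1 + freqNorm (0 : Fin n → ℤ) ^ 2) ^ (-(1 / 2 - r)) * t)) := by
      rw [Real.exp_le_exp]
      have := mul_le_mul_of_nonneg_right hy1 (mul_nonneg (by positivity : 0 ≤ ε / 4) ht.le)
      have := mul_le_mul_of_nonneg_right hε3 ht.le
      have := mul_nonneg hcP0.le ht.le
      linarith
    have := Real.exp_pos (-(ε / 4) * ((1 + freqNorm (0 : Fin n → ℤ) ^ 2) ^ (-(1 / 2 - r)) * t))
    linarith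
  have hk1 := one_le_freqNorm hξ
  have hk0 : 0 < freqNorm ξ := zero_lt_one.trans_le hk1
  have hμ := fracSymbol_ge_rpow hg hσ hr0 ξ
  set κ := freqNorm ξ with hκ
  have hpow : κ ^ (2 * r - 1) * κ = κ ^ (2 * r) := by
    rw [← Real.rpow_add_one hk0.ne']; congr 1; ring
  have hp1 : κ ^ (2 * r - 1) ≤ 1 := Real.rpow_le_one_of_one_le_of_nonpos hk1 (by linarith)
  have hp0 : 0 < κ ^ (2 * r - 1) := Real.rpow_pos_of_pos hk0 _
  -- Because `r < 1/2`, the rate at frequency `ξ` is at most `ε`, so the conditions free of the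
  -- frequency are inherited.
  have hεε : ε * κ ^ (2 * r - 1) ≤ ε := mul_le_of_le_one_right hε.le hp1
  have hkap : (1 + κ ^ 2) ^ (-(1 / 2 - r)) ≤ κ ^ (2 * r - 1) := by
    have e : κ ^ (2 * r - 1) = (κ ^ 2) ^ (-(1 / 2 - r)) := by
      rw [← Real.rpow_natCast, ← Real.rpow_mul hk0.le]; congr 1; push_cast; ring
    rw [e]
    exact Real.rpow_le_rpow_of_nonpos (by positivity) (by linarith) (by linarith)
  refine (hw.decay_mode hℓ hR hξ hcP hC₁ hC₂ (ε := ε * κ ^ (2 * r - 1)) (by positivity) ?_ ?_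
    (hεε.trans hε3) ?_ (by linarith) ht).trans (mul_le_mul_of_nonneg_right ?_ hE0)
  · have h1 : ε * κ ^ (2 * r - 1) * (4 * (C₂ * κ)) = 1 / 8 * (ε * (32 * C₂)) * κ ^ (2 * r) := by
      rw [← hpow]; ring
    rw [h1]
    have := mul_le_mul_of_nonneg_right hε1 (Real.rpow_nonneg hk0.le (2 * r))
    linarith
  · have := mul_le_mul_of_nonneg_right hεε hD0.le
    linarith
  · have := mul_le_mul_of_nonneg_right hεε hC₁0.le
    linarith
  · refine mul_le_mul_of_nonneg_left (Real.exp_le_exp.2 ?_) (by norm_num)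
    have := mul_le_mul_of_nonneg_left hkap (mul_nonneg hε.le ht.le)
    linarith

/-- An exponential rate that degenerates with the frequency gives an algebraic one, at the price of
derivatives of the data. -/
theorem exp_neg_le_mul_rpow {ρ q y t : ℝ} (hρ : 0 < ρ) (hq : 0 < q) (hy : 0 < y) (hy1 : y ≤ 1)
    (ht : 0 ≤ t) : Real.exp (-ρ * (y * t)) ≤ (1 + q / ρ) ^ q * y ^ (-q) * (1 + t) ^ (-q) := by
  have hτ : 0 ≤ y * t := mul_nonneg hy.le ht
  -- From `y ≤ 1` one has `y (1 + t) ≤ 1 + y t`, and `1 + x ≤ exp x` at `x = (ρ/q) y t` bounds this;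
  -- the scale `ρ/q` is chosen so that the `q`-th power has exponent `ρ y t`.
  have h1 : y * (1 + t) ≤ (1 + q / ρ) * Real.exp (ρ / q * (y * t)) := by
    have h2 := Real.add_one_le_exp (ρ / q * (y * t))
    have h3 : (1 + q / ρ) * (ρ / q * (y * t) + 1) =
        1 + y * t + (ρ / q * (y * t) + q / ρ) := by
      field_simp
      ring
    have h4 : 0 ≤ ρ / q * (y * t) + q / ρ := by positivity
    have h5 := mul_le_mul_of_nonneg_left h2 (by positivity : 0 ≤ 1 + q / ρ)
    linarith
  have h6 := Real.rpow_le_rpow (by positivity) h1 hq.le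
  rw [Real.mul_rpow (by positivity) (by positivity), Real.mul_rpow (by positivity) (by positivity),
    ← Real.exp_mul] at h6
  have e : ρ / q * (y * t) * q = ρ * (y * t) := by field_simp
  rw [e] at h6
  have hy' := Real.rpow_pos_of_pos hy q
  have ht' : 0 < (1 + t) ^ q := Real.rpow_pos_of_pos (by positivity) q
  rw [Real.rpow_neg hy.le, Real.rpow_neg (by positivity), neg_mul, Real.exp_neg, mul_assoc,
    ← mul_inv, ← div_eq_mul_inv, inv_eq_one_div, div_le_div_iff₀ (Real.exp_pos _) (by positivity)]
  linarith

theorem fracSymbol_le {g σ r : ℝ} (hg : 0 < g) (hσ : 0 < σ) (hr0 : 0 ≤ r) (ξ : Fin n → ℤ) :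
    fracSymbol g σ r ξ ≤ (g + σ * (2 * Real.pi) ^ (2 * r)) * (1 + freqNorm ξ ^ 2) ^ r := by
  have hk : 0 ≤ freqNorm ξ := Real.sqrt_nonneg _
  have h1 : 1 ≤ (1 + freqNorm ξ ^ 2) ^ r :=
    Real.one_le_rpow (by linarith [sq_nonneg (freqNorm ξ)]) hr0
  have h2 : freqNorm ξ ^ (2 * r) ≤ (1 + freqNorm ξ ^ 2) ^ r := by
    rw [Real.rpow_mul hk, Real.rpow_two]
    exact Real.rpow_le_rpow (sq_nonneg _) (by linarith) hr0
  have hpi : 0 ≤ (2 * Real.pi) ^ (2 * r) := by positivity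
  rw [fracSymbol, Real.mul_rpow (by positivity) hk, add_mul]
  refine add_le_add (le_mul_of_one_le_right hg.le h1) ?_
  rw [← mul_assoc]
  exact mul_le_mul_of_nonneg_left h2 (by positivity)

theorem energy_eq_tsum {μ : (Fin n → ℤ) → ℝ} (hμ : ∀ ξ, 0 ≤ μ ξ) (w : L2Vec n ℓ) (b : L2Torus n) :
    energy μ w b = 2⁻¹ * ∑' ξ, ENNReal.ofReal (modeEnergy μ ξ w b) := by
  rw [energy, lintegral_enorm_sq_slab_eq, ← mul_add, ← ENNReal.tsum_add]
  congr 2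
  funext ξ
  rw [enorm_fourier_sq_eq_modes, modeEnergy, ENNReal.ofReal_add (inner_average_self_nonneg ξ w)
    (mul_nonneg (hμ ξ) (by positivity)), ENNReal.ofReal_mul (hμ ξ)]

end

end FluidLayer

end


/-! ### The decay theorem -/

theorem theorem4p3 (n : ℕ) (hn : 1 ≤ n) (ℓ g σ r s : ℝ) (hℓ : 0 < ℓ) (hg : 0 < g) (hσ : 0 < σ)
    (hr0 : 0 ≤ r) (hr : r < 1 / 2) (hs : 0 < s) :
    ∃ K : ℝ, 0 < K ∧
      ∀ (u₀ : FluidLayer.L2Vec n ℓ) (h₀ : FluidLayer.L2Torus n)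
        (u : ℝ → FluidLayer.divFree n ℓ) (h : ℝ → FluidLayer.L2Torus n),
        FluidLayer.IsWeakSolution (FluidLayer.fracSymbol g σ r) u₀ h₀ u h →
        FluidLayer.sobolevSlabSq ℓ s u₀ < ⊤ →
        FluidLayer.sobolevSq (s + r) h₀ < ⊤ →
        -- the representatives of `u` and `h` that are continuous in time, with values in `L²`
        ∃ (U : ℝ → FluidLayer.L2Vec n ℓ) (H : ℝ → FluidLayer.L2Torus n),
          ContinuousOn U (Set.Ici 0) ∧ ContinuousOn H (Set.Ici 0) ∧
          (∀ᵐ t ∂volume.restrict (Set.Ioi 0), (u t).1.fst = U t ∧ h t = H t) ∧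
          U 0 = u₀ ∧ H 0 = h₀ ∧
          ∀ t : ℝ, 0 ≤ t →
            FluidLayer.energy (FluidLayer.fracSymbol g σ r) (U t) (H t) ≤
              ENNReal.ofReal K *
                (FluidLayer.sobolevSlabSq ℓ s u₀ + FluidLayer.sobolevSq (s + r) h₀) *
                ENNReal.ofReal ((1 + t) ^ (-s / (1 / 2 - r))) := by
  open FluidLayer in
  obtain ⟨ρ, hρ, hdecay⟩ := exists_decay_rate n hℓ hg hσ hr0 hr
  set q := s / (1 / 2 - r) with hq
  have hr' : 0 < 1 / 2 - r := by linarith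
  have hq0 : 0 < q := div_pos hs hr'
  set K₁ := (1 + q / ρ) ^ q with hK₁
  have hK₁0 : 0 < K₁ := by positivity
  set K₂ := g + σ * (2 * Real.pi) ^ (2 * r) with hK₂
  have hK₂0 : 0 < K₂ := by positivity
  -- The factor `2` is the `4` of the decay estimate times the `½` in the energy.
  refine ⟨2 * (K₁ * (1 + K₂)), by positivity, fun u₀ h₀ u h hw _ _ => ?_⟩
  obtain ⟨du, dh, mh, hw⟩ := hw
  obtain ⟨U, H, hR⟩ := hw.exists_representative
  refine ⟨U, H, hR.continuousOn_fst, hR.continuousOn_snd, hR.fst_eq.and hR.snd_eq, hR.fst_zero,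
    hR.snd_zero, fun t ht => ?_⟩
  have hmode : ∀ ξ, ENNReal.ofReal (modeEnergy (fracSymbol g σ r) ξ (U t) (H t)) ≤
      ENNReal.ofReal (4 * (K₁ * (1 + K₂)) * (1 + t) ^ (-q)) *
        (ENNReal.ofReal ((1 + freqNorm ξ ^ 2) ^ s) *
          ENNReal.ofReal ⟪(slabTranslation n ℓ _).average ξ u₀, u₀⟫_ℝ +
          ENNReal.ofReal ((1 + freqNorm ξ ^ 2) ^ (s + r)) * ‖fourier h₀ ξ‖ₑ ^ 2) := fun ξ => by
    have hw0 : 0 < 1 + freqNorm ξ ^ 2 := by positivity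
    have hX := inner_average_self_nonneg ξ u₀
    rw [enorm_fourier_sq_eq_modes, ← ENNReal.ofReal_mul (by positivity),
      ← ENNReal.ofReal_mul (by positivity), ← ENNReal.ofReal_add (by positivity) (by positivity),
      ← ENNReal.ofReal_mul (by positivity)]
    refine ENNReal.ofReal_le_ofReal ((hdecay u₀ h₀ u h du dh mh U H hw hR ξ t ht).trans ?_)
    rw [hR.fst_zero, hR.snd_zero, modeEnergy]
    have h1 := exp_neg_le_mul_rpow hρ hq0 (Real.rpow_pos_of_pos hw0 (-(1 / 2 - r)))
      (Real.rpow_le_one_of_one_le_of_nonpos (by linarith [sq_nonneg (freqNorm ξ)]) (by linarith)) ht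
    -- The choice of `q` makes the price of the algebraic rate exactly the weight of the `H^s` norm.
    have e1 : ((1 + freqNorm ξ ^ 2) ^ (-(1 / 2 - r))) ^ (-q) = (1 + freqNorm ξ ^ 2) ^ s := by
      rw [← Real.rpow_mul hw0.le, hq]
      rw [neg_mul_neg, mul_comm, div_mul_cancel₀ _ hr'.ne']
    rw [e1] at h1
    rw [Real.rpow_add hw0]
    have h2 := fracSymbol_le hg hσ hr0 ξ
    have hμ : 0 ≤ fracSymbol g σ r ξ := hg.le.trans (fracSymbol_ge hσ ξ)
    set W := cosMode ξ h₀ ^ 2 + sinMode ξ h₀ ^ 2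
    have hW : 0 ≤ W := by positivity
    set X := ⟪(slabTranslation n ℓ _).average ξ u₀, u₀⟫_ℝ
    set A := (1 + freqNorm ξ ^ 2) ^ s
    have hA : 0 < A := Real.rpow_pos_of_pos hw0 s
    set R := (1 + freqNorm ξ ^ 2) ^ r
    have hRp : 0 < R := Real.rpow_pos_of_pos hw0 r
    set Θ := (1 + t) ^ (-q)
    have hΘ : 0 < Θ := by positivity
    -- The symbol is bounded by `K₂ (1+|ξ|²)^r`, which raises the index of the norm of `h₀` from `s`
    -- to `s + r`.
    have h3 : X + fracSymbol g σ r ξ * W ≤ (1 + K₂) * (X + R * W) := by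
      have h4 := mul_le_mul_of_nonneg_right h2 hW
      have h5 := mul_nonneg hRp.le hW
      have h6 := mul_nonneg hK₂0.le hX
      linarith
    calc 4 * Real.exp (-ρ * ((1 + freqNorm ξ ^ 2) ^ (-(1 / 2 - r)) * t)) *
          (X + fracSymbol g σ r ξ * W)
        ≤ 4 * (K₁ * A * Θ) * ((1 + K₂) * (X + R * W)) :=
          mul_le_mul (mul_le_mul_of_nonneg_left h1 (by norm_num)) h3
            (add_nonneg hX (mul_nonneg hμ hW)) (by positivity)
      _ = _ := by ring
  rw [energy_eq_tsum fun ξ => hg.le.trans (fracSymbol_ge hσ ξ), sobolevSlabSq_eq, sobolevSq,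
    ← ENNReal.tsum_add, neg_div, ← hq]
  refine (mul_le_mul_right (ENNReal.tsum_le_tsum hmode) _).trans (le_of_eq ?_)
  rw [ENNReal.tsum_mul_left, ← mul_assoc, mul_right_comm (ENNReal.ofReal _)]
  congr 1
  have e2 : (2⁻¹ : ℝ≥0∞) = ENNReal.ofReal 2⁻¹ := by
    rw [ENNReal.ofReal_inv_of_pos (by norm_num), ENNReal.ofReal_ofNat]
  rw [e2, ← ENNReal.ofReal_mul (by norm_num), ← ENNReal.ofReal_mul (by positivity)]
  congr 1
  ring
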